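/- Let $\dot{\mathcal H}^{1/2}=\dot H^{1/2}(\mathbb R^3)\times\dot H^{-1/2}(\mathbb R^3)$ denote the space of pairs of real-valued tempered distributions with finite norm $\big(\|(-\Delta)^{1/4}f_0\|_{L^2}^2+\|(-\Delta)^{-1/4}f_1\|_{L^2}^2\big)^{1/2}$. For $\mathbf f=(f_0,f_1)\in\dot{\mathcal H}^{1/2}$ let $S\mathbf f(t)=\cos(t\sqrt{-\Delta})f_0+\frac{\sin(t\sqrt{-\Delta})}{\sqrt{-\Delta}}f_1$ be the solution of the linear wave equation with data $\mathbf f$ at $t=0$, and for $F\in L^{4/3}(\mathbb R^{1+3})$ let $$\Box^{-1}F(t,\cdot)=\int_{-\infty}^t\frac{\sin((t-s)\sqrt{-\Delta})}{\sqrt{-\Delta}}F(s,\cdot)\,ds .$$ For a function $u$ on $\mathbb R^{1+3}$ write $\mathbf u(t)=(u(t,\cdot),\partial_tu(t,\cdot))$. Fix $\sigma\in\mathbb R$. Call a real-valued $u$ a solution with datum $\mathbf f\in\dot{\mathcal H}^{1/2}$ if $u\in L^4(\mathbb R^{1+3})$, $\mathbf u\in C(\mathbb R;\dot{\mathcal H}^{1/2})$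 and $u=S\mathbf f+\sigma\,\Box^{-1}(u^3)$. For $\beta\in\mathbb R^3$ with $|\beta|<1$ let $L^\beta$ be the Lorentz boost of velocity $\beta$, that is, with $\gamma=(1-|\beta|^2)^{-1/2}$, $$L^\beta(t,x)=\Big(\gamma(t-\beta\cdot x),\ x+\big(\tfrac{\gamma^2}{\gamma+1}\,\beta\cdot x-\gamma t\big)\beta\Big).$$ For $t_0\in\mathbb R$, $x_0\in\mathbb R^3$, $\lambda>0$ put $\Lambda(t,x)=L^\beta(\lambda(t-t_0),\lambda(x-x_0))$ and $u_\Lambda(t,x)=\lambda\,u(\Lambda(t,x))$. **Theorem.** Let $u$ be a solution with datum $\mathbf f$, and let $\Lambda$ be as above. Then: 1. $u_\Lambda\in L^4(\mathbb R^{1+3})$, $\|u_\Lambda\|_{L^4}=\|u\|_{L^4}$, and $\mathbf u_\Lambda\in C(\mathbb R;\dot{\mathcal H}^{1/2})$. 2. There is a unique $\mathbf f_\Lambda\in\dot{\mathcal H}^{1/2}$ with $\lambda\,(S\mathbf f)\circ\Lambda=S\mathbf f_\Lambda$, and $u_\Lambda=S\mathbf f_\Lambda+\sigma\,\Box^{-1}(u_\Lambda^3)$.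 3. The limits $\lim_{t\to-\infty}\|\mathbf u(t)\|_{\dot{\mathcal H}^{1/2}}$ and $\lim_{t\to-\infty}\|\mathbf u_\Lambda(t)\|_{\dot{\mathcal H}^{1/2}}$ exist, are finite, and are equal. Consequently, for $\delta\ge0$ let $A(\delta)$ be the set of all solutions $u$ (with any datum in $\dot{\mathcal H}^{1/2}$) such that $\lim_{t\to-\infty}\|\mathbf u(t)\|_{\dot{\mathcal H}^{1/2}}\le\delta$, and let $I(\delta)=\sup\{\|u\|_{L^4}^4: u\in A(\delta)\}\in[0,\infty]$. Then $\{u_\Lambda:u\in A(\delta)\}=A(\delta)$ and $I(\delta)=\sup\{\|u_\Lambda\|_{L^4}^4:u\in A(\delta)\}$. -/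

import Mathlib

open MeasureTheory Filter Topology
open scoped ENNReal NNReal SchwartzMap FourierTransform

noncomputable section

namespace CubicWave

/-- Three-dimensional Euclidean space. Spacetime is `ℝ × E3`, a point being `(t, x)`, with
Lebesgue measure. -/
abbrev E3 : Type := EuclideanSpace ℝ (Fin 3)

/-! ### The homogeneous Sobolev spaces of order `1/2` and `-1/2` -/

/-- The Fourier transform of the tempered distribution `T` is the function `g`. -/
def IsFourierDensity (T : 𝓢'(E3, ℂ)) (g : E3 → ℂ) : Prop :=
  ∀ φ : 𝓢(E3, ℂ), Integrable (fun ξ => g ξ * φ ξ) ∧ 𝓕 T φ = ∫ ξ, g ξ * φ ξ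

/-- The homogeneous Sobolev norm `‖(-Δ)^{s/2} T‖_{L²} = ‖ |2πξ|^s T^ ‖_{L²}` of a tempered
distribution, for `|s| < 3/2`; it is `∞` if the Fourier transform of `T` is not a function. The
infimum is over the representatives of the almost-everywhere class of the Fourier transform, on
all of which the norm is the same. With the convention `e^{-2πi x·ξ}` for the Fourier transform,
the operator `√(-Δ)` has the symbol `2π|ξ|`. -/
def eHdotNorm (s : ℝ) (T : 𝓢'(E3, ℂ)) : ℝ≥0∞ :=
  ⨅ (g : E3 → ℂ) (_ : IsFourierDensity T g),
    eLpNorm (fun ξ : E3 => ((2 * Real.pi * ‖ξ‖) ^ s : ℝ) • g ξ) 2 volume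

/-- A tempered distribution is real if it takes real values on real test functions. -/
def IsRealDistribution (T : 𝓢'(E3, ℂ)) : Prop :=
  ∀ φ : 𝓢(E3, ℂ), (∀ x, (φ x).im = 0) → (T φ).im = 0

/-- The norm of `Ḣ^{1/2} × Ḣ^{-1/2}`. -/
def ePhaseNorm (f : 𝓢'(E3, ℂ) × 𝓢'(E3, ℂ)) : ℝ≥0∞ :=
  (eHdotNorm (1 / 2) f.1 ^ 2 + eHdotNorm (-1 / 2) f.2 ^ 2) ^ (1 / 2 : ℝ)

/-- Membership in the real space `Ḣ^{1/2}(ℝ³) × Ḣ^{-1/2}(ℝ³)`. -/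
def MemPhaseSpace (f : 𝓢'(E3, ℂ) × 𝓢'(E3, ℂ)) : Prop :=
  ePhaseNorm f < ∞ ∧ IsRealDistribution f.1 ∧ IsRealDistribution f.2

/-! ### The wave propagators -/

/-- The symbol of `cos(t√(-Δ))`. -/
def cosSymbol (t : ℝ) (ξ : E3) : ℂ := (Real.cos (2 * Real.pi * t * ‖ξ‖) : ℝ)

/-- The symbol `sin(2πt|ξ|) / (2π|ξ|)` of `sin(t√(-Δ))/√(-Δ)`, with its value `t` at `ξ = 0`. -/
def sinSymbol (t : ℝ) (ξ : E3) : ℂ := (t * Real.sinc (2 * Real.pi * t * ‖ξ‖) : ℝ)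

/-- `S f (t)`, the solution at time `t` of the linear wave equation with data
`(v(0), ∂ₜv(0)) = f`, that is `cos(t√(-Δ)) f₀ + (sin(t√(-Δ))/√(-Δ)) f₁`. -/
def freeWave (f : 𝓢'(E3, ℂ) × 𝓢'(E3, ℂ)) (t : ℝ) : 𝓢'(E3, ℂ) :=
  TemperedDistribution.fourierMultiplierCLM ℂ (cosSymbol t) f.1 +
    TemperedDistribution.fourierMultiplierCLM ℂ (sinSymbol t) f.2

/-- For `F ∈ L^{4/3}(ℝ × ℝ³)`, the distribution
`(□⁻¹F)(t) = ∫_{-∞}^t (sin((t-s)√(-Δ))/√(-Δ)) F(s,·) ds` on `ℝ³`, evaluated at the test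
function `φ`. The propagator, which is its own transpose, is moved to `φ`. -/
def antibox (F : ℝ × E3 → ℝ) (t : ℝ) (φ : 𝓢(E3, ℂ)) : ℂ :=
  ∫ s in Set.Iio t, ∫ x : E3,
    (F (s, x) : ℂ) * SchwartzMap.fourierMultiplierCLM ℂ (sinSymbol (t - s)) φ x

/-! ### Solutions -/

/-- The function `w ∈ L⁴(ℝ × ℝ³)` is the time-dependent distribution `W`: for almost every `t`,
`w(t,·)` is `W(t)` as a distribution on `ℝ³`. -/
def Represents (w : ℝ × E3 → ℝ) (W : ℝ → 𝓢(E3, ℂ) → ℂ) : Prop :=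
  MemLp w 4 volume ∧ ∀ᵐ t : ℝ, ∀ φ : 𝓢(E3, ℂ), ∫ x : E3, (w (t, x) : ℂ) * φ x = W t φ

/-- `U` is the curve `t ↦ (u(t), ∂ₜu(t))`, and it is continuous with values in
`Ḣ^{1/2} × Ḣ^{-1/2}`. -/
structure IsPhaseCurve (u : ℝ × E3 → ℝ) (U : ℝ → 𝓢'(E3, ℂ) × 𝓢'(E3, ℂ)) : Prop where
  represents : Represents u (fun t φ => (U t).1 φ)
  hasDerivAt : ∀ (t : ℝ) (φ : 𝓢(E3, ℂ)), HasDerivAt (fun s => (U s).1 φ) ((U t).2 φ) t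
  mem : ∀ t, MemPhaseSpace (U t)
  continuous : ∀ t, Tendsto (fun s => ePhaseNorm (U s - U t)) (𝓝 t) (𝓝 0)

/-- `u ∈ L⁴(ℝ × ℝ³)`, with `(u, ∂ₜu) ∈ C(ℝ; Ḣ^{1/2} × Ḣ^{-1/2})`, satisfies
`u = S f + σ □⁻¹(u³)`. -/
structure IsSolution (σ : ℝ) (f : 𝓢'(E3, ℂ) × 𝓢'(E3, ℂ)) (u : ℝ × E3 → ℝ) : Prop where
  memLp : MemLp u 4 volume
  continuous : ∃ U, IsPhaseCurve u U
  fixedPoint : Represents u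
    (fun t φ => freeWave f t φ + (σ : ℂ) * antibox (fun z => u z ^ 3) t φ)

/-- The limit of `‖(u(t), ∂ₜu(t))‖` in `Ḣ^{1/2} × Ḣ^{-1/2}` as `t → -∞` exists and is `ℓ`. -/
def HasPastNorm (u : ℝ × E3 → ℝ) (ℓ : ℝ≥0) : Prop :=
  ∃ U, IsPhaseCurve u U ∧ Tendsto (fun t => ePhaseNorm (U t)) atBot (𝓝 (ℓ : ℝ≥0∞))

/-- The solutions `u` such that the limit of `‖(u(t), ∂ₜu(t))‖` as `t → -∞` is at most `δ`. -/
def admissible (σ : ℝ) (δ : ℝ≥0) : Set (ℝ × E3 → ℝ) :=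
  {u | (∃ f, MemPhaseSpace f ∧ IsSolution σ f u) ∧ ∃ ℓ ≤ δ, HasPastNorm u ℓ}

/-- The functional `I(δ)`, the supremum of `‖u‖⁴_{L⁴}` over the admissible solutions. -/
def maxStrichartz (σ : ℝ) (δ : ℝ≥0) : ℝ≥0∞ :=
  ⨆ u ∈ admissible σ δ, eLpNorm u 4 volume ^ 4

/-! ### Poincaré transformations and dilations -/

/-- The Lorentz factor. -/
def gammaFactor (β : E3) : ℝ := (Real.sqrt (1 - ‖β‖ ^ 2))⁻¹

/-- The Lorentz boost of velocity `β`, for `|β| < 1`. In the plane of `t` and of the direction of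
`β` it is `(t, y) ↦ (γ (t - |β| y), γ (y - |β| t))`, and it fixes the vectors orthogonal to that
plane; note that `γ² / (γ + 1) = (γ - 1) / |β|²` if `β ≠ 0`. -/
def lorentzBoost (β : E3) (z : ℝ × E3) : ℝ × E3 :=
  (gammaFactor β * (z.1 - inner ℝ β z.2),
    z.2 + (gammaFactor β ^ 2 / (gammaFactor β + 1) * inner ℝ β z.2 - gammaFactor β * z.1) • β)

/-- `Λ(t, x) = L^β (lam (t - t₀), lam (x - x₀))`. -/
def poincare (t₀ : ℝ) (x₀ : E3) (lam : ℝ) (β : E3) (z : ℝ × E3) : ℝ × E3 :=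
  lorentzBoost β (lam * (z.1 - t₀), lam • (z.2 - x₀))

/-- `u_Λ = lam · (u ∘ Λ)`. -/
def poincareAct (t₀ : ℝ) (x₀ : E3) (lam : ℝ) (β : E3) (u : ℝ × E3 → ℝ) : ℝ × E3 → ℝ :=
  fun z => lam * u (poincare t₀ x₀ lam β z)

/-- `g` is a transformed datum of `f`: it lies in `Ḣ^{1/2} × Ḣ^{-1/2}`, and
`lam · (S f ∘ Λ) = S g`, where `v` is `S f` as a function on spacetime. -/
def IsTransformedData (t₀ : ℝ) (x₀ : E3) (lam : ℝ) (β : E3)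
    (f g : 𝓢'(E3, ℂ) × 𝓢'(E3, ℂ)) : Prop :=
  MemPhaseSpace g ∧ ∃ v : ℝ × E3 → ℝ, Represents v (fun t φ => freeWave f t φ) ∧
    Represents (poincareAct t₀ x₀ lam β v) (fun t φ => freeWave g t φ)

end CubicWave

end

open CubicWave

/-! The point is to describe both halves of the equation `u = S f + σ □⁻¹(u³)` by objects on the
light cone, where the measure `dξ/|ξ|` (`coneMeasure`) is invariant under boosts
(`measurePreserving_coneBoost`) and homogeneous of degree 2 under dilations
(`map_smul_coneMeasure`).

Free waves. A real pair in the phase space corresponds to a single complex profile `a ∈ L²(dξ/|ξ|)`,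
with `S f` equal to twice the real part of the superposition `halfWave a` of the characters of
frequency `(|ξ|, ξ)`. By the parallelogram law the phase space norm is `√(8π)` times the norm of `a`
(`HasProfile.ePhaseNorm_eq`). Composition with `Λ` moves the frequency along the cone and multiplies
by a phase, so it acts on profiles by the operator `actProfile`, which is unitary on `L²(dξ/|ξ|)`.
Hence `f_Λ` exists and has the norm of `f`. That `S f` is a function in `L⁴` is the Strichartz
estimate `eLpNorm_halfWave_le`. The square of a half wave is a Fourier transform supported on sums
of two points of the cone, and in three dimensions the convolution of the cone measure with itself
has density at most `2π` (`lintegral_coneMeasure_convolution_le`); Cauchy–Schwarz and Plancherel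
conclude.

Retarded part. By Kirchhoff's formula `□⁻¹F` is the potential `(1/4π) ∫ F(t - |y|, x - y) dy/|y|`
(`antibox_eq_integral_retarded`), an integral over the backward light cone of `(t, x)`. The map `Λ`
is affine and carries backward cones to backward cones, and the invariance of the measure gives `λ
(□⁻¹F) ∘ Λ = □⁻¹(λ³ F ∘ Λ)` (`retarded_comp_poincare`). The factor `λ³` is the one produced by
`u_Λ³`, so `u_Λ` solves the equation with datum `f_Λ`.

Continuity and the past. At a fixed time `t`, `□⁻¹F` agrees with the free wave whose profile is, up
to a constant, the adjoint of the half wave operator applied to `F` cut to times before `t`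
(`exists_antibox_profile`). The dual Strichartz estimate bounds it by the `L^{4/3}` norm of the cut
function. This norm varies continuously with `t` and tends to 0 as `t → -∞`. Consequently `(u, ∂ₜu)`
is continuous in time, and its norm tends to that of `f` in the past (`exists_isPhaseCurve`). The
limits for `u` and `u_Λ` are the norms of `f` and `f_Λ`, which are equal.

The statements about `A(δ)` and `I(δ)` follow, since the inverse of `Λ` is again a map of the same
kind and the `L⁴` norm is invariant. -/

namespace CubicWave

/-! ### Integration in axial coordinates -/

/-- Polar coordinates for a function of the distance to the origin of the plane. -/
lemma lintegral_plane_radial (f : ℝ → ℝ≥0∞) (hf : Measurable f) :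
    ∫⁻ p : ℝ × ℝ, f (p.1 ^ 2 + p.2 ^ 2) =
      ∫⁻ r in Set.Ioi (0 : ℝ), ENNReal.ofReal (2 * Real.pi * r) * f (r ^ 2) := by
  rw [← lintegral_comp_polarCoord_symm]
  have h1 : ∀ p : ℝ × ℝ, (polarCoord.symm p).1 ^ 2 + (polarCoord.symm p).2 ^ 2 = p.1 ^ 2 := by
    intro p
    simp only [polarCoord_symm_apply]
    nlinarith [Real.sin_sq_add_cos_sq p.2]
  simp_rw [h1, polarCoord_target]
  rw [Measure.volume_eq_prod, ← Measure.prod_restrict, lintegral_prod]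
  · refine lintegral_congr fun r => ?_
    simp only [lintegral_const, Measure.restrict_apply MeasurableSet.univ, Set.univ_inter,
      Real.volume_Ioo, smul_eq_mul]
    rw [show Real.pi - -Real.pi = 2 * Real.pi by ring,
      ENNReal.ofReal_mul (p := 2 * Real.pi) (by positivity)]
    ring
  · refine Measurable.aemeasurable ?_
    fun_prop

/-- The substitution `r = √(s² + q²)`, `dr = (q/r) dq`, at a fixed height `s`. It trades the
distance `q` to the axis for the distance `r` to the origin. -/
lemma lintegral_Ioi_abs_eq (s : ℝ) (g : ℝ → ℝ≥0∞) :
    ∫⁻ r in Set.Ioi |s|, g r =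
      ∫⁻ q in Set.Ioi (0 : ℝ), ENNReal.ofReal (q / √(s ^ 2 + q ^ 2)) * g √(s ^ 2 + q ^ 2) := by
  have himg : (fun q => √(s ^ 2 + q ^ 2)) '' Set.Ioi 0 = Set.Ioi |s| := by
    ext r
    simp only [Set.mem_image, Set.mem_Ioi]
    constructor
    · rintro ⟨q, hq, rfl⟩
      rw [← Real.sqrt_sq_eq_abs]
      exact Real.sqrt_lt_sqrt (sq_nonneg _) (by nlinarith)
    · intro hr
      have hr0 : 0 < r := (abs_nonneg s).trans_lt hr
      have h2 : s ^ 2 < r ^ 2 := by rw [← sq_abs s]; gcongr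
      refine ⟨√(r ^ 2 - s ^ 2), Real.sqrt_pos.2 (by linarith), ?_⟩
      rw [Real.sq_sqrt (by linarith), show s ^ 2 + (r ^ 2 - s ^ 2) = r ^ 2 by ring,
        Real.sqrt_sq hr0.le]
  have hd : ∀ q ∈ Set.Ioi (0 : ℝ), HasDerivWithinAt (fun q => √(s ^ 2 + q ^ 2))
      (q / √(s ^ 2 + q ^ 2)) (Set.Ioi 0) q := by
    intro q hq
    have hq' : 0 < q := hq
    have h0 : s ^ 2 + q ^ 2 ≠ 0 := by positivity
    have := (((hasDerivAt_pow 2 q).const_add (s ^ 2)).sqrt h0).hasDerivWithinAt (s := Set.Ioi 0)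
    refine this.congr_deriv ?_
    field_simp
    norm_num
  have hinj : Set.InjOn (fun q => √(s ^ 2 + q ^ 2)) (Set.Ioi 0) := by
    intro q hq q' hq' h
    have hq0 : 0 < q := hq
    have hq0' : 0 < q' := hq'
    have := (Real.sqrt_inj (by positivity) (by positivity)).1 h
    exact (pow_left_inj₀ hq0.le hq0'.le two_ne_zero).1 (by linarith)
  rw [← himg, lintegral_image_eq_lintegral_abs_deriv_mul measurableSet_Ioi hd hinj]
  refine setLIntegral_congr_fun measurableSet_Ioi fun q hq => ?_
  have hq0 : 0 < q := hq
  rw [abs_of_nonneg (by positivity)]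

lemma lintegral_coord (f : ℝ → ℝ → ℝ≥0∞) (hf : Measurable (Function.uncurry f)) :
    ∫⁻ y : E3, f (y 0) (y 1 ^ 2 + y 2 ^ 2) = ∫⁻ s, ∫⁻ p : ℝ × ℝ, f s (p.1 ^ 2 + p.2 ^ 2) := by
  have h1 := (PiLp.volume_preserving_ofLp (Fin 3))
  have h2 := (volume_preserving_piFinSuccAbove (fun _ : Fin 3 => ℝ) 0)
  have h3 := (volume_preserving_finTwoArrow ℝ)
  have h4 := ((MeasurePreserving.id (volume : Measure ℝ)).prod h3).comp (h2.comp h1)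
  have h5 := h4.lintegral_comp (f := fun q : ℝ × ℝ × ℝ => f q.1 (q.2.1 ^ 2 + q.2.2 ^ 2))
    (by change Measurable fun q : ℝ × ℝ × ℝ => Function.uncurry f (q.1, q.2.1 ^ 2 + q.2.2 ^ 2)
        fun_prop)
  rw [lintegral_prod] at h5
  · exact h5
  · refine Measurable.aemeasurable ?_
    change Measurable fun q : ℝ × ℝ × ℝ => Function.uncurry f (q.1, q.2.1 ^ 2 + q.2.2 ^ 2)
    fun_prop

/-- A reflection carries `e` to the first basis vector. Polar coordinates in the orthogonal plane
give the weight `2πq dq`, which is `2πr dr` at a fixed height. -/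
theorem lintegral_axial {e : E3} (he : ‖e‖ = 1) (H : ℝ → ℝ → ℝ≥0∞)
    (hH : Measurable (Function.uncurry H)) :
    ∫⁻ y : E3, H ‖y‖ (inner ℝ y e) =
      ∫⁻ r in Set.Ioi (0 : ℝ), ∫⁻ s in Set.Ioo (-r) r, ENNReal.ofReal (2 * Real.pi * r) * H r s := by
  have key : ∫⁻ y : E3, H ‖y‖ (inner ℝ y e) = ∫⁻ y : E3, H √(y 0 ^ 2 + (y 1 ^ 2 + y 2 ^ 2)) (y 0) := by
    let e0 : E3 := EuclideanSpace.single 0 1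
    have he0 : ‖e‖ = ‖e0‖ := by simp [he, e0]
    let R : E3 ≃ₗᵢ[ℝ] E3 := (ℝ ∙ (e - e0))ᗮ.reflection
    have hR : R e = e0 := Submodule.reflection_sub he0
    rw [← (R.measurePreserving).lintegral_comp_emb R.toHomeomorph.measurableEmbedding
      (fun y : E3 => H √(y 0 ^ 2 + (y 1 ^ 2 + y 2 ^ 2)) (y 0))]
    refine lintegral_congr fun y => ?_
    have h1 : R y 0 = inner ℝ y e := by
      rw [← R.inner_map_map y e, hR]
      simp [e0, EuclideanSpace.inner_single_right]
    have h2 : √(R y 0 ^ 2 + (R y 1 ^ 2 + R y 2 ^ 2)) = ‖y‖ := by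
      rw [← R.norm_map y, EuclideanSpace.norm_eq, Fin.sum_univ_three]
      simp [add_assoc]
    rw [h1, ← h2, h1]
  have hm : Measurable fun q : ℝ × ℝ => H √(q.1 ^ 2 + q.2) q.1 := by
    change Measurable fun q : ℝ × ℝ => Function.uncurry H (√(q.1 ^ 2 + q.2), q.1)
    fun_prop
  rw [key, lintegral_coord (fun s p => H √(s ^ 2 + p) s) hm]
  have hm' : Measurable fun q : ℝ × ℝ => ENNReal.ofReal (2 * Real.pi * q.2) * H q.2 q.1 := by
    have : Measurable fun q : ℝ × ℝ => Function.uncurry H (q.2, q.1) := by fun_prop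
    exact Measurable.mul (by fun_prop) this
  have h1 : ∀ s : ℝ, ∫⁻ p : ℝ × ℝ, H √(s ^ 2 + (p.1 ^ 2 + p.2 ^ 2)) s =
      ∫⁻ r, (Set.Ioi |s|).indicator (fun r => ENNReal.ofReal (2 * Real.pi * r) * H r s) r := by
    intro s
    rw [lintegral_indicator measurableSet_Ioi, lintegral_Ioi_abs_eq,
      lintegral_plane_radial (fun p => H √(s ^ 2 + p) s)]
    · refine setLIntegral_congr_fun measurableSet_Ioi fun q hq => ?_
      have hq0 : 0 < q := hq
      rw [← mul_assoc, ← ENNReal.ofReal_mul (by positivity)]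
      congr 2
      field_simp
    · exact hm.comp (measurable_const.prodMk measurable_id)
  simp_rw [h1]
  have hset : ∀ s r : ℝ, (Set.Ioi |s|).indicator
      (fun r => ENNReal.ofReal (2 * Real.pi * r) * H r s) r =
      {q : ℝ × ℝ | |q.1| < q.2}.indicator
        (fun q => ENNReal.ofReal (2 * Real.pi * q.2) * H q.2 q.1) (s, r) := by
    intro s r
    by_cases h : |s| < r <;> simp [Set.indicator, h]
  simp_rw [hset]
  rw [lintegral_lintegral_swap]
  · rw [← lintegral_indicator measurableSet_Ioi]
    refine lintegral_congr fun r => ?_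
    by_cases hr : 0 < r
    · rw [Set.indicator_of_mem (by simpa using hr), ← lintegral_indicator measurableSet_Ioo]
      refine lintegral_congr fun s => ?_
      by_cases h : |s| < r <;> simp [Set.indicator, h, ← abs_lt]
    · rw [Set.indicator_of_notMem (by simpa using hr)]
      refine (lintegral_congr fun s => ?_).trans lintegral_zero
      have : ¬ |s| < r := fun h => hr ((abs_nonneg s).trans_lt h)
      simp [Set.indicator, this]
  · refine Measurable.aemeasurable ?_
    exact hm'.indicator (measurableSet_lt (by fun_prop) (by fun_prop))

/-! ### The invariant measure on the light cone -/

/-- The Lorentz invariant measure `dξ / |ξ|` of the light cone, parametrized by `ξ ∈ ℝ³`. -/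
noncomputable def coneMeasure : Measure E3 := volume.withDensity fun ξ => ENNReal.ofReal ‖ξ‖⁻¹

lemma lintegral_coneMeasure (f : E3 → ℝ≥0∞) :
    ∫⁻ ξ, f ξ ∂coneMeasure = ∫⁻ ξ, ENNReal.ofReal ‖ξ‖⁻¹ * f ξ := by
  rw [coneMeasure, lintegral_withDensity_eq_lintegral_mul_non_measurable _ (by fun_prop)
    (by simp)]
  rfl

instance : SFinite coneMeasure := by unfold coneMeasure; infer_instance

/-- With the convention `0⁻¹ = 0` the density vanishes exactly at the origin, a null point, so the
two measures have the same null sets. -/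
lemma coneMeasure_ae_iff {p : E3 → Prop} :
    (∀ᵐ ξ ∂coneMeasure, p ξ) ↔ ∀ᵐ ξ : E3, p ξ := by
  have h : ∀ᵐ ξ : E3, ξ ≠ 0 := by simp [ae_iff]
  rw [coneMeasure, ae_withDensity_iff (by fun_prop)]
  refine ⟨fun h' => ?_, fun h' => h'.mono fun ξ hξ _ => hξ⟩
  filter_upwards [h, h'] with ξ h1 h2
  exact h2 (by simpa using h1)

lemma ae_coneMeasure : ae coneMeasure = ae (volume : Measure E3) := by
  ext s
  exact coneMeasure_ae_iff (p := fun ξ => ξ ∈ s)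

lemma aestronglyMeasurable_coneMeasure {f : E3 → ℂ} :
    AEStronglyMeasurable f coneMeasure ↔ AEStronglyMeasurable f volume :=
  ⟨fun h => h.mono_ac (by rw [← Measure.ae_le_iff_absolutelyContinuous, ae_coneMeasure]),
    fun h => h.mono_ac (by rw [← Measure.ae_le_iff_absolutelyContinuous, ae_coneMeasure])⟩

lemma integral_coneMeasure (f : E3 → ℂ) :
    ∫ ξ, f ξ ∂coneMeasure = ∫ ξ : E3, (‖ξ‖⁻¹ : ℝ) • f ξ := by
  rw [coneMeasure, integral_withDensity_eq_integral_toReal_smul (by fun_prop) (by simp)]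
  simp

lemma integrable_coneMeasure {f : E3 → ℂ} :
    Integrable f coneMeasure ↔ Integrable fun ξ : E3 => (‖ξ‖⁻¹ : ℝ) • f ξ := by
  rw [coneMeasure, integrable_withDensity_iff_integrable_smul' (by fun_prop) (by simp)]
  simp

/-- Here `r = |ξ|`, `z = |ζ|` and `s` is the component of `ξ` along `ζ`. By the law of cosines `q =
|ζ - ξ|` satisfies `q² = r² - 2zs + z²`, hence `|ds| = (q/z) dq`, and the factor `q` cancels the
singular weight `1/q`. -/
lemma lintegral_Ioo_bipolar {z r : ℝ} (hz : 0 < z) (hr : 0 < r) (h : ℝ → ℝ≥0∞) :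
    ∫⁻ s in Set.Ioo (-r) r, ENNReal.ofReal (√(r ^ 2 - 2 * z * s + z ^ 2))⁻¹ *
        h (r + √(r ^ 2 - 2 * z * s + z ^ 2)) =
      ENNReal.ofReal z⁻¹ * ∫⁻ q in Set.Ioo |r - z| (r + z), h (r + q) := by
  set g : ℝ → ℝ := fun q => (r ^ 2 + z ^ 2 - q ^ 2) / (2 * z) with hg
  have hpos : ∀ q ∈ Set.Ioo |r - z| (r + z), 0 < q := fun q hq => (abs_nonneg _).trans_lt hq.1
  have himg : g '' Set.Ioo |r - z| (r + z) = Set.Ioo (-r) r := by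
    ext s
    simp only [Set.mem_image, hg]
    constructor
    · rintro ⟨q, hq, rfl⟩
      have h0 := hpos q hq
      have h1 : (r - z) ^ 2 < q ^ 2 := by rw [← sq_abs (r - z)]; gcongr; exact hq.1
      have h2 : q ^ 2 < (r + z) ^ 2 := by gcongr; exact hq.2
      constructor
      · rw [lt_div_iff₀ (by positivity)]; nlinarith
      · rw [div_lt_iff₀ (by positivity)]; nlinarith
    · rintro ⟨h1, h2⟩
      have h3 : 0 < (r + z) ^ 2 - (r ^ 2 - 2 * z * s + z ^ 2) := by nlinarith
      have h4 : 0 < (r ^ 2 - 2 * z * s + z ^ 2) - (r - z) ^ 2 := by nlinarith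
      refine ⟨√(r ^ 2 - 2 * z * s + z ^ 2), ⟨?_, ?_⟩, ?_⟩
      · rw [← Real.sqrt_sq_eq_abs]
        exact Real.sqrt_lt_sqrt (sq_nonneg _) (by linarith)
      · rw [Real.sqrt_lt' (by positivity)]; linarith
      · rw [Real.sq_sqrt (by nlinarith [sq_nonneg (r - z)])]
        field_simp
        ring
  have hd : ∀ q ∈ Set.Ioo |r - z| (r + z),
      HasDerivWithinAt g (-(q / z)) (Set.Ioo |r - z| (r + z)) q := by
    intro q hq
    refine ((((hasDerivAt_pow 2 q).const_sub (r ^ 2 + z ^ 2)).div_const (2 * z)).hasDerivWithinAt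
      ).congr_deriv ?_
    field_simp
    norm_num
  have hinj : Set.InjOn g (Set.Ioo |r - z| (r + z)) := by
    intro q hq q' hq' hqq
    simp only [hg] at hqq
    rw [div_left_inj' (by positivity)] at hqq
    exact (pow_left_inj₀ (hpos q hq).le (hpos q' hq').le two_ne_zero).1 (by linarith)
  rw [← himg, lintegral_image_eq_lintegral_abs_deriv_mul measurableSet_Ioo hd hinj,
    ← lintegral_const_mul' _ _ ENNReal.ofReal_ne_top]
  refine setLIntegral_congr_fun measurableSet_Ioo fun q hq => ?_
  have h0 := hpos q hq
  have h1 : r ^ 2 - 2 * z * g q + z ^ 2 = q ^ 2 := by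
    simp only [hg]
    field_simp
    ring
  simp only [h1, Real.sqrt_sq h0.le]
  rw [← mul_assoc, ← ENNReal.ofReal_mul (abs_nonneg _), abs_neg, abs_of_pos (by positivity)]
  congr 2
  field_simp

/-- In the coordinates `r = |ξ|`, `q = |ζ - ξ|` the integrand becomes `(2π/z) h(r + q) dq dr`. For a
given sum `τ = r + q` the admissible `r` lie in an interval of length `z`, which cancels `1/z`. -/
lemma lintegral_bipolar_le {ζ : E3} (hζ : ζ ≠ 0) (h : ℝ → ℝ≥0∞) (hh : Measurable h) :
    ∫⁻ ξ : E3, ENNReal.ofReal ‖ξ‖⁻¹ * (ENNReal.ofReal ‖ζ - ξ‖⁻¹ * h (‖ξ‖ + ‖ζ - ξ‖)) ≤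
      ENNReal.ofReal (2 * Real.pi) * ∫⁻ τ, h τ := by
  set z := ‖ζ‖ with hz'
  have hz : 0 < z := norm_pos_iff.2 hζ
  set e : E3 := z⁻¹ • ζ with he'
  have he : ‖e‖ = 1 := by simp [he', norm_smul, ← hz', abs_of_pos hz, hz.ne']
  have hζe : ζ = z • e := by simp [he', smul_smul, hz.ne']
  have hn : ∀ ξ : E3, ‖ζ - ξ‖ = √(‖ξ‖ ^ 2 - 2 * z * inner ℝ ξ e + z ^ 2) := by
    intro ξ
    have h1 : inner ℝ ζ ξ = z * inner ℝ ξ e := by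
      rw [real_inner_comm ξ ζ]
      conv_lhs => rw [hζe, real_inner_smul_right]
    rw [← Real.sqrt_sq (norm_nonneg (ζ - ξ)), norm_sub_sq_real, h1]
    congr 1
    ring
  have hax := lintegral_axial he (fun r s => ENNReal.ofReal r⁻¹ *
    (ENNReal.ofReal (√(r ^ 2 - 2 * z * s + z ^ 2))⁻¹ * h (r + √(r ^ 2 - 2 * z * s + z ^ 2))))
    (by fun_prop)
  simp_rw [hn]
  rw [hax]
  have h1 : ∀ r ∈ Set.Ioi (0 : ℝ), ∫⁻ s in Set.Ioo (-r) r, ENNReal.ofReal (2 * Real.pi * r) *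
      (ENNReal.ofReal r⁻¹ * (ENNReal.ofReal (√(r ^ 2 - 2 * z * s + z ^ 2))⁻¹ *
        h (r + √(r ^ 2 - 2 * z * s + z ^ 2)))) ≤
      ENNReal.ofReal (2 * Real.pi) * (ENNReal.ofReal z⁻¹ *
        ∫⁻ τ, {q : ℝ × ℝ | (q.2 - z) / 2 < q.1 ∧ q.1 < (q.2 + z) / 2}.indicator
          (fun q => h q.2) (r, τ)) := by
    intro r hr
    have hr0 : 0 < r := hr
    rw [lintegral_const_mul' _ _ ENNReal.ofReal_ne_top,
      lintegral_const_mul' _ _ ENNReal.ofReal_ne_top, lintegral_Ioo_bipolar hz hr0, ← mul_assoc,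
      ← ENNReal.ofReal_mul (by positivity), mul_assoc _ r, mul_inv_cancel₀ hr0.ne', mul_one]
    refine mul_le_mul_right (mul_le_mul_right ?_ _) _
    -- With `q = τ - r`, the triangle conditions `|r - z| < q < r + z` give the two bounds on `r`.
    -- They also give `τ > z`, which is dropped; only an upper bound is needed.
    rw [← lintegral_indicator measurableSet_Ioo, ← lintegral_sub_right_eq_self _ r]
    refine lintegral_mono fun τ => ?_
    by_cases hτ : τ - r ∈ Set.Ioo |r - z| (r + z)
    · have h3 := abs_lt.1 hτ.1
      have h4 := hτ.2
      rw [Set.indicator_of_mem hτ, Set.indicator_of_mem]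
      · simp
      · constructor <;> simp only <;> linarith
    · rw [Set.indicator_of_notMem hτ]
      exact zero_le
  have hms : MeasurableSet {q : ℝ × ℝ | (q.2 - z) / 2 < q.1 ∧ q.1 < (q.2 + z) / 2} :=
    (measurableSet_lt (f := fun q : ℝ × ℝ => (q.2 - z) / 2) (g := fun q => q.1)
      (by fun_prop) (by fun_prop)).inter
      (measurableSet_lt (f := fun q : ℝ × ℝ => q.1) (g := fun q => (q.2 + z) / 2)
        (by fun_prop) (by fun_prop))
  calc _ ≤ ∫⁻ r in Set.Ioi (0 : ℝ), ENNReal.ofReal (2 * Real.pi) * (ENNReal.ofReal z⁻¹ *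
        ∫⁻ τ, {q : ℝ × ℝ | (q.2 - z) / 2 < q.1 ∧ q.1 < (q.2 + z) / 2}.indicator
          (fun q => h q.2) (r, τ)) := setLIntegral_mono' measurableSet_Ioi h1
    _ ≤ ∫⁻ r, ENNReal.ofReal (2 * Real.pi) * (ENNReal.ofReal z⁻¹ *
        ∫⁻ τ, {q : ℝ × ℝ | (q.2 - z) / 2 < q.1 ∧ q.1 < (q.2 + z) / 2}.indicator
          (fun q => h q.2) (r, τ)) := setLIntegral_le_lintegral _ _
    _ = ENNReal.ofReal (2 * Real.pi) * (ENNReal.ofReal z⁻¹ * ∫⁻ τ, ∫⁻ r,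
        (Set.Ioo ((τ - z) / 2) ((τ + z) / 2)).indicator (fun _ => h τ) r) := by
      rw [lintegral_const_mul' _ _ ENNReal.ofReal_ne_top,
        lintegral_const_mul' _ _ ENNReal.ofReal_ne_top, lintegral_lintegral_swap]
      · rfl
      · exact ((hh.comp measurable_snd).indicator hms).aemeasurable
    _ = _ := by
      have h5 : ∀ τ, ∫⁻ r, (Set.Ioo ((τ - z) / 2) ((τ + z) / 2)).indicator (fun _ => h τ) r =
          ENNReal.ofReal z * h τ := by
        intro τ
        rw [lintegral_indicator measurableSet_Ioo, lintegral_const]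
        simp only [Measure.restrict_apply MeasurableSet.univ, Set.univ_inter, Real.volume_Ioo]
        rw [mul_comm]
        congr 2
        ring
      simp_rw [h5]
      rw [lintegral_const_mul' _ _ ENNReal.ofReal_ne_top, ← mul_assoc (ENNReal.ofReal z⁻¹),
        ← ENNReal.ofReal_mul (by positivity), inv_mul_cancel₀ hz.ne', ENNReal.ofReal_one, one_mul]

/-- Translating `η = ζ - ξ` reduces to `lintegral_bipolar_le` for each `ζ ≠ 0`. The boundedness of
this convolution density is the geometric input of the Strichartz estimate with exponent 4. -/
theorem lintegral_coneMeasure_convolution_le (Φ : ℝ × E3 → ℝ≥0∞) (hΦ : Measurable Φ) :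
    ∫⁻ ξ, ∫⁻ η, Φ (‖ξ‖ + ‖η‖, ξ + η) ∂coneMeasure ∂coneMeasure ≤
      ENNReal.ofReal (2 * Real.pi) * ∫⁻ z, Φ z := by
  have h1 : ∀ ξ : E3, ∫⁻ η, Φ (‖ξ‖ + ‖η‖, ξ + η) ∂coneMeasure =
      ∫⁻ ζ : E3, ENNReal.ofReal ‖ζ - ξ‖⁻¹ * Φ (‖ξ‖ + ‖ζ - ξ‖, ζ) := by
    intro ξ
    rw [lintegral_coneMeasure, ← lintegral_sub_right_eq_self _ ξ]
    simp
  rw [lintegral_coneMeasure]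
  simp_rw [h1, ← lintegral_const_mul' _ _ ENNReal.ofReal_ne_top]
  rw [lintegral_lintegral_swap (by fun_prop)]
  have h2 : ∀ᵐ ζ : E3, ζ ≠ 0 := by simp [ae_iff]
  calc _ ≤ ∫⁻ ζ : E3, ENNReal.ofReal (2 * Real.pi) * ∫⁻ τ, Φ (τ, ζ) := by
        refine lintegral_mono_ae ?_
        filter_upwards [h2] with ζ hζ
        exact lintegral_bipolar_le hζ (fun τ => Φ (τ, ζ)) (by fun_prop)
    _ = _ := by
        rw [lintegral_const_mul' _ _ ENNReal.ofReal_ne_top,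
          lintegral_const_mul' _ _ ENNReal.ofReal_ne_top, Measure.volume_eq_prod,
          lintegral_prod_symm _ hΦ.aemeasurable]

/-! ### Lorentz boosts -/

section Boost

variable {β : E3}

lemma gammaFactor_pos (hβ : ‖β‖ < 1) : 0 < gammaFactor β := by
  unfold gammaFactor
  have : 0 < 1 - ‖β‖ ^ 2 := by nlinarith [norm_nonneg β]
  positivity

lemma gammaFactor_sq (hβ : ‖β‖ < 1) : gammaFactor β ^ 2 * (1 - ‖β‖ ^ 2) = 1 := by
  unfold gammaFactor
  have h : 0 < 1 - ‖β‖ ^ 2 := by nlinarith [norm_nonneg β]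
  rw [inv_pow, Real.sq_sqrt h.le, inv_mul_cancel₀ h.ne']

@[simp] lemma gammaFactor_neg (β : E3) : gammaFactor (-β) = gammaFactor β := by
  simp [gammaFactor]

/-- The Lorentz boost as a linear map. -/
noncomputable def lorentzBoostₗ (β : E3) : ℝ × E3 →ₗ[ℝ] ℝ × E3 where
  toFun := lorentzBoost β
  map_add' z w := by
    ext1
    · simp only [lorentzBoost, Prod.fst_add, Prod.snd_add, inner_add_right]
      ring
    · simp only [lorentzBoost, Prod.fst_add, Prod.snd_add, inner_add_right]
      module
  map_smul' c z := by
    ext1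
    · simp only [lorentzBoost, Prod.smul_fst, Prod.smul_snd, inner_smul_right, smul_eq_mul,
        RingHom.id_apply]
      ring
    · simp only [lorentzBoost, Prod.smul_fst, Prod.smul_snd, inner_smul_right, smul_eq_mul,
        RingHom.id_apply]
      module

lemma lorentzBoost_add (z w : ℝ × E3) :
    lorentzBoost β (z + w) = lorentzBoost β z + lorentzBoost β w := (lorentzBoostₗ β).map_add z w

lemma lorentzBoost_sub (z w : ℝ × E3) :
    lorentzBoost β (z - w) = lorentzBoost β z - lorentzBoost β w := (lorentzBoostₗ β).map_sub z w

lemma lorentzBoost_smul (c : ℝ) (z : ℝ × E3) :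
    lorentzBoost β (c • z) = c • lorentzBoost β z := (lorentzBoostₗ β).map_smul c z

lemma continuous_lorentzBoost : Continuous (lorentzBoost β) := by
  unfold lorentzBoost
  fun_prop

lemma lorentzBoost_neg_lorentzBoost (hβ : ‖β‖ < 1) (z : ℝ × E3) :
    lorentzBoost (-β) (lorentzBoost β z) = z := by
  have hg := gammaFactor_pos hβ
  have hg2 := gammaFactor_sq hβ
  have hg1 : gammaFactor β + 1 ≠ 0 := by positivity
  have hb : inner ℝ β β = ‖β‖ ^ 2 := real_inner_self_eq_norm_sq β
  have hb2 : ‖β‖ ^ 2 * gammaFactor β ^ 2 = gammaFactor β ^ 2 - 1 := by linarith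
  ext1
  · simp only [lorentzBoost, gammaFactor_neg, inner_neg_left, inner_add_right, inner_smul_right, hb]
    field_simp
    linear_combination (z.1 * (gammaFactor β + 1) - inner ℝ β z.2 * gammaFactor β ) * hg2
  · simp only [lorentzBoost, gammaFactor_neg, inner_neg_left, inner_add_right, inner_smul_right, hb]
    set A := gammaFactor β ^ 2 / (gammaFactor β + 1) * inner ℝ β z.2 - gammaFactor β * z.1 with hA
    have hA' : A * (gammaFactor β + 1) =
        gammaFactor β ^ 2 * inner ℝ β z.2 - gammaFactor β * z.1 * (gammaFactor β + 1) := by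
      rw [hA]
      field_simp
    rw [add_assoc, smul_neg, ← sub_eq_add_neg, ← sub_smul]
    have h0 : A - (gammaFactor β ^ 2 / (gammaFactor β + 1) * (-inner ℝ β z.2 + A * -‖β‖ ^ 2) -
        gammaFactor β * (gammaFactor β * (z.1 - inner ℝ β z.2))) = 0 := by
      field_simp
      linear_combination gammaFactor β * hA' + A * hb2
    rw [h0, zero_smul, add_zero]

/-- The pairing of spacetime with frequency space. -/
noncomputable def spacetimeInner (z k : ℝ × E3) : ℝ := inner ℝ z.2 k.2 + z.1 * k.1

/-- The matrix of a boost is symmetric for the Euclidean pairing, so a boost of the point can be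
moved to the frequency unchanged. -/
lemma spacetimeInner_lorentzBoost (z k : ℝ × E3) :
    spacetimeInner (lorentzBoost β z) k = spacetimeInner z (lorentzBoost β k) := by
  simp only [spacetimeInner, lorentzBoost, inner_add_left, inner_smul_left, inner_add_right,
    inner_smul_right, real_inner_comm z.2 β]
  simp
  ring

/-- The action of the Lorentz boost on the light cone, parametrized by `ξ ∈ ℝ³`. -/
noncomputable def coneBoost (β ξ : E3) : E3 := (lorentzBoost β (‖ξ‖, ξ)).2

/-- A boost preserves the Minkowski form, so the image of `(|ξ|, ξ)` is a null vector. Its time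
component is nonnegative because `|β| < 1`, hence equals the norm of its space component: the
forward cone is preserved. -/
lemma norm_coneBoost (hβ : ‖β‖ < 1) (ξ : E3) :
    ‖coneBoost β ξ‖ = gammaFactor β * (‖ξ‖ - inner ℝ β ξ) := by
  have hg := gammaFactor_pos hβ
  have hg2 := gammaFactor_sq hβ
  have hg1 : gammaFactor β + 1 ≠ 0 := by positivity
  have h0 : 0 ≤ ‖ξ‖ - inner ℝ β ξ := by
    have := real_inner_le_norm β ξ
    nlinarith [norm_nonneg ξ]
  rw [← sq_eq_sq₀ (norm_nonneg _) (by positivity)]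
  simp only [coneBoost, lorentzBoost]
  rw [norm_add_sq_real, inner_smul_right, norm_smul, mul_pow, Real.norm_eq_abs, sq_abs,
    real_inner_comm β ξ]
  set d := gammaFactor β * inner ℝ β ξ / (gammaFactor β + 1) - ‖ξ‖ with hd'
  have hd : gammaFactor β * inner ℝ β ξ = (d + ‖ξ‖) * (gammaFactor β + 1) := by
    rw [hd']
    field_simp
    ring
  have hc : gammaFactor β ^ 2 / (gammaFactor β + 1) * inner ℝ β ξ - gammaFactor β * ‖ξ‖ =
      gammaFactor β * d := by
    rw [hd']
    field_simp
  rw [hc]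
  linear_combination (2 * d + 2 * gammaFactor β * ‖ξ‖ - gammaFactor β * inner ℝ β ξ -
    (d + ‖ξ‖) * (gammaFactor β + 1)) * hd - d ^ 2 * hg2

lemma lorentzBoost_cone (hβ : ‖β‖ < 1) (ξ : E3) :
    lorentzBoost β (‖ξ‖, ξ) = (‖coneBoost β ξ‖, coneBoost β ξ) := by
  rw [norm_coneBoost hβ]
  rfl

lemma coneBoost_neg_coneBoost (hβ : ‖β‖ < 1) (ξ : E3) : coneBoost (-β) (coneBoost β ξ) = ξ := by
  rw [coneBoost, ← lorentzBoost_cone hβ, lorentzBoost_neg_lorentzBoost hβ]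

lemma continuous_coneBoost : Continuous (coneBoost β) :=
  continuous_snd.comp (continuous_lorentzBoost.comp (by fun_prop))

lemma hasFDerivAt_coneBoost {ξ : E3} (hξ : ξ ≠ 0) :
    HasFDerivAt (coneBoost β) (ContinuousLinearMap.id ℝ E3 +
      ((gammaFactor β ^ 2 / (gammaFactor β + 1)) • innerSL ℝ β -
        (gammaFactor β * ‖ξ‖⁻¹) • innerSL ℝ ξ).smulRight β) ξ := by
  have h1 : HasFDerivAt (fun ξ : E3 => ‖ξ‖) (‖ξ‖⁻¹ • innerSL ℝ ξ) ξ := by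
    have h0 : ‖ξ‖ ≠ 0 := norm_ne_zero_iff.2 hξ
    have := (hasStrictFDerivAt_norm_sq ξ).hasFDerivAt.sqrt (by positivity)
    simp only [Real.sqrt_sq (norm_nonneg _)] at this
    refine this.congr_fderiv ?_
    rw [← Nat.cast_smul_eq_nsmul ℝ, smul_smul]
    congr 1
    field_simp
    norm_num
  have h2 : HasFDerivAt (fun ξ : E3 => inner ℝ β ξ) (innerSL ℝ β) ξ := (innerSL ℝ β).hasFDerivAt
  have h3 := (hasFDerivAt_id ξ).add (((h2.const_mul (gammaFactor β ^ 2 / (gammaFactor β + 1))).sub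
    (h1.const_mul (gammaFactor β))).smul_const β)
  refine h3.congr_fderiv ?_
  rw [smul_smul]

/-- The derivative of the boost on the cone is the identity plus a rank one map `ℓ ⊗ β`, so its
determinant is `1 + ℓ(β)`. This equals the ratio of the norms of the image and of `ξ`, which the
density `1/|ξ|` compensates exactly. The origin, where the norm is not differentiable, is a null
point. -/
theorem measurePreserving_coneBoost (hβ : ‖β‖ < 1) :
    MeasurePreserving (coneBoost β) coneMeasure coneMeasure := by
  have hβ' : ‖-β‖ < 1 := by rwa [norm_neg]
  have hg := gammaFactor_pos hβ
  have hg2 := gammaFactor_sq hβ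
  have hg1 : gammaFactor β + 1 ≠ 0 := by positivity
  have h0 : ∀ {β : E3}, ‖β‖ < 1 → ∀ ξ : E3, ξ ≠ 0 → coneBoost β ξ ≠ 0 := by
    intro β hβ ξ hξ h
    have h1 := coneBoost_neg_coneBoost hβ ξ
    rw [h] at h1
    exact hξ (by rw [← h1]; simp [coneBoost, lorentzBoost])
  have himg : coneBoost β '' {0}ᶜ = {0}ᶜ := by
    ext η
    constructor
    · rintro ⟨ξ, hξ, rfl⟩
      exact h0 hβ ξ hξ
    · intro hη
      refine ⟨coneBoost (-β) η, h0 hβ' η hη, ?_⟩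
      simpa using coneBoost_neg_coneBoost hβ' η
  have hinj : Set.InjOn (coneBoost β) {0}ᶜ := fun ξ _ η _ h => by
    rw [← coneBoost_neg_coneBoost hβ ξ, h, coneBoost_neg_coneBoost hβ η]
  refine ⟨continuous_coneBoost.measurable, Measure.ext_of_lintegral _ fun f hf => ?_⟩
  rw [lintegral_map hf continuous_coneBoost.measurable, lintegral_coneMeasure,
    lintegral_coneMeasure]
  have hc : (({0}ᶜ : Set E3)) =ᵐ[volume] Set.univ := by
    simp [ae_eq_univ]
  rw [← setLIntegral_univ (fun ξ => _ * f ξ), ← setLIntegral_congr hc]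
  conv_rhs => rw [← himg]
  rw [lintegral_image_eq_lintegral_abs_det_fderiv_mul volume (measurableSet_singleton 0).compl
    (fun ξ hξ => (hasFDerivAt_coneBoost hξ).hasFDerivWithinAt) hinj,
    ← setLIntegral_univ (fun ξ => _ * f (coneBoost β ξ)), ← setLIntegral_congr hc]
  refine setLIntegral_congr_fun (measurableSet_singleton 0).compl fun ξ hξ => ?_
  have hξ0 : 0 < ‖ξ‖ := norm_pos_iff.2 hξ
  have hb0 : 0 < ‖coneBoost β ξ‖ := norm_pos_iff.2 (h0 hβ ξ hξ)
  have hdet : (ContinuousLinearMap.id ℝ E3 +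
      ((gammaFactor β ^ 2 / (gammaFactor β + 1)) • innerSL ℝ β -
        (gammaFactor β * ‖ξ‖⁻¹) • innerSL ℝ ξ).smulRight β).det = ‖coneBoost β ξ‖ * ‖ξ‖⁻¹ := by
    have := LinearMap.transvection.det (((gammaFactor β ^ 2 / (gammaFactor β + 1)) • innerSL ℝ β -
        (gammaFactor β * ‖ξ‖⁻¹) • innerSL ℝ ξ : E3 →L[ℝ] ℝ) : E3 →ₗ[ℝ] ℝ) β
    refine Eq.trans ?_ (this.trans ?_)
    · rfl
    · simp only [ContinuousLinearMap.coe_coe, sub_apply, smul_apply, innerSL_apply_apply,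
        real_inner_self_eq_norm_sq, norm_coneBoost hβ, smul_eq_mul, real_inner_comm β ξ]
      field_simp
      linear_combination (-‖ξ‖) * hg2
  rw [hdet, abs_of_pos (by positivity), ← mul_assoc, ← ENNReal.ofReal_mul (by positivity)]
  congr 2
  field_simp

/-- The boost of velocity `-β` is the inverse of the boost of velocity `β`, and is also its
conjugate under the reflection of space. The two therefore have equal determinants with product 1.
-/
theorem measurePreserving_lorentzBoost (hβ : ‖β‖ < 1) :
    MeasurePreserving (lorentzBoost β) (volume : Measure (ℝ × E3)) volume := by
  have hβ' : ‖-β‖ < 1 := by rwa [norm_neg]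
  let R : ℝ × E3 →ₗ[ℝ] ℝ × E3 := LinearMap.prodMap LinearMap.id (-LinearMap.id)
  have hR : R ∘ₗ R = LinearMap.id := by ext <;> simp [R]
  have hRL : lorentzBoostₗ (-β) = R ∘ₗ lorentzBoostₗ β ∘ₗ R := by
    refine LinearMap.ext fun z => ?_
    ext1 <;> simp [R, lorentzBoostₗ, lorentzBoost]
    module
  have h1 : lorentzBoostₗ (-β) ∘ₗ lorentzBoostₗ β = LinearMap.id :=
    LinearMap.ext fun z => lorentzBoost_neg_lorentzBoost hβ z
  have h2 := congrArg LinearMap.det h1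
  have h3 := congrArg LinearMap.det hR
  rw [LinearMap.det_comp, LinearMap.det_id] at h2 h3
  rw [hRL, LinearMap.det_comp, LinearMap.det_comp] at h2
  have h4 : LinearMap.det (lorentzBoostₗ β) ^ 2 = 1 := by
    linear_combination h2 - LinearMap.det (lorentzBoostₗ β) ^ 2 * h3
  have h5 : |LinearMap.det (lorentzBoostₗ β)| = 1 := by
    rw [← sq_eq_sq₀ (abs_nonneg _) zero_le_one, sq_abs, h4, one_pow]
  refine ⟨continuous_lorentzBoost.measurable, ?_⟩
  have : (volume : Measure (ℝ × E3)).IsAddHaarMeasure := by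
    rw [Measure.volume_eq_prod]
    infer_instance
  have h6 := Measure.map_linearMap_addHaar_eq_smul_addHaar (volume : Measure (ℝ × E3))
    (f := lorentzBoostₗ β) (by intro h; simp [h] at h5)
  rw [abs_inv, h5, inv_one, ENNReal.ofReal_one, one_smul] at h6
  exact h6

end Boost

/-! ### The Fourier transform of radial functions -/

lemma exists_unit_direction (ξ : E3) : ∃ e : E3, ‖e‖ = 1 ∧ ξ = ‖ξ‖ • e := by
  rcases eq_or_ne ξ 0 with rfl | hξ
  · exact ⟨EuclideanSpace.single 0 1, by simp, by simp⟩
  · have : ‖ξ‖ ≠ 0 := norm_ne_zero_iff.2 hξ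
    exact ⟨‖ξ‖⁻¹ • ξ, by simp [norm_smul, this], by simp [smul_smul, this]⟩

/-- The region `|s| < r` of axial coordinates. -/
def axialRegion : Set (ℝ × ℝ) := {q | 0 < q.1 ∧ q.2 ∈ Set.Ioo (-q.1) q.1}

lemma measurableSet_axialRegion : MeasurableSet axialRegion :=
  (measurableSet_lt (f := fun _ : ℝ × ℝ => (0 : ℝ)) (g := fun q => q.1)
    (by fun_prop) (by fun_prop)).inter <|
  (measurableSet_lt (f := fun q : ℝ × ℝ => -q.1) (g := fun q => q.2)
    (by fun_prop) (by fun_prop)).inter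
  (measurableSet_lt (f := fun q : ℝ × ℝ => q.2) (g := fun q => q.1) (by fun_prop) (by fun_prop))

/-- The image of Lebesgue measure in axial coordinates. -/
noncomputable def axialMeasure : Measure (ℝ × ℝ) :=
  (volume.restrict axialRegion).withDensity fun q => ENNReal.ofReal (2 * Real.pi * q.1)

lemma lintegral_axialRegion (G : ℝ × ℝ → ℝ≥0∞) (hG : Measurable G) :
    ∫⁻ q in axialRegion, G q =
      ∫⁻ r in Set.Ioi (0 : ℝ), ∫⁻ s in Set.Ioo (-r) r, G (r, s) := by
  rw [← lintegral_indicator measurableSet_axialRegion, Measure.volume_eq_prod,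
    lintegral_prod _ (hG.indicator measurableSet_axialRegion).aemeasurable,
    ← lintegral_indicator measurableSet_Ioi]
  refine lintegral_congr fun r => ?_
  by_cases hr : 0 < r
  · rw [Set.indicator_of_mem (by simpa using hr), ← lintegral_indicator measurableSet_Ioo]
    refine lintegral_congr fun s => ?_
    by_cases h : -r < s ∧ s < r <;> simp [Set.indicator, h, axialRegion, hr]
  · rw [Set.indicator_of_notMem (by simpa using hr)]
    refine (lintegral_congr fun s => ?_).trans lintegral_zero
    simp [Set.indicator, axialRegion, hr]

lemma measurePreserving_axial {e : E3} (he : ‖e‖ = 1) :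
    MeasurePreserving (fun y : E3 => (‖y‖, inner ℝ y e)) volume axialMeasure := by
  refine ⟨by fun_prop, Measure.ext_of_lintegral _ fun G hG => ?_⟩
  rw [lintegral_map hG (by fun_prop), lintegral_axial he (fun r s => G (r, s)) hG,
    axialMeasure, lintegral_withDensity_eq_lintegral_mul _ (by fun_prop) hG,
    lintegral_axialRegion _ (by fun_prop)]
  rfl

lemma integral_Ioo_exp (r z : ℝ) (hr : 0 < r) :
    ∫ s in Set.Ioo (-r) r, Complex.exp (2 * Real.pi * Complex.I * ((s * z : ℝ) : ℂ)) =
      (2 * (r * Real.sinc (2 * Real.pi * r * z)) : ℝ) := by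
  rw [← integral_Ioc_eq_integral_Ioo, ← intervalIntegral.integral_of_le (by linarith)]
  rcases eq_or_ne z 0 with rfl | hz
  · simp
    ring
  · have hc : 2 * Real.pi * z ≠ 0 := by positivity
    have h1 := intervalIntegral.integral_comp_mul_left (a := -r) (b := r)
      (fun t : ℝ => Complex.exp (t * Complex.I)) hc
    rw [show 2 * Real.pi * z * -r = -(2 * Real.pi * z * r) by ring,
      integral_exp_mul_I_eq_sinc] at h1
    refine Eq.trans ?_ (h1.trans ?_)
    · congr 1
      ext s
      congr 1
      push_cast
      ring
    · rw [Complex.real_smul, show 2 * Real.pi * z * r = 2 * Real.pi * r * z by ring]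
      push_cast
      have : (z : ℂ) ≠ 0 := by exact_mod_cast hz
      have : (Real.pi : ℂ) ≠ 0 := by exact_mod_cast Real.pi_ne_zero
      field_simp

lemma integrable_axialMeasure {G : ℝ × ℝ → ℂ} :
    Integrable G axialMeasure ↔
      IntegrableOn (fun q => (2 * Real.pi * q.1 : ℝ) • G q) axialRegion := by
  rw [axialMeasure, integrable_withDensity_iff_integrable_smul' (by fun_prop) (by simp)]
  refine integrable_congr ?_
  filter_upwards [ae_restrict_mem measurableSet_axialRegion] with q hq
  have : 0 < q.1 := hq.1
  rw [ENNReal.toReal_ofReal (by positivity)]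

lemma integral_axialMeasure {G : ℝ × ℝ → ℂ} (hG : Integrable G axialMeasure) :
    ∫ q, G q ∂axialMeasure =
      ∫ r in Set.Ioi (0 : ℝ), ∫ s in Set.Ioo (-r) r, (2 * Real.pi * r : ℝ) • G (r, s) := by
  have hi := integrable_axialMeasure.1 hG
  have h1 : ∫ q, G q ∂axialMeasure = ∫ q in axialRegion, (2 * Real.pi * q.1 : ℝ) • G q := by
    rw [axialMeasure, integral_withDensity_eq_integral_toReal_smul (by fun_prop) (by simp)]
    refine setIntegral_congr_fun measurableSet_axialRegion fun q hq => ?_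
    have : 0 < q.1 := hq.1
    rw [ENNReal.toReal_ofReal (by positivity)]
  rw [h1, ← integral_indicator measurableSet_axialRegion, Measure.volume_eq_prod,
    integral_prod _ ((integrable_indicator_iff measurableSet_axialRegion).2 hi),
    ← integral_indicator measurableSet_Ioi]
  refine integral_congr_ae (.of_forall fun r => ?_)
  by_cases hr : 0 < r
  · simp only
    rw [Set.indicator_of_mem (by simpa using hr), ← integral_indicator measurableSet_Ioo]
    refine integral_congr_ae (.of_forall fun s => ?_)
    by_cases h : -r < s ∧ s < r <;> simp [Set.indicator, h, axialRegion, hr]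
  · simp only
    rw [Set.indicator_of_notMem (by simpa using hr)]
    refine (integral_congr_ae (.of_forall fun s => ?_)).trans (integral_zero _ _)
    simp [Set.indicator, axialRegion, hr]

/-- The slice `|s| < r` has length `2r`, so the integral of the modulus is at most that of `4π |r
h(r)|` over the half line. -/
lemma integrable_axial_radial {h : ℝ → ℂ} (hh : Measurable h)
    (hi : IntegrableOn (fun r => r * h r) (Set.Ioi 0)) {c : ℝ → ℂ} (hc : Measurable c)
    (hc1 : ∀ s, ‖c s‖ ≤ 1) :
    Integrable (fun q : ℝ × ℝ => (q.1⁻¹ : ℝ) • (h q.1 * c q.2)) axialMeasure := by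
  rw [integrable_axialMeasure]
  have hm : Measurable fun q : ℝ × ℝ =>
      (2 * Real.pi * q.1 : ℝ) • (q.1⁻¹ : ℝ) • (h q.1 * c q.2) := by fun_prop
  refine ⟨hm.aestronglyMeasurable, ?_⟩
  rw [hasFiniteIntegral_iff_enorm, lintegral_axialRegion _ hm.enorm]
  calc _ ≤ ∫⁻ r in Set.Ioi (0 : ℝ), ENNReal.ofReal (4 * Real.pi) * ‖r * h r‖ₑ := by
        refine setLIntegral_mono' measurableSet_Ioi fun r hr => ?_
        have hr0 : 0 < r := hr
        calc _ ≤ ∫⁻ s in Set.Ioo (-r) r, ENNReal.ofReal (2 * Real.pi) * ‖h r‖ₑ := by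
              refine lintegral_mono fun s => ?_
              simp only
              rw [smul_smul, mul_inv_cancel_right₀ hr0.ne', enorm_smul,
                Real.enorm_eq_ofReal (by positivity)]
              have : ‖c s‖ₑ ≤ 1 := by
                rw [← ofReal_norm]
                exact ENNReal.ofReal_le_one.2 (hc1 s)
              calc _ ≤ ENNReal.ofReal (2 * Real.pi) * (‖h r‖ₑ * 1) :=
                    mul_le_mul_right (by rw [enorm_mul]; gcongr) _
                _ = _ := by rw [mul_one]
          _ = _ := by
              rw [lintegral_const, Measure.restrict_apply_univ, Real.volume_Ioo, enorm_mul,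
                show (4 * Real.pi) = 2 * Real.pi * 2 by ring,
                ENNReal.ofReal_mul (by positivity : 0 ≤ 2 * Real.pi),
                show r - -r = 2 * r by ring, ENNReal.ofReal_mul (p := 2) (q := r) (by norm_num)]
              rw [← ofReal_norm (r : ℂ), Complex.norm_real, Real.norm_of_nonneg hr0.le]
              ring
    _ < ∞ := by
        rw [lintegral_const_mul' _ _ ENNReal.ofReal_ne_top]
        exact ENNReal.mul_lt_top ENNReal.ofReal_lt_top hi.hasFiniteIntegral

theorem integrable_coneMeasure_norm {h : ℝ → ℂ} (hh : Measurable h)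
    (hi : IntegrableOn (fun r => r * h r) (Set.Ioi 0)) :
    Integrable (fun y => h ‖y‖) coneMeasure := by
  have h1 := (measurePreserving_axial (e := EuclideanSpace.single 0 1) (by simp)).integrable_comp_of_integrable
    (integrable_axial_radial hh hi (c := fun _ => 1) (by fun_prop) (by simp))
  rw [integrable_coneMeasure]
  simpa [Function.comp_def] using h1

/-- The Fourier transform of a radial function with respect to the measure of the cone. -/
theorem integral_coneMeasure_norm_mul_exp {h : ℝ → ℂ} (hh : Measurable h)
    (hi : IntegrableOn (fun r => r * h r) (Set.Ioi 0)) (ξ : E3) :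
    ∫ y, h ‖y‖ * Complex.exp (2 * Real.pi * Complex.I * (inner ℝ y ξ : ℝ)) ∂coneMeasure =
      4 * Real.pi * ∫ r in Set.Ioi (0 : ℝ), h r * sinSymbol r ξ := by
  obtain ⟨e, he, hξ⟩ := exists_unit_direction ξ
  set c : ℝ → ℂ := fun s => Complex.exp (2 * Real.pi * Complex.I * ((s * ‖ξ‖ : ℝ) : ℂ)) with hc
  have hcm : Measurable c := by fun_prop
  have hc1 : ∀ s, ‖c s‖ ≤ 1 := fun s => by
    rw [hc, Complex.norm_exp]
    simp
  have hint := integrable_axial_radial hh hi hcm hc1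
  have hmp := measurePreserving_axial he
  rw [integral_coneMeasure]
  have h1 : ∀ y : E3, (‖y‖⁻¹ : ℝ) •
      (h ‖y‖ * Complex.exp (2 * Real.pi * Complex.I * (inner ℝ y ξ : ℝ))) =
      (fun q : ℝ × ℝ => (q.1⁻¹ : ℝ) • (h q.1 * c q.2)) (‖y‖, inner ℝ y e) := by
    intro y
    simp only [hc]
    conv_lhs => rw [hξ, inner_smul_right]
    rw [mul_comm ‖ξ‖]
  simp_rw [h1]
  have h2 := integral_map (μ := (volume : Measure E3)) hmp.measurable.aemeasurable
    (hmp.map_eq ▸ hint.aestronglyMeasurable)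
  rw [hmp.map_eq] at h2
  rw [← h2, integral_axialMeasure hint, ← integral_const_mul]
  refine setIntegral_congr_fun measurableSet_Ioi fun r hr => ?_
  have hr0 : 0 < r := hr
  simp only [smul_smul, mul_inv_cancel_right₀ hr0.ne']
  rw [integral_smul, integral_const_mul, integral_Ioo_exp r ‖ξ‖ hr0, sinSymbol, Complex.real_smul]
  push_cast
  ring

/-! ### Temperate growth of the wave symbols -/

/-- Each derivative of the Fourier transform is bounded by a moment of `f`, so the growth exponent
can be taken to be 0 at every order. -/
lemma hasTemperateGrowth_fourier {f : E3 → ℂ}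
    (hf : ∀ n : ℕ, Integrable (fun v => ‖v‖ ^ n * ‖f v‖)) (hm : AEStronglyMeasurable f) :
    (𝓕 f).HasTemperateGrowth := by
  refine ⟨Real.contDiff_fourier fun n _ => hf n, fun n => ⟨0, ?_⟩⟩
  refine ⟨∫ v, ‖VectorFourier.fourierPowSMulRight (innerSL ℝ) f v n‖, fun x => ?_⟩
  rw [Real.iteratedFDeriv_fourier (N := ⊤) (fun n _ => hf n) hm le_top, pow_zero, mul_one]
  exact VectorFourier.norm_fourierIntegral_le_integral_norm _ _ _ _ _

lemma sinSymbol_neg_right (t : ℝ) (ξ : E3) : sinSymbol t (-ξ) = sinSymbol t ξ := by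
  simp [sinSymbol]

/-- The integral is, up to the factor `4π`, the Fourier transform of `|y|^{k-1}` on the unit ball.
This function is integrable with compact support, hence its transform is smooth with bounded
derivatives. Smoothness at `ξ = 0`, where the norm is singular, is obtained in this way. -/
lemma hasTemperateGrowth_integral_sinSymbol (k : ℕ) :
    (fun ξ : E3 => ∫ r in (0 : ℝ)..1, (r : ℂ) ^ k * sinSymbol r ξ).HasTemperateGrowth := by
  set h : ℝ → ℂ := (Set.Ioc (0 : ℝ) 1).indicator fun r => (r : ℂ) ^ k with hh
  have hhm : Measurable h := Measurable.indicator (by fun_prop) measurableSet_Ioc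
  have hb : ∀ n : ℕ, IntegrableOn (fun r : ℝ => (r : ℂ) * ((r : ℂ) ^ n * h r)) (Set.Ioi 0) := by
    intro n
    have : (fun r : ℝ => (r : ℂ) * ((r : ℂ) ^ n * h r)) =
        (Set.Ioc (0 : ℝ) 1).indicator fun r => (r : ℂ) * ((r : ℂ) ^ n * (r : ℂ) ^ k) := by
      ext r
      simp only [hh, Set.indicator]
      split_ifs <;> simp
    rw [this]
    refine IntegrableOn.integrable_indicator ?_ measurableSet_Ioc |>.integrableOn
    exact (Continuous.integrableOn_Ioc (by fun_prop))
  set f : E3 → ℂ := fun y => (‖y‖⁻¹ : ℝ) • h ‖y‖ with hf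
  have h1 : (𝓕 f).HasTemperateGrowth := by
    refine hasTemperateGrowth_fourier (fun n => ?_) (by fun_prop)
    have := (integrable_coneMeasure.1 (integrable_coneMeasure_norm
      (h := fun r => (r : ℂ) ^ n * h r) (by fun_prop) (hb n))).norm
    refine this.congr (.of_forall fun y => ?_)
    simp [hf]
    ring
  have h2 : (fun ξ : E3 => ∫ r in (0 : ℝ)..1, (r : ℂ) ^ k * sinSymbol r ξ) =
      fun ξ => (4 * Real.pi : ℂ)⁻¹ * 𝓕 f ξ := by
    ext ξ
    have h3 : 𝓕 f ξ =
        ∫ y, h ‖y‖ * Complex.exp (2 * Real.pi * Complex.I * (inner ℝ y (-ξ) : ℝ)) ∂coneMeasure := by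
      rw [Real.fourier_eq', integral_coneMeasure]
      refine integral_congr_ae (.of_forall fun y => ?_)
      simp only [hf, Complex.real_smul, smul_eq_mul, inner_neg_right]
      push_cast
      ring_nf
    have hpi : (Real.pi : ℂ) ≠ 0 := by exact_mod_cast Real.pi_ne_zero
    rw [h3, integral_coneMeasure_norm_mul_exp hhm (by simpa using hb 0), ← mul_assoc,
      inv_mul_cancel₀ (by simp [hpi]), one_mul, intervalIntegral.integral_of_le zero_le_one]
    simp_rw [sinSymbol_neg_right]
    have h4 : ∀ r : ℝ, h r * sinSymbol r ξ =
        (Set.Ioc (0 : ℝ) 1).indicator (fun r => (r : ℂ) ^ k * sinSymbol r ξ) r := by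
      intro r
      simp only [hh, Set.indicator]
      split_ifs <;> simp
    simp_rw [h4]
    rw [setIntegral_indicator measurableSet_Ioc]
    congr 2
    ext r
    simp +contextual
  rw [h2]
  exact (Function.HasTemperateGrowth.const _).mul h1

/-- With `ρ = 2π|ξ|` this is `cos ρ = 1 - ρ² ∫₀¹ (sin(ρr)/ρ) dr`. The next identity is `sin ρ/ρ =
cos ρ + ρ² ∫₀¹ r (sin(ρr)/ρ) dr`. Both express the symbols through polynomials in `ξ` and the smooth
integrals above. -/
lemma cosSymbol_one_eq (ξ : E3) : cosSymbol 1 ξ =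
    1 - ((2 * Real.pi) ^ 2 * ‖ξ‖ ^ 2 : ℝ) *
      ∫ r in (0 : ℝ)..1, (r : ℂ) ^ 0 * sinSymbol r ξ := by
  rcases eq_or_ne ξ 0 with rfl | hξ
  · simp [cosSymbol]
  set ρ := 2 * Real.pi * ‖ξ‖ with hρ
  have hρ0 : ρ ≠ 0 := by positivity
  have h1 : ∫ r in (0 : ℝ)..1, r * Real.sinc (2 * Real.pi * r * ‖ξ‖) = (1 - Real.cos ρ) / ρ ^ 2 := by
    have hd : ∀ r ∈ Set.uIcc (0 : ℝ) 1, HasDerivAt (fun r => -Real.cos (ρ * r) / ρ ^ 2)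
        (r * Real.sinc (2 * Real.pi * r * ‖ξ‖)) r := by
      intro r _
      have := (((hasDerivAt_id r).const_mul ρ).cos.neg).div_const (ρ ^ 2)
      refine this.congr_deriv ?_
      rw [show 2 * Real.pi * r * ‖ξ‖ = ρ * r by rw [hρ]; ring]
      rcases eq_or_ne r 0 with rfl | hr
      · simp
      · rw [Real.sinc_of_ne_zero (by positivity)]
        simp
        field_simp
    rw [intervalIntegral.integral_eq_sub_of_hasDerivAt hd]
    · simp
      ring
    · exact (continuous_id.mul (Real.continuous_sinc.comp (by fun_prop))).intervalIntegrable _ _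
  simp only [pow_zero, one_mul, sinSymbol, intervalIntegral.integral_ofReal, h1, cosSymbol]
  norm_cast
  rw [show 2 * Real.pi * 1 * ‖ξ‖ = ρ by rw [hρ]; ring,
    show (2 * Real.pi) ^ 2 * ‖ξ‖ ^ 2 = ρ ^ 2 by rw [hρ]; ring]
  field_simp
  ring

lemma sinSymbol_one_eq (ξ : E3) : sinSymbol 1 ξ = cosSymbol 1 ξ +
    ((2 * Real.pi) ^ 2 * ‖ξ‖ ^ 2 : ℝ) *
      ∫ r in (0 : ℝ)..1, (r : ℂ) ^ 1 * sinSymbol r ξ := by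
  rcases eq_or_ne ξ 0 with rfl | hξ
  · simp [cosSymbol, sinSymbol]
  set ρ := 2 * Real.pi * ‖ξ‖ with hρ
  have hρ0 : ρ ≠ 0 := by positivity
  have h1 : ∫ r in (0 : ℝ)..1, r * (r * Real.sinc (2 * Real.pi * r * ‖ξ‖)) =
      (Real.sin ρ - ρ * Real.cos ρ) / ρ ^ 3 := by
    have hd : ∀ r ∈ Set.uIcc (0 : ℝ) 1,
        HasDerivAt (fun r => (Real.sin (ρ * r) - ρ * r * Real.cos (ρ * r)) / ρ ^ 3)
        (r * (r * Real.sinc (2 * Real.pi * r * ‖ξ‖))) r := by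
      intro r _
      have h0 := (hasDerivAt_id r).const_mul ρ
      have := (h0.sin.sub (h0.mul h0.cos)).div_const (ρ ^ 3)
      refine this.congr_deriv ?_
      rw [show 2 * Real.pi * r * ‖ξ‖ = ρ * r by rw [hρ]; ring]
      rcases eq_or_ne r 0 with rfl | hr
      · simp
      · rw [Real.sinc_of_ne_zero (by positivity)]
        simp
        field_simp
        ring
    rw [intervalIntegral.integral_eq_sub_of_hasDerivAt hd]
    · simp
    · exact (continuous_id.mul (continuous_id.mul
        (Real.continuous_sinc.comp (by fun_prop)))).intervalIntegrable _ _
  have h2 : ∫ r in (0 : ℝ)..1, (r : ℂ) ^ 1 * sinSymbol r ξ =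
      ((∫ r in (0 : ℝ)..1, r * (r * Real.sinc (2 * Real.pi * r * ‖ξ‖)) : ℝ) : ℂ) := by
    rw [← intervalIntegral.integral_ofReal]
    simp [sinSymbol]
  rw [h2, h1]
  simp only [sinSymbol, cosSymbol]
  norm_cast
  rw [show 2 * Real.pi * 1 * ‖ξ‖ = ρ by rw [hρ]; ring,
    show (2 * Real.pi) ^ 2 * ‖ξ‖ ^ 2 = ρ ^ 2 by rw [hρ]; ring, Real.sinc_of_ne_zero hρ0]
  field_simp
  ring

lemma hasTemperateGrowth_sq_norm : (fun ξ : E3 =>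
    (((2 * Real.pi) ^ 2 * ‖ξ‖ ^ 2 : ℝ) : ℂ)).HasTemperateGrowth :=
  Function.HasTemperateGrowth.comp Function.Complex.hasTemperateGrowth_ofReal
    ((Function.HasTemperateGrowth.const _).mul (Function.hasTemperateGrowth_norm_sq E3))

lemma hasTemperateGrowth_cosSymbol_one : (cosSymbol 1).HasTemperateGrowth := by
  rw [funext cosSymbol_one_eq]
  exact (Function.HasTemperateGrowth.const _).sub
    (hasTemperateGrowth_sq_norm.mul (hasTemperateGrowth_integral_sinSymbol 0))

lemma hasTemperateGrowth_sinSymbol_one : (sinSymbol 1).HasTemperateGrowth := by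
  rw [funext sinSymbol_one_eq]
  exact hasTemperateGrowth_cosSymbol_one.add
    (hasTemperateGrowth_sq_norm.mul (hasTemperateGrowth_integral_sinSymbol 1))

/-- The symbol at time `t` is the symbol at time 1 evaluated at `tξ`. Temperate growth is the
hypothesis of `SchwartzMap.smulLeftCLM_apply_apply`, by which the multipliers are computed
pointwise. -/
theorem hasTemperateGrowth_cosSymbol (t : ℝ) : (cosSymbol t).HasTemperateGrowth := by
  have h : cosSymbol t = cosSymbol 1 ∘ (t • ContinuousLinearMap.id ℝ E3) := by
    ext ξ
    simp only [cosSymbol, Function.comp_apply, smul_apply, ContinuousLinearMap.id_apply, norm_smul,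
      Real.norm_eq_abs]
    rw [← Real.cos_abs]
    congr 2
    simp only [abs_mul, abs_norm, abs_of_pos Real.pi_pos]
    ring
  rw [h]
  exact hasTemperateGrowth_cosSymbol_one.comp (ContinuousLinearMap.hasTemperateGrowth _)

theorem hasTemperateGrowth_sinSymbol (t : ℝ) : (sinSymbol t).HasTemperateGrowth := by
  have hs : ∀ x : ℝ, Real.sinc |x| = Real.sinc x := fun x => by
    rcases abs_choice x with h | h <;> simp [h]
  have h : sinSymbol t = fun ξ => (t : ℂ) *
      (sinSymbol 1 ∘ (t • ContinuousLinearMap.id ℝ E3)) ξ := by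
    ext ξ
    simp only [sinSymbol, Function.comp_apply, smul_apply, ContinuousLinearMap.id_apply, norm_smul,
      Real.norm_eq_abs]
    rw [← hs (2 * Real.pi * t * ‖ξ‖), ← hs (2 * Real.pi * 1 * (|t| * ‖ξ‖))]
    simp only [abs_mul, abs_norm]
    simp only [abs_one, abs_abs, mul_one, one_mul, mul_assoc, Complex.ofReal_mul]
  rw [h]
  exact (Function.HasTemperateGrowth.const _).mul
    (hasTemperateGrowth_sinSymbol_one.comp (ContinuousLinearMap.hasTemperateGrowth _))

/-! ### Local finiteness and temperate growth of the cone measure -/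

instance : IsFiniteMeasureOnCompacts coneMeasure := by
  refine ⟨fun K hK => ?_⟩
  obtain ⟨R, hR⟩ := hK.isBounded.subset_closedBall 0
  refine (measure_mono hR).trans_lt ?_
  set h : ℝ → ℂ := (Set.Iic R).indicator fun _ => 1 with hh
  have h1 : Integrable (fun y : E3 => h ‖y‖) coneMeasure := by
    refine integrable_coneMeasure_norm (Measurable.indicator (by fun_prop) measurableSet_Iic) ?_
    have h2 : (fun r : ℝ => (r : ℂ) * h r) = (Set.Iic R).indicator fun r => (r : ℂ) := by
      ext r
      simp only [hh, Set.indicator]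
      split_ifs <;> simp
    rw [h2, IntegrableOn, integrable_indicator_iff measurableSet_Iic, IntegrableOn,
      Measure.restrict_restrict measurableSet_Iic, Set.inter_comm, Set.Ioi_inter_Iic]
    exact Continuous.integrableOn_Ioc (by fun_prop)
  have h2 : (fun y : E3 => h ‖y‖) = (Metric.closedBall 0 R).indicator fun _ => 1 := by
    ext y
    simp [hh, Set.indicator]
  rw [h2, integrable_indicator_iff Metric.isClosed_closedBall.measurableSet,
    integrableOn_const_iff] at h1
  simpa using h1

instance : coneMeasure.HasTemperateGrowth := by
  -- The weight `(1 + |ξ|)⁻³` suffices because `dξ/|ξ|` is `4π r dr` in the radius, and `r (1 +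
  -- r)⁻³` is integrable.
  refine ⟨3, ?_⟩
  have h1 : IntegrableOn (fun r : ℝ => (r : ℂ) * (((1 + r) ^ (-((3 : ℕ) : ℝ)) : ℝ) : ℂ))
      (Set.Ioi 0) := by
    have h2 : Integrable (fun r : ℝ => (1 + ‖r‖) ^ (-(2 : ℝ))) :=
      integrable_one_add_norm (by simp)
    refine h2.integrableOn.mono' (Measurable.aestronglyMeasurable (by fun_prop)) ?_
    filter_upwards [ae_restrict_mem measurableSet_Ioi] with r hr
    have hr0 : 0 < r := hr
    rw [norm_mul, Complex.norm_real, Complex.norm_real, Real.norm_of_nonneg hr0.le,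
      Real.norm_of_nonneg (by positivity)]
    calc r * (1 + r) ^ (-((3 : ℕ) : ℝ)) ≤ (1 + r) * (1 + r) ^ (-((3 : ℕ) : ℝ)) := by
          gcongr
          linarith
      _ = (1 + r) ^ (-(2 : ℝ)) := by
          nth_rewrite 1 [← Real.rpow_one (1 + r)]
          rw [← Real.rpow_add (by linarith)]
          norm_num
  have h3 := (integrable_coneMeasure_norm
    (h := fun r => (((1 + r) ^ (-((3 : ℕ) : ℝ)) : ℝ) : ℂ)) (by fun_prop) h1).norm
  refine h3.congr (.of_forall fun y => ?_)
  simp only [Complex.norm_real]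
  rw [Real.norm_of_nonneg (by positivity)]

/-! ### The half wave operator -/

/-- The character of spacetime with frequency `(|ξ|, ξ)` on the light cone. -/
noncomputable def coneChar (z : ℝ × E3) (ξ : E3) : ℂ :=
  Complex.exp (2 * Real.pi * Complex.I * (spacetimeInner z (‖ξ‖, ξ) : ℝ))

lemma norm_coneChar (z : ℝ × E3) (ξ : E3) : ‖coneChar z ξ‖ = 1 := by
  rw [coneChar, Complex.norm_exp]
  simp

@[fun_prop]
lemma continuous_coneChar {X : Type*} [TopologicalSpace X] {f : X → ℝ × E3} {g : X → E3}
    (hf : Continuous f) (hg : Continuous g) : Continuous fun x => coneChar (f x) (g x) := by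
  unfold coneChar spacetimeInner
  fun_prop

lemma measurable_coneChar (z : ℝ × E3) : Measurable (coneChar z) :=
  (continuous_coneChar continuous_const continuous_id).measurable

/-- `∫ e^{2πi(x·ξ + t|ξ|)} a(ξ) dξ/|ξ|`, a solution of the half wave equation. -/
noncomputable def halfWave (a : E3 → ℂ) (z : ℝ × E3) : ℂ := ∫ ξ, coneChar z ξ * a ξ ∂coneMeasure

lemma integrable_coneChar_mul {a : E3 → ℂ} (ha : Integrable a coneMeasure) (z : ℝ × E3) :
    Integrable (fun ξ => coneChar z ξ * a ξ) coneMeasure :=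
  ha.bdd_mul (c := 1) (measurable_coneChar z).aestronglyMeasurable
    (.of_forall fun ξ => (norm_coneChar z ξ).le)

lemma continuous_halfWave {a : E3 → ℂ} (ha : Integrable a coneMeasure) :
    Continuous (halfWave a) := by
  refine continuous_of_dominated (bound := fun ξ => ‖a ξ‖)
    (fun z => (integrable_coneChar_mul ha z).aestronglyMeasurable)
    (fun z => .of_forall fun ξ => ?_) ha.norm (.of_forall fun ξ => ?_)
  · rw [norm_mul, norm_coneChar, one_mul]
  · fun_prop

lemma norm_halfWave_le {a : E3 → ℂ} (z : ℝ × E3) :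
    ‖halfWave a z‖ ≤ ∫ ξ, ‖a ξ‖ ∂coneMeasure := by
  refine (norm_integral_le_integral_norm _).trans_eq ?_
  simp_rw [norm_mul, norm_coneChar, one_mul]

/-! ### An `L²` bound by duality with Schwartz functions -/

section Duality

variable {W : Type*} [NormedAddCommGroup W] [InnerProductSpace ℝ W]
    [FiniteDimensional ℝ W] [MeasurableSpace W] [BorelSpace W]

/-- Density of Schwartz functions in `L²(μ)` extends the functional, and the Riesz theorem
represents it. The measure is general since the lemma serves both for Lebesgue measure on spacetime
and for the measure of the cone. -/
lemma exists_Lp_two_of_forall_schwartz {μ : Measure W}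
    [μ.HasTemperateGrowth] [IsFiniteMeasureOnCompacts μ] (f : 𝓢(W, ℂ) →ₗ[ℂ] ℂ) {K : ℝ} (hK0 : 0 ≤ K)
    (hK : ∀ ψ : 𝓢(W, ℂ), ‖f ψ‖ ≤ K * ‖ψ.toLp 2 μ‖) :
    ∃ g : Lp ℂ 2 μ, ‖g‖ ≤ K ∧
      ∀ ψ : 𝓢(W, ℂ), f ψ = ∫ w, ψ w * (starRingEnd ℂ) (g w) ∂μ := by
  have he : DenseRange (SchwartzMap.toLpCLM ℂ ℂ 2 μ).toLinearMap :=
    SchwartzMap.denseRange_toLpCLM (by simp)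
  let L := f.extendOfNorm (SchwartzMap.toLpCLM ℂ ℂ 2 μ).toLinearMap
  have hL : ∀ ψ : 𝓢(W, ℂ), L (ψ.toLp 2 μ) = f ψ :=
    fun ψ => LinearMap.extendOfNorm_eq he ⟨K, hK⟩ ψ
  have hLn : ‖L‖ ≤ K := LinearMap.opNorm_extendOfNorm_le he hK0 hK
  clear_value L
  refine ⟨(InnerProductSpace.toDual ℂ (Lp ℂ 2 μ)).symm L, ?_, fun ψ => ?_⟩
  · rwa [LinearIsometryEquiv.norm_map]
  · rw [← hL, ← InnerProductSpace.toDual_symm_apply, L2.inner_def]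
    refine integral_congr_ae ?_
    filter_upwards [ψ.coeFn_toLp 2 μ] with w hw
    rw [hw]
    simp

/-- A locally integrable function is determined by its integrals against Schwartz functions. -/
lemma ae_eq_of_forall_schwartz {G G' : W → ℂ} (hG : LocallyIntegrable G)
    (hG' : LocallyIntegrable G')
    (h : ∀ ψ : 𝓢(W, ℂ), HasCompactSupport ψ → ∫ w, ψ w * G w = ∫ w, ψ w * G' w) :
    ∀ᵐ w, G w = G' w := by
  refine ae_eq_of_integral_contDiff_smul_eq hG hG' fun χ hχ hχc => ?_
  have hc : HasCompactSupport fun w => (χ w : ℂ) := hχc.comp_left (g := fun x : ℝ => (x : ℂ)) rfl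
  have h1 := h (hc.toSchwartzMap (Complex.ofRealCLM.contDiff.comp hχ)) hc
  have h2 : ∀ w, hc.toSchwartzMap (Complex.ofRealCLM.contDiff.comp hχ) w = (χ w : ℂ) := fun _ => rfl
  simp_rw [h2] at h1
  simpa only [Complex.real_smul] using h1

lemma exists_linearMap_schwartz {G : W → ℂ}
    (hGi : ∀ ψ : 𝓢(W, ℂ), Integrable fun w => ψ w * G w) :
    ∃ f : 𝓢(W, ℂ) →ₗ[ℂ] ℂ, ∀ ψ, f ψ = ∫ w, ψ w * G w :=
  ⟨{ toFun := fun ψ : 𝓢(W, ℂ) => ∫ w, ψ w * G w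
     map_add' := fun ψ χ => by
        rw [← integral_add (hGi ψ) (hGi χ)]
        refine integral_congr_ae (.of_forall fun w => ?_)
        exact add_mul (ψ w) (χ w) (G w)
     map_smul' := fun c ψ => by
        rw [RingHom.id_apply, smul_eq_mul, ← integral_const_mul]
        refine integral_congr_ae (.of_forall fun w => ?_)
        exact mul_assoc c (ψ w) (G w) }, fun _ => rfl⟩

/-- Membership of `G` in `L²` is part of the conclusion. The Riesz representative has the same
integrals against test functions as the locally integrable `G`, hence agrees with it almost
everywhere. -/
lemma eLpNorm_two_le_of_forall_schwartz {G : W → ℂ}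
    (hG : LocallyIntegrable G) (hGi : ∀ ψ : 𝓢(W, ℂ), Integrable fun w => ψ w * G w) {K : ℝ}
    (hK0 : 0 ≤ K) (hK : ∀ ψ : 𝓢(W, ℂ), ‖∫ w, ψ w * G w‖ ≤ K * ‖ψ.toLp 2‖) :
    eLpNorm G 2 ≤ ENNReal.ofReal K := by
  obtain ⟨f, hf⟩ := exists_linearMap_schwartz hGi
  obtain ⟨g, hg, hgG⟩ := exists_Lp_two_of_forall_schwartz f hK0 fun ψ => (hf ψ).symm ▸ hK ψ
  simp_rw [hf] at hgG
  have hgn : eLpNorm g 2 = ENNReal.ofReal ‖g‖ := by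
    rw [Lp.norm_def, ENNReal.ofReal_toReal (Lp.eLpNorm_ne_top g)]
  have hgm : MemLp (fun w => (starRingEnd ℂ) (g w)) 2 := (Lp.memLp g).star
  have hae := ae_eq_of_forall_schwartz hG (hgm.locallyIntegrable (by norm_num)) fun ψ _ => hgG ψ
  have hn : eLpNorm G 2 volume = eLpNorm g 2 volume :=
    (eLpNorm_congr_ae hae).trans (eLpNorm_congr_norm_ae (.of_forall fun w => RCLike.norm_conj (g w)))
  rw [hn, hgn]
  exact ENNReal.ofReal_le_ofReal hg

end Duality

/-! ### The Strichartz estimate -/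

/-- Frequency space with its Euclidean structure. -/
abbrev SpacetimeL2 : Type := WithLp 2 (ℝ × E3)

lemma coneChar_mul_coneChar (w : SpacetimeL2) (ξ η : E3) :
    coneChar w.ofLp ξ * coneChar w.ofLp η = Complex.exp (2 * Real.pi * Complex.I *
      (inner ℝ w (WithLp.toLp 2 (‖ξ‖ + ‖η‖, ξ + η)) : ℝ)) := by
  rw [coneChar, coneChar, ← Complex.exp_add, ← mul_add, ← Complex.ofReal_add]
  congr 3
  simp only [spacetimeInner, WithLp.prod_inner_apply, inner_add_right]
  simp
  ring

/-- The product of two characters of the cone is the character of frequency `(|ξ| + |η|, ξ + η)`.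
Writing the square as a double integral and applying Fubini moves the Fourier transform onto `ψ`.
Spacetime carries its Euclidean norm here, so that the inner product is the pairing of the
characters. -/
lemma integral_schwartz_mul_halfWave_sq {a : E3 → ℂ} (ha : Integrable a coneMeasure)
    (ψ : 𝓢(SpacetimeL2, ℂ)) :
    ∫ w, ψ w * halfWave a w.ofLp ^ 2 = ∫ p : E3 × E3, (a p.1 * a p.2) *
      (𝓕⁻ ψ) (WithLp.toLp 2 (‖p.1‖ + ‖p.2‖, p.1 + p.2)) ∂(coneMeasure.prod coneMeasure) := by
  have h1 : ∀ w : SpacetimeL2, halfWave a w.ofLp ^ 2 = ∫ p : E3 × E3,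
      (coneChar w.ofLp p.1 * coneChar w.ofLp p.2) * (a p.1 * a p.2)
        ∂(coneMeasure.prod coneMeasure) := by
    intro w
    rw [sq, halfWave, ← integral_prod_mul]
    refine integral_congr_ae (.of_forall fun p => ?_)
    simp only
    ring
  have hc : Continuous fun q : SpacetimeL2 × (E3 × E3) =>
      coneChar q.1.ofLp q.2.1 * coneChar q.1.ofLp q.2.2 := by fun_prop
  have hn : ∀ q : SpacetimeL2 × (E3 × E3),
      ‖coneChar q.1.ofLp q.2.1 * coneChar q.1.ofLp q.2.2‖ ≤ 1 := fun q => by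
    rw [norm_mul, norm_coneChar, norm_coneChar, one_mul]
  have hi : Integrable (fun q : SpacetimeL2 × (E3 × E3) => ψ q.1 * (a q.2.1 * a q.2.2))
      (volume.prod (coneMeasure.prod coneMeasure)) := ψ.integrable.mul_prod (ha.mul_prod ha)
  have hint : Integrable (fun q : SpacetimeL2 × (E3 × E3) =>
      (coneChar q.1.ofLp q.2.1 * coneChar q.1.ofLp q.2.2) * (ψ q.1 * (a q.2.1 * a q.2.2)))
      (volume.prod (coneMeasure.prod coneMeasure)) :=
    hi.bdd_mul hc.aestronglyMeasurable (.of_forall hn)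
  calc ∫ w, ψ w * halfWave a w.ofLp ^ 2
      = ∫ w, ∫ p : E3 × E3, (coneChar w.ofLp p.1 * coneChar w.ofLp p.2) *
          (ψ w * (a p.1 * a p.2)) ∂(coneMeasure.prod coneMeasure) := by
        refine integral_congr_ae (.of_forall fun w => ?_)
        simp only
        rw [h1, ← integral_const_mul]
        refine integral_congr_ae (.of_forall fun p => ?_)
        simp only
        ring
    _ = ∫ p : E3 × E3, (∫ w : SpacetimeL2, (coneChar w.ofLp p.1 * coneChar w.ofLp p.2) *
          (ψ w * (a p.1 * a p.2))) ∂(coneMeasure.prod coneMeasure) := integral_integral_swap hint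
    _ = _ := by
        refine integral_congr_ae (.of_forall fun p => ?_)
        simp only
        rw [SchwartzMap.fourierInv_coe, Real.fourierInv_eq', ← integral_const_mul]
        refine integral_congr_ae (.of_forall fun w => ?_)
        simp only [coneChar_mul_coneChar, smul_eq_mul]
        push_cast
        ring_nf

lemma lintegral_enorm_sq {α : Type*} [MeasurableSpace α] {μ : Measure α} (f : α → ℂ) :
    ∫⁻ x, ‖f x‖ₑ ^ (2 : ℝ) ∂μ = eLpNorm f 2 μ ^ 2 := by
  rw [eLpNorm_eq_lintegral_rpow_enorm_toReal (by norm_num) (by norm_num)]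
  rw [← ENNReal.rpow_natCast, ← ENNReal.rpow_mul]
  simp

/-- Cauchy–Schwarz on the product of two cones separates `a ⊗ a`, of norm `‖a‖²`, from the transform
of `ψ` at sums of cone points. The convolution bound controls the latter by `√(2π)` times its `L²`
norm on spacetime, and Plancherel returns to `ψ`. -/
lemma enorm_integral_schwartz_mul_halfWave_sq_le {a : E3 → ℂ} (ha : Integrable a coneMeasure)
    (ψ : 𝓢(SpacetimeL2, ℂ)) :
    ‖∫ w, ψ w * halfWave a w.ofLp ^ 2‖ₑ ≤
      ENNReal.ofReal √(2 * Real.pi) * eLpNorm a 2 coneMeasure ^ 2 * eLpNorm ψ 2 := by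
  rw [integral_schwartz_mul_halfWave_sq ha]
  refine (enorm_integral_le_lintegral_enorm _).trans ?_
  simp_rw [enorm_mul]
  have hpsi : Continuous fun z : ℝ × E3 => (𝓕⁻ ψ) (WithLp.toLp 2 z) :=
    (𝓕⁻ ψ).continuous.comp (by fun_prop)
  have hae : AEMeasurable (fun ξ => ‖a ξ‖ₑ) coneMeasure := ha.aestronglyMeasurable.enorm
  have hm1 : AEMeasurable (fun p : E3 × E3 => ‖a p.1‖ₑ * ‖a p.2‖ₑ)
      (coneMeasure.prod coneMeasure) := hae.comp_fst.mul hae.comp_snd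
  have hm2 : Continuous (fun p : E3 × E3 =>
      ‖(𝓕⁻ ψ) (WithLp.toLp 2 (‖p.1‖ + ‖p.2‖, p.1 + p.2))‖ₑ) :=
    (hpsi.comp (by fun_prop : Continuous fun p : E3 × E3 => (‖p.1‖ + ‖p.2‖, p.1 + p.2))).enorm
  have h0 := ENNReal.lintegral_mul_le_Lp_mul_Lq _ Real.HolderConjugate.two_two hm1
    hm2.measurable.aemeasurable
  simp only [Pi.mul_apply] at h0
  have h1 : (∫⁻ p : E3 × E3, (‖a p.1‖ₑ * ‖a p.2‖ₑ) ^ (2 : ℝ) ∂(coneMeasure.prod coneMeasure)) ^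
      (1 / 2 : ℝ) = eLpNorm a 2 coneMeasure ^ 2 := by
    simp_rw [ENNReal.mul_rpow_of_nonneg _ _ (zero_le_two (α := ℝ))]
    rw [lintegral_prod_mul (hae.pow_const _) (hae.pow_const _), lintegral_enorm_sq, ← sq,
      ← ENNReal.rpow_natCast, ← ENNReal.rpow_mul]
    simp
  have h2 : (∫⁻ p : E3 × E3, ‖(𝓕⁻ ψ) (WithLp.toLp 2 (‖p.1‖ + ‖p.2‖, p.1 + p.2))‖ₑ ^ (2 : ℝ)
      ∂(coneMeasure.prod coneMeasure)) ^ (1 / 2 : ℝ) ≤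
      ENNReal.ofReal √(2 * Real.pi) * eLpNorm ψ 2 := by
    have h3 := lintegral_coneMeasure_convolution_le
      (fun z => ‖(𝓕⁻ ψ) (WithLp.toLp 2 z)‖ₑ ^ (2 : ℝ)) (hpsi.enorm.measurable.pow_const _)
    rw [lintegral_prod _ (hm2.measurable.pow_const _).aemeasurable]
    have h4 : ∫⁻ z : ℝ × E3, ‖(𝓕⁻ ψ) (WithLp.toLp 2 z)‖ₑ ^ (2 : ℝ) = eLpNorm ψ 2 ^ 2 := by
      have h6 := (WithLp.volume_preserving_toLp ℝ E3).lintegral_comp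
        (f := fun w => ‖(𝓕⁻ ψ) w‖ₑ ^ (2 : ℝ)) ((𝓕⁻ ψ).continuous.enorm.measurable.pow_const _)
      refine h6.trans ?_
      rw [lintegral_enorm_sq]
      congr 1
      have h5 := SchwartzMap.norm_fourier_toL2_eq (𝓕⁻ ψ)
      rw [FourierTransform.fourier_fourierInv_eq, SchwartzMap.norm_toLp, SchwartzMap.norm_toLp] at h5
      exact ((ENNReal.toReal_eq_toReal_iff' (SchwartzMap.eLpNorm_lt_top _ _ _).ne
        (SchwartzMap.eLpNorm_lt_top _ _ _).ne).1 h5).symm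
    rw [h4] at h3
    refine (ENNReal.rpow_le_rpow h3 (by norm_num : (0 : ℝ) ≤ 1 / 2)).trans_eq ?_
    rw [ENNReal.mul_rpow_of_nonneg _ _ (by norm_num), ENNReal.ofReal_rpow_of_nonneg (by positivity)
      (by norm_num), ← Real.sqrt_eq_rpow, ← ENNReal.rpow_natCast, ← ENNReal.rpow_mul]
    simp
  rw [h1] at h0
  refine h0.trans ((mul_le_mul_right h2 _).trans_eq ?_)
  ring

/-- The Strichartz constant obtained here. -/
noncomputable def strichartzConst : ℝ := √√(2 * Real.pi)

/-- The `L⁴` norm squared is the `L²` norm of the square, which is bounded by duality. The square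
root of `√(2π)` gives the constant. -/
theorem eLpNorm_halfWave_le {a : E3 → ℂ} (ha : Integrable a coneMeasure)
    (ha2 : MemLp a 2 coneMeasure) :
    eLpNorm (halfWave a) 4 volume ≤
      ENNReal.ofReal strichartzConst * eLpNorm a 2 coneMeasure := by
  have hmp := WithLp.volume_preserving_ofLp ℝ E3
  have hc : Continuous fun w : SpacetimeL2 => halfWave a w.ofLp ^ 2 :=
    ((continuous_halfWave ha).comp (by fun_prop)).pow 2
  set A := (eLpNorm a 2 coneMeasure).toReal with hA
  have hA' : eLpNorm a 2 coneMeasure = ENNReal.ofReal A :=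
    (ENNReal.ofReal_toReal ha2.eLpNorm_ne_top).symm
  have h1 : eLpNorm (fun w : SpacetimeL2 => halfWave a w.ofLp ^ 2) 2 volume ≤
      ENNReal.ofReal (√(2 * Real.pi) * A ^ 2) := by
    refine eLpNorm_two_le_of_forall_schwartz hc.locallyIntegrable (fun ψ => ?_) (by positivity)
      fun ψ => ?_
    · refine ψ.integrable.mul_bdd (c := (∫ ξ, ‖a ξ‖ ∂coneMeasure) ^ 2)
        hc.aestronglyMeasurable (.of_forall fun w => ?_)
      rw [norm_pow]
      gcongr
      exact norm_halfWave_le _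
    · have h2 := enorm_integral_schwartz_mul_halfWave_sq_le ha ψ
      rw [hA', ← ENNReal.ofReal_toReal (SchwartzMap.eLpNorm_lt_top ψ 2 volume).ne,
        ← SchwartzMap.norm_toLp, ← ENNReal.ofReal_pow (by positivity),
        ← ENNReal.ofReal_mul (by positivity), ← ENNReal.ofReal_mul (by positivity),
        ← ofReal_norm, ENNReal.ofReal_le_ofReal_iff (by positivity)] at h2
      exact h2
  have h3 : eLpNorm (fun w : SpacetimeL2 => halfWave a w.ofLp ^ 2) 2 volume =
      eLpNorm (halfWave a) 4 volume ^ 2 := by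
    have h4 := eLpNorm_comp_measurePreserving (p := 2)
      (g := fun z : ℝ × E3 => halfWave a z ^ 2)
      ((continuous_halfWave ha).pow 2).aestronglyMeasurable hmp
    refine h4.trans ?_
    have h5 := eLpNorm_norm_rpow (μ := (volume : Measure (ℝ × E3))) (p := 2) (halfWave a)
      (q := 2) two_pos
    have h6 : (2 : ℝ≥0∞) * ENNReal.ofReal 2 = 4 := by norm_num
    rw [h6] at h5
    rw [← ENNReal.rpow_natCast]
    refine Eq.trans (eLpNorm_congr_norm_ae (.of_forall fun z => ?_)) h5
    simp
  rw [h3, ENNReal.ofReal_mul (by positivity), ENNReal.ofReal_pow (by positivity), ← hA',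
    ← Real.sq_sqrt (Real.sqrt_nonneg (2 * Real.pi)), ENNReal.ofReal_pow (by positivity),
    ← mul_pow] at h1
  exact (ENNReal.pow_le_pow_left_iff two_ne_zero).1 h1

/-! ### Hölder's inequality and slices -/

instance : ENNReal.HolderConjugate 4 (4 / 3) := by
  refine ENNReal.HolderConjugate.of_toReal ?_
  rw [Real.holderConjugate_iff]
  norm_num [ENNReal.toReal_div]

instance : ENNReal.HolderConjugate (4 / 3) 4 := ENNReal.HolderConjugate.symm

instance : Fact ((1 : ℝ≥0∞) ≤ 4) := ⟨by norm_num⟩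

lemma eLpNorm_mul_le {α : Type*} [MeasurableSpace α] {μ : Measure α} {p q : ℝ≥0∞}
    [p.HolderConjugate q] {f g : α → ℂ} (hf : AEStronglyMeasurable f μ)
    (hg : AEStronglyMeasurable g μ) :
    eLpNorm (fun x => f x * g x) 1 μ ≤ eLpNorm f p μ * eLpNorm g q μ := by
  have h := eLpNorm_smul_le_mul_eLpNorm (μ := μ) (φ := f) (f := g) (p := p) (q := q) (r := 1) hg hf
  exact h

lemma integrable_mul_of_memLp {α : Type*} [MeasurableSpace α] {μ : Measure α} (p q : ℝ≥0∞)
    [p.HolderConjugate q] {f g : α → ℂ} (hf : MemLp f p μ) (hg : MemLp g q μ) :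
    Integrable (fun x => f x * g x) μ := by
  rw [← memLp_one_iff_integrable]
  exact ⟨hf.1.mul hg.1, (eLpNorm_mul_le hf.1 hg.1).trans_lt (ENNReal.mul_lt_top hf.2 hg.2)⟩

lemma enorm_integral_mul_le {α : Type*} [MeasurableSpace α] {μ : Measure α} (p q : ℝ≥0∞)
    [p.HolderConjugate q] {f g : α → ℂ} (hf : AEStronglyMeasurable f μ)
    (hg : AEStronglyMeasurable g μ) :
    ‖∫ x, f x * g x ∂μ‖ₑ ≤ eLpNorm f p μ * eLpNorm g q μ := by
  refine (enorm_integral_le_lintegral_enorm _).trans ?_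
  rw [← eLpNorm_one_eq_lintegral_enorm]
  exact eLpNorm_mul_le hf hg

lemma eLpNorm_four_pow {α F : Type*} [MeasurableSpace α] [NormedAddCommGroup F] {μ : Measure α}
    (f : α → F) : eLpNorm f 4 μ ^ 4 = ∫⁻ x, ‖f x‖ₑ ^ 4 ∂μ := by
  rw [eLpNorm_eq_lintegral_rpow_enorm_toReal (by norm_num) (by norm_num), ← ENNReal.rpow_natCast,
    ← ENNReal.rpow_mul]
  simp only [ENNReal.toReal_ofNat]
  norm_num

lemma lintegral_eLpNorm_slice {F : Type*} [NormedAddCommGroup F] {w : ℝ × E3 → F}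
    (hw : AEStronglyMeasurable w volume) :
    ∫⁻ t, eLpNorm (fun x => w (t, x)) 4 volume ^ 4 = eLpNorm w 4 volume ^ 4 := by
  simp_rw [eLpNorm_four_pow]
  rw [Measure.volume_eq_prod] at hw ⊢
  rw [lintegral_prod _ (hw.enorm.pow_const 4)]

lemma aemeasurable_eLpNorm_slice {F : Type*} [NormedAddCommGroup F] {w : ℝ × E3 → F}
    (hw : AEStronglyMeasurable w volume) :
    AEMeasurable (fun t => eLpNorm (fun x => w (t, x)) 4 volume ^ 4) volume := by
  simp_rw [eLpNorm_four_pow]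
  rw [Measure.volume_eq_prod] at hw
  exact (hw.enorm.pow_const 4).lintegral_prod_right'

lemma ae_aestronglyMeasurable_slice {F : Type*} [NormedAddCommGroup F] {w : ℝ × E3 → F}
    (hw : AEStronglyMeasurable w volume) :
    ∀ᵐ t : ℝ, AEStronglyMeasurable (fun x => w (t, x)) volume := by
  rw [Measure.volume_eq_prod] at hw
  exact hw.prodMk_left

lemma ae_memLp_slice {F : Type*} [NormedAddCommGroup F] {w : ℝ × E3 → F}
    (hw : MemLp w 4 volume) : ∀ᵐ t : ℝ, MemLp (fun x => w (t, x)) 4 volume := by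
  have h1 := lintegral_eLpNorm_slice hw.1
  have h2 : ∀ᵐ t : ℝ, eLpNorm (fun x => w (t, x)) 4 volume ^ 4 < ∞ := by
    refine ae_lt_top' (aemeasurable_eLpNorm_slice hw.1) ?_
    rw [h1]
    exact ENNReal.pow_ne_top hw.2.ne
  filter_upwards [h2, ae_aestronglyMeasurable_slice hw.1] with t ht ht'
  refine ⟨ht', ?_⟩
  by_contra hc
  rw [not_lt, top_le_iff] at hc
  simp [hc] at ht

lemma eLpNorm_ofReal_complex {α : Type*} [MeasurableSpace α] {μ : Measure α} {p : ℝ≥0∞}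
    (f : α → ℝ) : eLpNorm (fun x => (f x : ℂ)) p μ = eLpNorm f p μ :=
  eLpNorm_congr_norm_ae (.of_forall fun x => by simp)

/-! ### Time-dependent distributions represented by functions -/

/-- Two functions in `L⁴` whose slices agree as distributions are equal. -/
lemma ae_eq_of_forall_slice {w w' : ℝ × E3 → ℝ} (hw : AEStronglyMeasurable w volume)
    (hw' : AEStronglyMeasurable w' volume)
    (h : ∀ᵐ t : ℝ, ∀ᵐ x : E3, w (t, x) = w' (t, x)) : w =ᵐ[volume] w' := by
  have h1 := lintegral_eLpNorm_slice (hw.sub hw')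
  have h2 : ∫⁻ t, eLpNorm (fun x => (w - w') (t, x)) 4 volume ^ 4 = 0 := by
    rw [lintegral_eq_zero_iff' (aemeasurable_eLpNorm_slice (hw.sub hw'))]
    filter_upwards [h] with t ht
    have h3 : eLpNorm (fun x => (w - w') (t, x)) 4 volume = 0 := by
      rw [← eLpNorm_zero (μ := (volume : Measure E3)) (ε := ℝ) (p := 4)]
      refine eLpNorm_congr_ae ?_
      filter_upwards [ht] with x hx
      simp [hx]
    simp only [h3]
    simp
  rw [h2] at h1
  have h4 : eLpNorm (w - w') 4 volume = 0 := by simpa using h1.symm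
  rw [eLpNorm_eq_zero_iff (hw.sub hw') (by norm_num)] at h4
  filter_upwards [h4] with z hz
  simpa [sub_eq_zero] using hz

lemma Represents.ae_eq {w w' : ℝ × E3 → ℝ} {W : ℝ → 𝓢(E3, ℂ) → ℂ} (h : Represents w W)
    (h' : Represents w' W) : w =ᵐ[volume] w' := by
  refine ae_eq_of_forall_slice h.1.1 h'.1.1 ?_
  filter_upwards [h.2, h'.2, ae_memLp_slice h.1, ae_memLp_slice h'.1] with t ht ht' hm hm'
  have h1 := ae_eq_of_forall_schwartz (G := fun x => (w (t, x) : ℂ))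
    (G' := fun x => (w' (t, x) : ℂ)) (hm.ofReal.locallyIntegrable (by norm_num))
    (hm'.ofReal.locallyIntegrable (by norm_num)) fun φ _ => by
      simp_rw [mul_comm (φ _)]
      rw [ht, ht']
  filter_upwards [h1] with x hx
  exact_mod_cast hx

lemma Represents.congr_ae {w w' : ℝ × E3 → ℝ} {W : ℝ → 𝓢(E3, ℂ) → ℂ} (h : Represents w W)
    (hw : w =ᵐ[volume] w') : Represents w' W := by
  refine ⟨h.1.ae_eq hw, ?_⟩
  rw [Measure.volume_eq_prod] at hw
  filter_upwards [h.2, Measure.ae_ae_of_ae_prod hw] with t ht hx φ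
  rw [← ht]
  refine integral_congr_ae ?_
  filter_upwards [hx] with x hx
  rw [hx]

lemma Represents.add {w w' : ℝ × E3 → ℝ} {W W' : ℝ → 𝓢(E3, ℂ) → ℂ} (h : Represents w W)
    (h' : Represents w' W') : Represents (w + w') (fun t φ => W t φ + W' t φ) := by
  refine ⟨h.1.add h'.1, ?_⟩
  filter_upwards [h.2, h'.2, ae_memLp_slice h.1, ae_memLp_slice h'.1] with t ht ht' hm hm' φ
  have h1 := integral_add (integrable_mul_of_memLp 4 (4 / 3) hm.ofReal (φ.memLp _ _))
    (integrable_mul_of_memLp 4 (4 / 3) hm'.ofReal (φ.memLp _ _))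
  refine Eq.trans ?_ (h1.trans (congrArg₂ _ (ht φ) (ht' φ)))
  refine integral_congr_ae (.of_forall fun x => ?_)
  simp [add_mul]

lemma Represents.const_mul {w : ℝ × E3 → ℝ} {W : ℝ → 𝓢(E3, ℂ) → ℂ} (h : Represents w W)
    (c : ℝ) : Represents (fun z => c * w z) (fun t φ => c * W t φ) := by
  refine ⟨h.1.const_mul c, ?_⟩
  filter_upwards [h.2] with t ht φ
  rw [← ht, ← integral_const_mul]
  refine integral_congr_ae (.of_forall fun x => ?_)
  simp [mul_assoc]

/-- The class of represented distributions is closed under convergence in `L⁴`. -/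
lemma represents_of_tendsto {w : ℕ → ℝ × E3 → ℝ} {v : ℝ × E3 → ℝ}
    {W : ℕ → ℝ → 𝓢(E3, ℂ) → ℂ} {V : ℝ → 𝓢(E3, ℂ) → ℂ} (h : ∀ n, Represents (w n) (W n))
    (hv : MemLp v 4 volume) (hwv : Tendsto (fun n => eLpNorm (w n - v) 4 volume) atTop (𝓝 0))
    (hWV : ∀ t φ, Tendsto (fun n => W n t φ) atTop (𝓝 (V t φ))) : Represents v V := by
  refine ⟨hv, ?_⟩
  set f : ℕ → ℝ → ℝ≥0∞ := fun n t => eLpNorm (fun x => (w n - v) (t, x)) 4 volume ^ 4 with hf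
  have hfm : ∀ n, AEMeasurable (f n) := fun n =>
    aemeasurable_eLpNorm_slice ((h n).1.1.sub hv.1)
  -- Convergence in `L⁴` of spacetime does not give convergence of almost every slice. By Fatou's
  -- lemma, almost every slice is approximated along infinitely many `n`; this is enough because the
  -- other side converges for every `t`.
  have h0 : ∫⁻ t, liminf (fun n => f n t) atTop = 0 := by
    rw [← nonpos_iff_eq_zero]
    refine (lintegral_liminf_le' hfm).trans_eq ?_
    simp_rw [hf, fun n => lintegral_eLpNorm_slice ((h n).1.1.sub hv.1)]
    have h1 : Tendsto (fun n => eLpNorm (w n - v) 4 volume ^ 4) atTop (𝓝 (0 ^ 4)) :=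
      ENNReal.Tendsto.pow hwv
    simpa using h1.liminf_eq
  have h0m : AEMeasurable (fun t => liminf (fun n => f n t) atTop) :=
    ⟨fun t => liminf (fun n => (hfm n).mk _ t) atTop,
      Measurable.liminf fun n => (hfm n).measurable_mk, by
        filter_upwards [ae_all_iff.2 fun n => (hfm n).ae_eq_mk] with t ht
        simp_rw [ht]⟩
  rw [lintegral_eq_zero_iff' h0m] at h0
  filter_upwards [h0, ae_all_iff.2 fun n => (h n).2, ae_memLp_slice hv,
    ae_all_iff.2 fun n => ae_memLp_slice (h n).1] with t ht hW hm hmn φ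
  have h2 : ∀ n, ‖V t φ - ∫ x : E3, (v (t, x) : ℂ) * φ x‖ₑ ≤ ‖V t φ - W n t φ‖ₑ +
      eLpNorm (fun x => (w n - v) (t, x)) 4 volume * eLpNorm φ (4 / 3) volume := fun n => by
    have h3 : V t φ - ∫ x : E3, (v (t, x) : ℂ) * φ x = (V t φ - W n t φ) +
        ∫ x : E3, ((w n - v) (t, x) : ℝ) * φ x := by
      have h4 := integral_sub
        (integrable_mul_of_memLp 4 (4 / 3) (hmn n).ofReal (φ.memLp _ _))
        (integrable_mul_of_memLp 4 (4 / 3) hm.ofReal (φ.memLp _ _))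
      have h5 : ∫ x : E3, ((w n - v) (t, x) : ℝ) * φ x =
          W n t φ - ∫ x : E3, (v (t, x) : ℂ) * φ x := by
        refine Eq.trans ?_ (h4.trans (congrArg₂ _ (hW n φ) rfl))
        refine integral_congr_ae (.of_forall fun x => ?_)
        simp [sub_mul]
      rw [h5, sub_add_sub_cancel]
    rw [h3]
    refine (enorm_add_le _ _).trans (add_le_add_right ?_ _)
    refine (enorm_integral_mul_le 4 (4 / 3) ((hmn n).sub hm).ofReal.1
      φ.continuous.aestronglyMeasurable).trans_eq ?_
    rw [← eLpNorm_ofReal_complex (fun x => (w n - v) (t, x))]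
    rfl
  have h4 : ‖V t φ - ∫ x : E3, (v (t, x) : ℂ) * φ x‖ₑ = 0 := by
    set K := eLpNorm φ (4 / 3) volume with hK
    have hKt : K ≠ ∞ := (φ.memLp (4 / 3) volume).2.ne
    refine le_antisymm (ENNReal.le_of_forall_pos_le_add fun ε hε _ => ?_) (zero_le)
    rw [zero_add]
    have h5 : Tendsto (fun n => ‖V t φ - W n t φ‖ₑ) atTop (𝓝 0) := by
      have := (tendsto_const_nhds (x := V t φ)).sub (hWV t φ)
      simpa using this.enorm
    have hε2 : (0 : ℝ≥0∞) < ε / 2 := by simpa using hε.ne'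
    have h6 : ∀ᶠ n in atTop, ‖V t φ - W n t φ‖ₑ < ε / 2 := h5.eventually_lt_const hε2
    have h7 : ∃ᶠ n in atTop, f n t < (ε / 2 / (K + 1)) ^ 4 := by
      refine frequently_lt_of_liminf_lt (by isBoundedDefault) ?_
      rw [ht]
      exact (ENNReal.pow_pos (ENNReal.div_pos hε2.ne' (by finiteness)) 4)
    obtain ⟨n, hn1, hn2⟩ := (h7.and_eventually h6).exists
    have h8 : eLpNorm (fun x => (w n - v) (t, x)) 4 volume ≤ ε / 2 / (K + 1) :=
      ((ENNReal.pow_lt_pow_left_iff (by norm_num : (4 : ℕ) ≠ 0)).1 hn1).le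
    refine (h2 n).trans ?_
    calc _ ≤ (ε : ℝ≥0∞) / 2 + ε / 2 / (K + 1) * (K + 1) := by
          gcongr
          exact le_self_add
      _ = ε := by
          rw [ENNReal.div_mul_cancel (by simp) (by finiteness), ENNReal.add_halves]
  rw [enorm_eq_zero, sub_eq_zero] at h4
  exact h4.symm

/-! ### Real solutions of the wave equation from a single profile -/

/-- The profile `conj (a (-ξ))`, corresponding to complex conjugation in space. -/
noncomputable def reflProfile (a : E3 → ℂ) (ξ : E3) : ℂ := (starRingEnd ℂ) (a (-ξ))

/-- The profile at time `t`. -/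
noncomputable def propag (t : ℝ) (a : E3 → ℂ) (ξ : E3) : ℂ := coneChar (t, 0) ξ * a ξ

/-- The real solution of the wave equation with the profile `a`. -/
noncomputable def freeSol (a : E3 → ℂ) (z : ℝ × E3) : ℝ := 2 * (halfWave a z).re

/-- The distribution with the profile `a`. -/
noncomputable def wavePair (a : E3 → ℂ) (φ : 𝓢(E3, ℂ)) : ℂ :=
  ∫ ξ, (a ξ + reflProfile a ξ) * 𝓕⁻ φ ξ ∂coneMeasure

/-- The time derivative of the distribution with the profile `a`. -/
noncomputable def velPair (a : E3 → ℂ) (φ : 𝓢(E3, ℂ)) : ℂ :=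
  ∫ ξ, (2 * Real.pi * Complex.I * ‖ξ‖) * (a ξ - reflProfile a ξ) * 𝓕⁻ φ ξ ∂coneMeasure

lemma measurePreserving_neg_coneMeasure :
    MeasurePreserving (fun ξ : E3 => -ξ) coneMeasure coneMeasure := by
  refine ⟨measurable_neg, ?_⟩
  ext s hs
  rw [Measure.map_apply measurable_neg hs, ← lintegral_indicator_one (measurable_neg hs),
    ← lintegral_indicator_one hs, lintegral_coneMeasure, lintegral_coneMeasure,
    ← lintegral_neg_eq_self]
  refine lintegral_congr fun ξ => ?_
  have h : -ξ ∈ Neg.neg ⁻¹' s ↔ ξ ∈ s := by rw [Set.mem_preimage, neg_neg]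
  by_cases hx : ξ ∈ s
  · simp only [Set.indicator, if_pos hx, if_pos (h.2 hx), norm_neg, Pi.one_apply]
  · simp only [Set.indicator, if_neg hx, if_neg (mt h.1 hx), norm_neg]

lemma reflProfile_reflProfile (a : E3 → ℂ) : reflProfile (reflProfile a) = a := by
  ext ξ
  simp [reflProfile]

lemma coneChar_zero_right_neg (t : ℝ) (ξ : E3) : coneChar (t, 0) (-ξ) = coneChar (t, 0) ξ := by
  simp [coneChar, spacetimeInner]

lemma conj_coneChar (z : ℝ × E3) (ξ : E3) :
    (starRingEnd ℂ) (coneChar z ξ) = coneChar (-z) ξ := by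
  rw [coneChar, coneChar, ← Complex.exp_conj]
  simp only [map_mul, Complex.conj_I, Complex.conj_ofReal, spacetimeInner, Prod.fst_neg,
    Prod.snd_neg, inner_neg_left]
  rw [map_ofNat]
  congr 1
  push_cast
  ring

lemma coneChar_add (z w : ℝ × E3) (ξ : E3) :
    coneChar (z + w) ξ = coneChar z ξ * coneChar w ξ := by
  rw [coneChar, coneChar, coneChar, ← Complex.exp_add]
  congr 1
  simp only [spacetimeInner, Prod.fst_add, Prod.snd_add, inner_add_left]
  push_cast
  ring

lemma coneChar_zero (ξ : E3) : coneChar 0 ξ = 1 := by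
  simp [coneChar, spacetimeInner]

lemma propag_propag (s t : ℝ) (a : E3 → ℂ) : propag s (propag t a) = propag (s + t) a := by
  ext ξ
  have h : ((s + t, 0) : ℝ × E3) = (s, 0) + (t, 0) := by simp
  rw [propag, propag, propag, h, coneChar_add, mul_assoc]

lemma propag_zero (a : E3 → ℂ) : propag 0 a = a := by
  ext ξ
  have h : ((0, 0) : ℝ × E3) = 0 := rfl
  rw [propag, h, coneChar_zero, one_mul]

lemma propag_sub (t : ℝ) (a b : E3 → ℂ) : propag t (a - b) = propag t a - propag t b := by
  ext ξ
  simp [propag, mul_sub]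

lemma propag_add (t : ℝ) (a b : E3 → ℂ) : propag t (a + b) = propag t a + propag t b := by
  ext ξ
  simp [propag, mul_add]

lemma reflProfile_sub (a b : E3 → ℂ) : reflProfile (a - b) = reflProfile a - reflProfile b := by
  ext ξ
  simp [reflProfile]

lemma reflProfile_add (a b : E3 → ℂ) : reflProfile (a + b) = reflProfile a + reflProfile b := by
  ext ξ
  simp [reflProfile]

lemma eLpNorm_reflProfile {a : E3 → ℂ} (ha : AEStronglyMeasurable a coneMeasure) (p : ℝ≥0∞) :
    eLpNorm (reflProfile a) p coneMeasure = eLpNorm a p coneMeasure := by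
  refine Eq.trans (eLpNorm_congr_norm_ae (.of_forall fun ξ => ?_))
    (eLpNorm_comp_measurePreserving ha measurePreserving_neg_coneMeasure)
  simp [reflProfile]

lemma aestronglyMeasurable_reflProfile {a : E3 → ℂ} (ha : AEStronglyMeasurable a coneMeasure) :
    AEStronglyMeasurable (reflProfile a) coneMeasure :=
  Complex.continuous_conj.comp_aestronglyMeasurable
    (ha.comp_measurePreserving measurePreserving_neg_coneMeasure)

lemma memLp_reflProfile {a : E3 → ℂ} {p : ℝ≥0∞} (ha : MemLp a p coneMeasure) :
    MemLp (reflProfile a) p coneMeasure :=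
  ⟨aestronglyMeasurable_reflProfile ha.1, (eLpNorm_reflProfile ha.1 p).trans_lt ha.2⟩

lemma eLpNorm_propag (t : ℝ) (a : E3 → ℂ) (p : ℝ≥0∞) :
    eLpNorm (propag t a) p coneMeasure = eLpNorm a p coneMeasure :=
  eLpNorm_congr_norm_ae (.of_forall fun ξ => by simp [propag, norm_coneChar])

lemma memLp_propag {a : E3 → ℂ} {p : ℝ≥0∞} (t : ℝ) (ha : MemLp a p coneMeasure) :
    MemLp (propag t a) p coneMeasure :=
  ⟨(measurable_coneChar _).aestronglyMeasurable.mul ha.1, (eLpNorm_propag t a p).trans_lt ha.2⟩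

lemma integrable_mul_fourierInv {b : E3 → ℂ} (hb : MemLp b 2 coneMeasure) (φ : 𝓢(E3, ℂ)) :
    Integrable (fun ξ => b ξ * 𝓕⁻ φ ξ) coneMeasure :=
  integrable_mul_of_memLp 2 2 hb ((𝓕⁻ φ).memLp 2 coneMeasure)

lemma wavePair_sub {a b : E3 → ℂ} (ha : MemLp a 2 coneMeasure) (hb : MemLp b 2 coneMeasure)
    (φ : 𝓢(E3, ℂ)) : wavePair (a - b) φ = wavePair a φ - wavePair b φ := by
  refine Eq.trans ?_ (integral_sub (integrable_mul_fourierInv (ha.add (memLp_reflProfile ha)) φ)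
    (integrable_mul_fourierInv (hb.add (memLp_reflProfile hb)) φ))
  rw [wavePair, reflProfile_sub]
  refine integral_congr_ae (.of_forall fun ξ => ?_)
  simp only [Pi.sub_apply]
  ring

lemma wavePair_add {a b : E3 → ℂ} (ha : MemLp a 2 coneMeasure) (hb : MemLp b 2 coneMeasure)
    (φ : 𝓢(E3, ℂ)) : wavePair (a + b) φ = wavePair a φ + wavePair b φ := by
  refine Eq.trans ?_ (integral_add (integrable_mul_fourierInv (ha.add (memLp_reflProfile ha)) φ)
    (integrable_mul_fourierInv (hb.add (memLp_reflProfile hb)) φ))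
  rw [wavePair, reflProfile_add]
  refine integral_congr_ae (.of_forall fun ξ => ?_)
  simp only [Pi.add_apply]
  ring

lemma enorm_wavePair_le {a : E3 → ℂ} (ha : MemLp a 2 coneMeasure) (φ : 𝓢(E3, ℂ)) :
    ‖wavePair a φ‖ₑ ≤ 2 * eLpNorm a 2 coneMeasure * eLpNorm (fun ξ => 𝓕⁻ φ ξ) 2 coneMeasure := by
  have h := enorm_integral_mul_le 2 2 (ha.add (memLp_reflProfile ha)).1
    (g := fun ξ => 𝓕⁻ φ ξ) ((𝓕⁻ φ).memLp 2 coneMeasure).1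
  refine h.trans (mul_le_mul_left ?_ _)
  refine (eLpNorm_add_le ha.1 (memLp_reflProfile ha).1 (by norm_num)).trans_eq ?_
  rw [eLpNorm_reflProfile ha.1, two_mul]

/-- The distribution with a given profile depends continuously on it. -/
lemma tendsto_wavePair {ι : Type*} {l : Filter ι} {a : ι → E3 → ℂ} {b : E3 → ℂ}
    (ha : ∀ i, MemLp (a i) 2 coneMeasure) (hb : MemLp b 2 coneMeasure)
    (h : Tendsto (fun i => eLpNorm (a i - b) 2 coneMeasure) l (𝓝 0)) (φ : 𝓢(E3, ℂ)) :
    Tendsto (fun i => wavePair (a i) φ) l (𝓝 (wavePair b φ)) := by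
  rw [tendsto_iff_edist_tendsto_0]
  have hK : eLpNorm (fun ξ => 𝓕⁻ φ ξ) 2 coneMeasure ≠ ∞ := ((𝓕⁻ φ).memLp 2 coneMeasure).2.ne
  have h1 : Tendsto (fun i => 2 * eLpNorm (a i - b) 2 coneMeasure *
      eLpNorm (fun ξ => 𝓕⁻ φ ξ) 2 coneMeasure) l (𝓝 0) := by
    have := ENNReal.Tendsto.mul_const (ENNReal.Tendsto.const_mul (a := 2) h (.inr (by simp)))
      (.inr hK)
    simpa using this
  refine tendsto_of_tendsto_of_tendsto_of_le_of_le tendsto_const_nhds h1 (fun i => zero_le)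
    fun i => ?_
  simp only [edist_eq_enorm_sub]
  rw [← wavePair_sub (ha i) hb]
  exact enorm_wavePair_le ((ha i).sub hb) φ

/-! ### Representation of the free evolution -/

lemma halfWave_sub {a b : E3 → ℂ} (ha : Integrable a coneMeasure) (hb : Integrable b coneMeasure) :
    halfWave (a - b) = halfWave a - halfWave b := by
  ext z
  rw [Pi.sub_apply, halfWave, halfWave, halfWave, ← integral_sub (integrable_coneChar_mul ha z)
    (integrable_coneChar_mul hb z)]
  refine integral_congr_ae (.of_forall fun ξ => ?_)
  simp [mul_sub]

lemma freeSol_sub {a b : E3 → ℂ} (ha : Integrable a coneMeasure) (hb : Integrable b coneMeasure) :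
    freeSol (a - b) = freeSol a - freeSol b := by
  ext z
  simp only [freeSol, halfWave_sub ha hb, Pi.sub_apply, Complex.sub_re]
  ring

lemma continuous_freeSol {a : E3 → ℂ} (ha : Integrable a coneMeasure) : Continuous (freeSol a) := by
  have := continuous_halfWave ha
  unfold freeSol
  fun_prop

lemma halfWave_add_left (a : E3 → ℂ) (z w : ℝ × E3) :
    halfWave a (z + w) = halfWave (fun ξ => coneChar w ξ * a ξ) z := by
  simp only [halfWave, coneChar_add, mul_assoc]

lemma halfWave_time (a : E3 → ℂ) (t : ℝ) (x : E3) :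
    halfWave a (t, x) = halfWave (propag t a) (0, x) := by
  have h : ((t, x) : ℝ × E3) = (0, x) + (t, 0) := by simp
  rw [h, halfWave_add_left]
  rfl

lemma conj_halfWave (a : E3 → ℂ) (t : ℝ) (x : E3) :
    (starRingEnd ℂ) (halfWave a (t, x)) = halfWave (reflProfile a) (-t, x) := by
  rw [halfWave, halfWave, ← integral_conj, ← measurePreserving_neg_coneMeasure.integral_comp
    (MeasurableEquiv.neg E3).measurableEmbedding]
  refine integral_congr_ae (.of_forall fun ξ => ?_)
  simp only [map_mul, conj_coneChar, reflProfile]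
  congr 1
  simp [coneChar, spacetimeInner]

/-- The first alternative splits an integral into two and needs both parts to be integrable. The
second alternative records the case in which this fails. -/
lemma ofReal_freeSol (a : E3 → ℂ) (t : ℝ) (x : E3) :
    (freeSol a (t, x) : ℂ) = halfWave (fun ξ => propag t a ξ + reflProfile (propag t a) ξ) (0, x) ∨
      ¬ Integrable a coneMeasure := by
  by_cases ha : Integrable a coneMeasure
  · left
    have h1 := memLp_propag t (memLp_one_iff_integrable.2 ha)
    have h2 := memLp_reflProfile h1
    have h3 : halfWave (fun ξ => propag t a ξ + reflProfile (propag t a) ξ) (0, x) =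
        halfWave (propag t a) (0, x) + halfWave (reflProfile (propag t a)) (0, x) := by
      rw [halfWave, halfWave, halfWave, ← integral_add
        (integrable_coneChar_mul (memLp_one_iff_integrable.1 h1) _)
        (integrable_coneChar_mul (memLp_one_iff_integrable.1 h2) _)]
      simp only [mul_add]
    have h4 := conj_halfWave (propag t a) 0 x
    rw [neg_zero] at h4
    rw [h3, ← h4, Complex.add_conj, freeSol, halfWave_time]
  · exact .inr ha

lemma integral_halfWave_mul {c : E3 → ℂ} (hc : Integrable c coneMeasure) (φ : 𝓢(E3, ℂ)) :
    ∫ x, halfWave c (0, x) * φ x = ∫ ξ, c ξ * 𝓕⁻ φ ξ ∂coneMeasure := by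
  have hint : Integrable (fun q : E3 × E3 => coneChar (0, q.1) q.2 * (φ q.1 * c q.2))
      (volume.prod coneMeasure) :=
    (φ.integrable.mul_prod hc).bdd_mul (c := 1)
      (Continuous.aestronglyMeasurable (by fun_prop))
      (.of_forall fun q => (norm_coneChar (0, q.1) q.2).le)
  calc ∫ x, halfWave c (0, x) * φ x
      = ∫ x, (∫ ξ, coneChar (0, x) ξ * (φ x * c ξ) ∂coneMeasure) := by
        refine integral_congr_ae (.of_forall fun x => ?_)
        simp only [halfWave]
        rw [← integral_mul_const]
        refine integral_congr_ae (.of_forall fun ξ => ?_)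
        simp only
        ring
    _ = ∫ ξ, (∫ x, coneChar (0, x) ξ * (φ x * c ξ)) ∂coneMeasure := integral_integral_swap hint
    _ = _ := by
        refine integral_congr_ae (.of_forall fun ξ => ?_)
        simp only
        rw [SchwartzMap.fourierInv_coe, Real.fourierInv_eq', ← integral_const_mul]
        refine integral_congr_ae (.of_forall fun x => ?_)
        simp only [coneChar, spacetimeInner, smul_eq_mul]
        push_cast
        ring_nf

lemma enorm_freeSol_le (a : E3 → ℂ) (z : ℝ × E3) : ‖freeSol a z‖ ≤ 2 * ‖halfWave a z‖ := by
  rw [freeSol, norm_mul, Real.norm_ofNat]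
  gcongr
  exact Complex.abs_re_le_norm _

lemma eLpNorm_freeSol_le {a : E3 → ℂ} (ha : Integrable a coneMeasure)
    (ha2 : MemLp a 2 coneMeasure) :
    eLpNorm (freeSol a) 4 volume ≤
      ENNReal.ofReal (2 * strichartzConst) * eLpNorm a 2 coneMeasure := by
  refine (eLpNorm_le_mul_eLpNorm_of_ae_le_mul (.of_forall (enorm_freeSol_le a)) 4).trans ?_
  rw [ENNReal.ofReal_mul zero_le_two, mul_assoc]
  gcongr
  exact eLpNorm_halfWave_le ha ha2

lemma represents_freeSol {a : E3 → ℂ} (ha : Integrable a coneMeasure)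
    (ha2 : MemLp a 2 coneMeasure) :
    Represents (freeSol a) (fun t φ => wavePair (propag t a) φ) := by
  refine ⟨⟨(continuous_freeSol ha).aestronglyMeasurable, (eLpNorm_freeSol_le ha ha2).trans_lt
    (ENNReal.mul_lt_top ENNReal.ofReal_lt_top ha2.2)⟩, .of_forall fun t φ => ?_⟩
  have h1 := memLp_propag t (memLp_one_iff_integrable.2 ha)
  have h3 := memLp_one_iff_integrable.1 (h1.add (memLp_reflProfile h1))
  refine Eq.trans ?_ (integral_halfWave_mul h3 φ)
  refine integral_congr_ae (.of_forall fun x => ?_)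
  simp only
  rw [(ofReal_freeSol a t x).resolve_right (not_not.2 ha)]
  rfl

/-- A profile in `L²` is the limit of integrable ones, along which the solutions converge
in `L⁴`. -/
lemma exists_seq_freeSol {a : E3 → ℂ} (ha : MemLp a 2 coneMeasure) :
    ∃ (b : ℕ → E3 → ℂ) (v : ℝ × E3 → ℝ), (∀ n, Integrable (b n) coneMeasure) ∧
      (∀ n, MemLp (b n) 2 coneMeasure) ∧
      Tendsto (fun n => eLpNorm (b n - a) 2 coneMeasure) atTop (𝓝 0) ∧ MemLp v 4 volume ∧
      Tendsto (fun n => eLpNorm (freeSol (b n) - v) 4 volume) atTop (𝓝 0) := by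
  have h1 : ∀ n : ℕ, ∃ g : E3 → ℂ, (Integrable g coneMeasure ∧ MemLp g 2 coneMeasure) ∧
      eLpNorm (g - a) 2 coneMeasure ≤ ENNReal.ofReal (1 / (n + 1)) := fun n => by
    -- The approximations are smooth with compact support, hence Schwartz functions, which lie in
    -- both `L¹` and `L²` of the cone. For integrable profiles the half wave is an absolutely
    -- convergent integral.
    obtain ⟨g, hg1, hg2, hg3⟩ := MemLp.exist_eLpNorm_sub_le (by norm_num) (by norm_num) ha
      (ε := 1 / (n + 1)) (by positivity)
    refine ⟨g, ⟨(hg1.toSchwartzMap hg2).integrable, (hg1.toSchwartzMap hg2).memLp 2 _⟩, ?_⟩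
    rwa [← neg_sub, eLpNorm_neg]
  choose b hb hba using h1
  have h2 : Tendsto (fun n => eLpNorm (b n - a) 2 coneMeasure) atTop (𝓝 0) := by
    refine tendsto_of_tendsto_of_tendsto_of_le_of_le tendsto_const_nhds ?_ (fun i => zero_le) hba
    have := (ENNReal.continuous_ofReal.tendsto 0).comp
      (tendsto_one_div_add_atTop_nhds_zero_nat (𝕜 := ℝ))
    simpa [Function.comp_def] using this
  have hm : ∀ n, MemLp (freeSol (b n)) 4 volume :=
    fun n => (represents_freeSol (hb n).1 (hb n).2).1
  let S : ℕ → Lp ℝ 4 (volume : Measure (ℝ × E3)) := fun n => (hm n).toLp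
  -- By linearity and the Strichartz estimate, the solutions are Cauchy in `L⁴` because their
  -- profiles are Cauchy in `L²`.
  have hS : CauchySeq S := by
    rw [EMetric.cauchySeq_iff]
    intro ε hε
    set C := ENNReal.ofReal (2 * strichartzConst) + 1 with hC
    have hCt : C ≠ ∞ := ENNReal.add_ne_top.2 ⟨ENNReal.ofReal_ne_top, ENNReal.one_ne_top⟩
    have hε' : 0 < ε / C / 2 :=
      ENNReal.div_pos (ENNReal.div_pos hε.ne' hCt).ne' (by simp)
    obtain ⟨N, hN⟩ := eventually_atTop.1 (h2.eventually_lt_const hε')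
    refine ⟨N, fun m hm' n hn => ?_⟩
    simp only [S]
    rw [Lp.edist_toLp_toLp, ← freeSol_sub (hb m).1 (hb n).1]
    refine (eLpNorm_freeSol_le ((hb m).1.sub (hb n).1) ((hb m).2.sub (hb n).2)).trans_lt ?_
    have h3 : eLpNorm (b m - b n) 2 coneMeasure < ε / C := by
      have h4 : b m - b n = (b m - a) - (b n - a) := by abel
      rw [h4, ← ENNReal.add_halves (ε / C)]
      exact (eLpNorm_sub_le ((hb m).2.sub ha).1 ((hb n).2.sub ha).1 (by norm_num)).trans_lt
        (ENNReal.add_lt_add (hN m hm') (hN n hn))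
    calc _ ≤ C * eLpNorm (b m - b n) 2 coneMeasure := by
          gcongr
          exact le_self_add
      _ < ε := by
        rw [mul_comm]
        exact (ENNReal.lt_div_iff_mul_lt (.inl (by simp [hC])) (.inl hCt)).1 h3
  obtain ⟨V, hV⟩ := cauchySeq_tendsto_of_complete hS
  refine ⟨b, V, fun n => (hb n).1, fun n => (hb n).2, h2, Lp.memLp V, ?_⟩
  rw [Lp.tendsto_Lp_iff_tendsto_eLpNorm'] at hV
  refine hV.congr fun n => eLpNorm_congr_ae ?_
  filter_upwards [(hm n).coeFn_toLp] with z hz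
  simp only [Pi.sub_apply, S, hz]

lemma tendsto_eLpNorm_propag_sub {ι : Type*} {l : Filter ι} {a : ι → E3 → ℂ} {b : E3 → ℂ} (t : ℝ)
    (h : Tendsto (fun i => eLpNorm (a i - b) 2 coneMeasure) l (𝓝 0)) :
    Tendsto (fun i => eLpNorm (propag t (a i) - propag t b) 2 coneMeasure) l (𝓝 0) := by
  simpa only [← propag_sub, eLpNorm_propag] using h

/-- Every free evolution of finite energy is a function in `L⁴`. -/
lemma exists_represents_wavePair {a : E3 → ℂ} (ha : MemLp a 2 coneMeasure) :
    ∃ v, Represents v (fun t φ => wavePair (propag t a) φ) := by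
  obtain ⟨b, v, hb, hb2, hba, hv, hbv⟩ := exists_seq_freeSol ha
  exact ⟨v, represents_of_tendsto (fun n => represents_freeSol (hb n) (hb2 n)) hv hbv fun t φ =>
    tendsto_wavePair (fun n => memLp_propag t (hb2 n)) (memLp_propag t ha)
      (tendsto_eLpNorm_propag_sub t hba) φ⟩

/-! ### Fourier densities -/

lemma hasTemperateGrowth_one_add_norm_sq :
    Function.HasTemperateGrowth (fun ξ : E3 => (1 + ‖ξ‖ ^ 2 : ℂ)) := by
  have h := Function.hasTemperateGrowth_norm_sq E3
  have h1 := Function.Complex.hasTemperateGrowth_ofReal.comp h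
  have h2 : (fun ξ : E3 => (1 + ‖ξ‖ ^ 2 : ℂ)) =
      (fun _ => (1 : ℂ)) + (fun x : ℝ => (x : ℂ)) ∘ fun ξ : E3 => ‖ξ‖ ^ 2 := by
    ext ξ
    simp
  rw [h2]
  exact (Function.HasTemperateGrowth.const (1 : ℂ)).add h1

/-- The Schwartz function `(1 + |ξ|²) ψ(ξ)`. -/
noncomputable def weightSchwartz (ψ : 𝓢(E3, ℂ)) : 𝓢(E3, ℂ) :=
  SchwartzMap.smulLeftCLM ℂ (fun ξ : E3 => (1 + ‖ξ‖ ^ 2 : ℂ)) ψ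

lemma weightSchwartz_apply (ψ : 𝓢(E3, ℂ)) (ξ : E3) :
    weightSchwartz ψ ξ = (1 + ‖ξ‖ ^ 2) * ψ ξ := by
  rw [weightSchwartz, SchwartzMap.smulLeftCLM_apply_apply hasTemperateGrowth_one_add_norm_sq,
    smul_eq_mul]

lemma one_add_norm_sq_ne_zero (ξ : E3) : (1 + ‖ξ‖ ^ 2 : ℂ) ≠ 0 := by
  have : (1 + ‖ξ‖ ^ 2 : ℝ) ≠ 0 := by positivity
  exact_mod_cast this

lemma norm_mul_eq_weightSchwartz (ψ : 𝓢(E3, ℂ)) (ξ : E3) :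
    (‖ξ‖ : ℂ) * ψ ξ = (‖ξ‖ / (1 + ‖ξ‖ ^ 2) : ℂ) * weightSchwartz ψ ξ := by
  rw [weightSchwartz_apply]
  field_simp [one_add_norm_sq_ne_zero ξ]

lemma norm_div_one_add_norm_sq_le (ξ : E3) : ‖(‖ξ‖ / (1 + ‖ξ‖ ^ 2) : ℂ)‖ ≤ 1 := by
  have h : (‖ξ‖ / (1 + ‖ξ‖ ^ 2) : ℂ) = ((‖ξ‖ / (1 + ‖ξ‖ ^ 2) : ℝ) : ℂ) := by push_cast; rfl
  rw [h, Complex.norm_real, Real.norm_of_nonneg (by positivity), div_le_one (by positivity)]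
  nlinarith [sq_nonneg (‖ξ‖ - 1)]

lemma memLp_norm_mul_schwartz (ψ : 𝓢(E3, ℂ)) :
    MemLp (fun ξ => (‖ξ‖ : ℂ) * ψ ξ) 2 coneMeasure := by
  refine ((weightSchwartz ψ).memLp 2 coneMeasure).mono
    (Continuous.aestronglyMeasurable (by fun_prop)) (.of_forall fun ξ => ?_)
  rw [norm_mul_eq_weightSchwartz, norm_mul]
  exact mul_le_of_le_one_left (norm_nonneg _) (norm_div_one_add_norm_sq_le ξ)

lemma norm_mul_inv_ae : ∀ᵐ ξ : E3, (‖ξ‖ : ℂ) ≠ 0 := by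
  have h : ∀ᵐ ξ : E3, ξ ≠ 0 := by simp [ae_iff]
  filter_upwards [h] with ξ hξ
  simpa using hξ

lemma exists_fourierDensity_inv_norm {b : E3 → ℂ} (hb : MemLp b 2 coneMeasure) :
    ∃ T : 𝓢'(E3, ℂ), IsFourierDensity T (fun ξ => (‖ξ‖ : ℂ)⁻¹ * b ξ) := by
  refine ⟨𝓕⁻ (Lp.toTemperedDistribution hb.toLp), fun φ => ⟨?_, ?_⟩⟩
  · have h := integrable_mul_of_memLp 2 2 hb (φ.memLp 2 coneMeasure)
    rw [integrable_coneMeasure] at h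
    refine h.congr (.of_forall fun ξ => ?_)
    simp [mul_assoc]
  · rw [FourierTransform.fourier_fourierInv_eq, Lp.toTemperedDistribution_apply,
      integral_coneMeasure]
    refine integral_congr_ae ?_
    have h := hb.coeFn_toLp
    rw [EventuallyEq, ae_coneMeasure] at h
    filter_upwards [h] with ξ hξ
    rw [hξ]
    simp
    ring

/-- Relative to `dξ/|ξ|` the density of `b dξ` is `|ξ| b`, which need not be square integrable. The
bounded factor `|ξ|/(1 + |ξ|²)` puts it in `L²` of the cone, and the polynomial `1 + |ξ|²` is
restored by multiplying the distribution. -/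
lemma exists_fourierDensity {b : E3 → ℂ} (hb : MemLp b 2 coneMeasure) :
    ∃ T : 𝓢'(E3, ℂ), IsFourierDensity T b := by
  have hc : MemLp (fun ξ => (‖ξ‖ / (1 + ‖ξ‖ ^ 2) : ℂ) * b ξ) 2 coneMeasure := by
    refine hb.mono (Measurable.aestronglyMeasurable (by fun_prop) |>.mul hb.1)
      (.of_forall fun ξ => ?_)
    rw [norm_mul]
    exact mul_le_of_le_one_left (norm_nonneg _) (norm_div_one_add_norm_sq_le ξ)
  refine ⟨𝓕⁻ (TemperedDistribution.smulLeftCLM ℂ (fun ξ : E3 => (1 + ‖ξ‖ ^ 2 : ℂ))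
    (Lp.toTemperedDistribution hc.toLp)), fun φ => ⟨?_, ?_⟩⟩
  · have h := integrable_mul_of_memLp 2 2 hb (memLp_norm_mul_schwartz φ)
    rw [integrable_coneMeasure] at h
    refine h.congr ?_
    filter_upwards [norm_mul_inv_ae] with ξ hξ
    simp only [Complex.real_smul, Complex.ofReal_inv]
    field_simp
  · rw [FourierTransform.fourier_fourierInv_eq, TemperedDistribution.smulLeftCLM_apply_apply,
      Lp.toTemperedDistribution_apply, integral_coneMeasure]
    refine integral_congr_ae ?_
    have h := hc.coeFn_toLp
    rw [EventuallyEq, ae_coneMeasure] at h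
    filter_upwards [h, norm_mul_inv_ae] with ξ hξ hξ0
    rw [hξ]
    change _ • (weightSchwartz φ ξ) • _ = _
    rw [weightSchwartz_apply]
    simp only [Complex.real_smul, Complex.ofReal_inv, smul_eq_mul]
    field_simp [one_add_norm_sq_ne_zero ξ]

/-- A Schwartz cutoff function. -/
lemma exists_schwartz_bump {R : ℝ} (hR : 0 < R) :
    ∃ χ : 𝓢(E3, ℂ), HasCompactSupport χ ∧ (∀ x, ∃ r : ℝ, 0 ≤ r ∧ r ≤ 1 ∧ χ x = r) ∧
      ∀ x, ‖x‖ ≤ R → χ x = 1 := by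
  let f : ContDiffBump (0 : E3) := ⟨R, R + 1, hR, by linarith⟩
  have hc : HasCompactSupport fun x => (f x : ℂ) :=
    f.hasCompactSupport.comp_left (g := fun x : ℝ => (x : ℂ)) rfl
  refine ⟨hc.toSchwartzMap (Complex.ofRealCLM.contDiff.comp f.contDiff), hc,
    fun x => ⟨f x, f.nonneg, f.le_one, rfl⟩, fun x hx => ?_⟩
  have h1 : f x = 1 := f.one_of_mem_closedBall (by simpa using hx)
  change ((f x : ℝ) : ℂ) = 1
  rw [h1, Complex.ofReal_one]

lemma locallyIntegrable_of_forall_schwartz {g : E3 → ℂ}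
    (h : ∀ φ : 𝓢(E3, ℂ), HasCompactSupport φ → Integrable fun x => g x * φ x) :
    LocallyIntegrable g := by
  rw [locallyIntegrable_iff]
  intro K hK
  obtain ⟨R, hR⟩ := hK.isBounded.subset_closedBall 0
  obtain ⟨χ, hχ, -, hχ1⟩ := exists_schwartz_bump (R := max R 1) (by positivity)
  refine IntegrableOn.mono_set ?_ hR
  refine (h χ hχ).integrableOn.congr_fun (fun x hx => ?_) Metric.isClosed_closedBall.measurableSet
  simp only
  rw [hχ1 x ((mem_closedBall_zero_iff.1 hx).trans (le_max_left _ _)), mul_one]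

lemma IsFourierDensity.locallyIntegrable {T : 𝓢'(E3, ℂ)} {g : E3 → ℂ}
    (h : IsFourierDensity T g) : LocallyIntegrable g :=
  locallyIntegrable_of_forall_schwartz fun φ _ => (h φ).1

lemma IsFourierDensity.ae_eq {T : 𝓢'(E3, ℂ)} {g g' : E3 → ℂ} (h : IsFourierDensity T g)
    (h' : IsFourierDensity T g') : ∀ᵐ ξ, g ξ = g' ξ :=
  ae_eq_of_forall_schwartz h.locallyIntegrable h'.locallyIntegrable fun φ _ => by
    simp_rw [mul_comm (φ _)]
    rw [← (h φ).2, ← (h' φ).2]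

lemma IsFourierDensity.congr_ae {T : 𝓢'(E3, ℂ)} {g g' : E3 → ℂ} (h : IsFourierDensity T g)
    (hg : ∀ᵐ ξ, g ξ = g' ξ) : IsFourierDensity T g' := fun φ => by
  have h1 : (fun ξ => g ξ * φ ξ) =ᵐ[volume] fun ξ => g' ξ * φ ξ := by
    filter_upwards [hg] with ξ hξ
    rw [hξ]
  exact ⟨(h φ).1.congr h1, (h φ).2.trans (integral_congr_ae h1)⟩

lemma IsFourierDensity.sub {T T' : 𝓢'(E3, ℂ)} {g g' : E3 → ℂ} (h : IsFourierDensity T g)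
    (h' : IsFourierDensity T' g') : IsFourierDensity (T - T') (g - g') := fun φ => by
  have h1 := (h φ).1.sub (h' φ).1
  refine ⟨h1.congr (.of_forall fun ξ => ?_), ?_⟩
  · simp [sub_mul]
  · have h2 := integral_sub (h φ).1 (h' φ).1
    rw [← (h φ).2, ← (h' φ).2] at h2
    refine Eq.trans ?_ (h2.symm.trans (integral_congr_ae (.of_forall fun ξ => ?_)))
    · rw [TemperedDistribution.fourier_apply, TemperedDistribution.fourier_apply,
        TemperedDistribution.fourier_apply]
      rfl
    · simp [sub_mul]

lemma IsFourierDensity.apply {T : 𝓢'(E3, ℂ)} {g : E3 → ℂ} (h : IsFourierDensity T g)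
    (φ : 𝓢(E3, ℂ)) : T φ = ∫ ξ, g ξ * 𝓕⁻ φ ξ := by
  rw [← (h (𝓕⁻ φ)).2, TemperedDistribution.fourier_apply, FourierTransform.fourier_fourierInv_eq]

/-- All Fourier densities of a distribution agree almost everywhere, so the infimum in `eHdotNorm`
runs over equal values. -/
lemma eHdotNorm_eq {T : 𝓢'(E3, ℂ)} {g : E3 → ℂ} (h : IsFourierDensity T g) (s : ℝ) :
    eHdotNorm s T = eLpNorm (fun ξ : E3 => ((2 * Real.pi * ‖ξ‖) ^ s : ℝ) • g ξ) 2 volume := by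
  refine le_antisymm (iInf₂_le g h) (le_iInf₂ fun g' hg' => ?_)
  refine (eLpNorm_congr_ae ?_).le
  filter_upwards [h.ae_eq hg'] with ξ hξ
  rw [hξ]

lemma exists_fourierDensity_of_eHdotNorm_lt_top {T : 𝓢'(E3, ℂ)} {s : ℝ}
    (h : eHdotNorm s T < ∞) : ∃ g, IsFourierDensity T g := by
  simp only [eHdotNorm, iInf_lt_top] at h
  obtain ⟨g, hg, -⟩ := h
  exact ⟨g, hg⟩

/-! ### Profiles of phase space points -/

/-- The pair `f` has the profile `a`. -/
def HasProfile (f : 𝓢'(E3, ℂ) × 𝓢'(E3, ℂ)) (a : E3 → ℂ) : Prop :=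
  MemLp a 2 coneMeasure ∧
    IsFourierDensity f.1 (fun ξ => (‖ξ‖ : ℂ)⁻¹ * (a ξ + reflProfile a ξ)) ∧
    IsFourierDensity f.2 (fun ξ => 2 * Real.pi * Complex.I * (a ξ - reflProfile a ξ))

lemma exists_hasProfile {a : E3 → ℂ} (ha : MemLp a 2 coneMeasure) : ∃ f, HasProfile f a := by
  obtain ⟨T, hT⟩ := exists_fourierDensity_inv_norm (ha.add (memLp_reflProfile ha))
  obtain ⟨T', hT'⟩ := exists_fourierDensity
    ((ha.sub (memLp_reflProfile ha)).const_mul (2 * Real.pi * Complex.I))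
  exact ⟨(T, T'), ha, hT, hT'⟩

lemma HasProfile.fst_apply {f : 𝓢'(E3, ℂ) × 𝓢'(E3, ℂ)} {a : E3 → ℂ} (h : HasProfile f a)
    (φ : 𝓢(E3, ℂ)) : f.1 φ = wavePair a φ := by
  rw [h.2.1.apply, wavePair, integral_coneMeasure]
  refine integral_congr_ae (.of_forall fun ξ => ?_)
  simp [mul_assoc]

lemma HasProfile.snd_apply {f : 𝓢'(E3, ℂ) × 𝓢'(E3, ℂ)} {a : E3 → ℂ} (h : HasProfile f a)
    (φ : 𝓢(E3, ℂ)) : f.2 φ = velPair a φ := by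
  rw [h.2.2.apply, velPair, integral_coneMeasure]
  refine integral_congr_ae ?_
  filter_upwards [norm_mul_inv_ae] with ξ hξ
  simp only [Complex.real_smul, Complex.ofReal_inv]
  field_simp

lemma HasProfile.sub {f g : 𝓢'(E3, ℂ) × 𝓢'(E3, ℂ)} {a b : E3 → ℂ} (hf : HasProfile f a)
    (hg : HasProfile g b) : HasProfile (f - g) (a - b) := by
  refine ⟨hf.1.sub hg.1, (hf.2.1.sub hg.2.1).congr_ae (.of_forall fun ξ => ?_),
    (hf.2.2.sub hg.2.2).congr_ae (.of_forall fun ξ => ?_)⟩ <;>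
  · simp only [Pi.sub_apply, reflProfile_sub]
    ring

lemma eLpNorm_two_rpow {α : Type*} [MeasurableSpace α] {μ : Measure α} {f : α → ℂ} :
    eLpNorm f 2 μ = (∫⁻ x, ‖f x‖ₑ ^ (2 : ℝ) ∂μ) ^ (1 / 2 : ℝ) := by
  rw [lintegral_enorm_sq, ← ENNReal.rpow_natCast, ← ENNReal.rpow_mul]
  simp

lemma enorm_rpow_smul_sq (s : ℝ) (ξ : E3) (c : ℂ) :
    ‖((2 * Real.pi * ‖ξ‖) ^ s : ℝ) • c‖ₑ ^ (2 : ℝ) =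
      ENNReal.ofReal ((2 * Real.pi * ‖ξ‖) ^ (2 * s)) * ‖c‖ₑ ^ (2 : ℝ) := by
  have h : (0 : ℝ) ≤ 2 * Real.pi * ‖ξ‖ := by positivity
  rw [enorm_smul, ENNReal.mul_rpow_of_nonneg _ _ zero_le_two, Real.enorm_of_nonneg (by positivity),
    ENNReal.ofReal_rpow_of_nonneg (by positivity) zero_le_two, ← Real.rpow_mul h, mul_comm s]

lemma HasProfile.eHdotNorm_fst_sq {f : 𝓢'(E3, ℂ) × 𝓢'(E3, ℂ)} {a : E3 → ℂ}
    (h : HasProfile f a) : eHdotNorm (1 / 2) f.1 ^ 2 = ENNReal.ofReal (2 * Real.pi) *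
      ∫⁻ ξ, ‖a ξ + reflProfile a ξ‖ₑ ^ (2 : ℝ) ∂coneMeasure := by
  rw [eHdotNorm_eq h.2.1, ← lintegral_enorm_sq, lintegral_coneMeasure,
    ← lintegral_const_mul' _ _ ENNReal.ofReal_ne_top]
  refine lintegral_congr fun ξ => ?_
  rw [enorm_rpow_smul_sq, ← ofReal_norm, norm_mul, ENNReal.ofReal_rpow_of_nonneg (by positivity)
    zero_le_two, ← ofReal_norm, ENNReal.ofReal_rpow_of_nonneg (by positivity) zero_le_two,
    ← ENNReal.ofReal_mul (by positivity), ← ENNReal.ofReal_mul (by positivity),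
    ← ENNReal.ofReal_mul (by positivity)]
  congr 1
  rw [Real.rpow_two, Real.rpow_two, norm_inv, Complex.norm_real, norm_norm]
  norm_num
  rcases eq_or_ne ‖ξ‖ 0 with h0 | h0
  · simp [h0]
  · field_simp

lemma HasProfile.eHdotNorm_snd_sq {f : 𝓢'(E3, ℂ) × 𝓢'(E3, ℂ)} {a : E3 → ℂ}
    (h : HasProfile f a) : eHdotNorm (-1 / 2) f.2 ^ 2 = ENNReal.ofReal (2 * Real.pi) *
      ∫⁻ ξ, ‖a ξ - reflProfile a ξ‖ₑ ^ (2 : ℝ) ∂coneMeasure := by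
  rw [eHdotNorm_eq h.2.2, ← lintegral_enorm_sq, lintegral_coneMeasure,
    ← lintegral_const_mul' _ _ ENNReal.ofReal_ne_top]
  refine lintegral_congr fun ξ => ?_
  rw [enorm_rpow_smul_sq, ← ofReal_norm, norm_mul, ENNReal.ofReal_rpow_of_nonneg (by positivity)
    zero_le_two, ← ofReal_norm, ENNReal.ofReal_rpow_of_nonneg (by positivity) zero_le_two,
    ← ENNReal.ofReal_mul (by positivity), ← ENNReal.ofReal_mul (by positivity),
    ← ENNReal.ofReal_mul (by positivity)]
  congr 1
  have h1 : ‖(2 * Real.pi * Complex.I : ℂ)‖ = 2 * Real.pi := by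
    simp [abs_of_pos Real.pi_pos]
  have h2 : (2 : ℝ) * (-1 / 2) = -1 := by norm_num
  rw [Real.rpow_two, Real.rpow_two, h1, h2, Real.rpow_neg_one, mul_inv]
  have := Real.pi_pos
  field_simp

/-- The two squared norms are `2π` times the squared `L²` norms on the cone of `a + ã` and `a - ã`,
where `ã` is the reflected conjugate of `a`. The parallelogram law and `‖ã‖ = ‖a‖` give `2π ·
4‖a‖²`. -/
lemma HasProfile.ePhaseNorm_eq {f : 𝓢'(E3, ℂ) × 𝓢'(E3, ℂ)} {a : E3 → ℂ} (h : HasProfile f a) :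
    ePhaseNorm f = ENNReal.ofReal √(8 * Real.pi) * eLpNorm a 2 coneMeasure := by
  have hm := h.1.1.enorm.pow_const (2 : ℝ)
  have hm' := (memLp_reflProfile h.1).1.enorm.pow_const (2 : ℝ)
  have h1 : ∫⁻ ξ, ‖a ξ + reflProfile a ξ‖ₑ ^ (2 : ℝ) ∂coneMeasure +
      ∫⁻ ξ, ‖a ξ - reflProfile a ξ‖ₑ ^ (2 : ℝ) ∂coneMeasure =
      4 * eLpNorm a 2 coneMeasure ^ 2 := by
    have h0 : AEMeasurable (fun ξ => ‖a ξ + reflProfile a ξ‖ₑ ^ (2 : ℝ)) coneMeasure :=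
      (h.1.add (memLp_reflProfile h.1)).1.enorm.pow_const _
    rw [← lintegral_add_left' h0]
    have h2 : ∀ ξ, ‖a ξ + reflProfile a ξ‖ₑ ^ (2 : ℝ) + ‖a ξ - reflProfile a ξ‖ₑ ^ (2 : ℝ) =
        2 * ‖a ξ‖ₑ ^ (2 : ℝ) + 2 * ‖reflProfile a ξ‖ₑ ^ (2 : ℝ) := fun ξ => by
      simp only [← ofReal_norm, ENNReal.ofReal_rpow_of_nonneg (norm_nonneg _) zero_le_two,
        Real.rpow_two]
      have h3 := parallelogram_law_with_norm ℝ (a ξ) (reflProfile a ξ)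
      rw [← ENNReal.ofReal_add (by positivity) (by positivity),
        show (2 : ℝ≥0∞) = ENNReal.ofReal 2 by simp, ← ENNReal.ofReal_mul (by positivity),
        ← ENNReal.ofReal_mul (by positivity), ← ENNReal.ofReal_add (by positivity) (by positivity)]
      congr 1
      linarith
    simp_rw [h2]
    rw [lintegral_add_left' (hm.const_mul 2), lintegral_const_mul' _ _ (by simp),
      lintegral_const_mul' _ _ (by simp), lintegral_enorm_sq, lintegral_enorm_sq,
      eLpNorm_reflProfile h.1.1]
    ring
  rw [ePhaseNorm, h.eHdotNorm_fst_sq, h.eHdotNorm_snd_sq, ← mul_add, h1, ← mul_assoc,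
    ENNReal.mul_rpow_of_nonneg _ _ (by norm_num), ← ENNReal.rpow_natCast (eLpNorm a 2 coneMeasure),
    ← ENNReal.rpow_mul, show (4 : ℝ≥0∞) = ENNReal.ofReal 4 by simp,
    ← ENNReal.ofReal_mul (by positivity),
    ENNReal.ofReal_rpow_of_nonneg (by positivity) (by norm_num), ← Real.sqrt_eq_rpow]
  have h2 : 2 * Real.pi * 4 = 8 * Real.pi := by ring
  rw [h2]
  norm_num

/-! ### Reality -/

lemma conj_fourierInv_of_real {φ : 𝓢(E3, ℂ)} (hφ : ∀ x, (φ x).im = 0) (ξ : E3) :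
    (starRingEnd ℂ) (𝓕⁻ φ ξ) = 𝓕⁻ φ (-ξ) := by
  rw [SchwartzMap.fourierInv_coe, Real.fourierInv_eq', Real.fourierInv_eq', ← integral_conj]
  refine integral_congr_ae (.of_forall fun x => ?_)
  simp only [smul_eq_mul, map_mul, Complex.conj_eq_iff_im.2 (hφ x), ← Complex.exp_conj,
    Complex.conj_I, Complex.conj_ofReal, inner_neg_right]
  congr 2
  push_cast
  ring

lemma conj_fourier_of_real {φ : 𝓢(E3, ℂ)} (hφ : ∀ x, (φ x).im = 0) (ξ : E3) :
    (starRingEnd ℂ) (𝓕 φ ξ) = 𝓕 φ (-ξ) := by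
  rw [SchwartzMap.fourier_coe, Real.fourier_eq', Real.fourier_eq', ← integral_conj]
  refine integral_congr_ae (.of_forall fun x => ?_)
  simp only [smul_eq_mul, map_mul, Complex.conj_eq_iff_im.2 (hφ x), ← Complex.exp_conj,
    Complex.conj_I, Complex.conj_ofReal, inner_neg_right]
  congr 2
  push_cast
  ring

lemma im_integral_hermitian_mul {c : E3 → ℂ} (hc : reflProfile c = c) {φ : 𝓢(E3, ℂ)}
    (hφ : ∀ x, (φ x).im = 0) : (∫ ξ, c ξ * 𝓕⁻ φ ξ ∂coneMeasure).im = 0 := by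
  rw [← Complex.conj_eq_iff_im, ← integral_conj, ← measurePreserving_neg_coneMeasure.integral_comp
    (MeasurableEquiv.neg E3).measurableEmbedding]
  refine integral_congr_ae (.of_forall fun ξ => ?_)
  have h := congrFun hc ξ
  simp only [reflProfile] at h
  simp only [map_mul, h]
  rw [conj_fourierInv_of_real hφ, neg_neg]

lemma HasProfile.memPhaseSpace {f : 𝓢'(E3, ℂ) × 𝓢'(E3, ℂ)} {a : E3 → ℂ} (h : HasProfile f a) :
    MemPhaseSpace f := by
  refine ⟨?_, fun φ hφ => ?_, fun φ hφ => ?_⟩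
  · rw [h.ePhaseNorm_eq]
    exact ENNReal.mul_lt_top ENNReal.ofReal_lt_top h.1.2
  · rw [h.fst_apply]
    refine im_integral_hermitian_mul (c := fun ξ => a ξ + reflProfile a ξ) ?_ hφ
    ext ξ
    simp [reflProfile, add_comm]
  · rw [h.snd_apply]
    refine im_integral_hermitian_mul
      (c := fun ξ => 2 * Real.pi * Complex.I * ‖ξ‖ * (a ξ - reflProfile a ξ)) ?_ hφ
    ext ξ
    simp [reflProfile, map_ofNat (starRingEnd ℂ) 2]
    ring

lemma im_apply_of_conj_eq_neg {T : 𝓢'(E3, ℂ)} (hT : IsRealDistribution T) {φ : 𝓢(E3, ℂ)}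
    (hφ : ∀ x, (starRingEnd ℂ) (φ x) = -φ x) : (T φ).re = 0 := by
  have h := hT (Complex.I • φ) fun x => by
    rw [smul_apply, smul_eq_mul, ← Complex.conj_eq_iff_im, map_mul, hφ, Complex.conj_I]
    ring
  rw [map_smul, smul_eq_mul] at h
  simpa using h

lemma LocallyIntegrable.reflProfile {g : E3 → ℂ} (hg : LocallyIntegrable g) :
    LocallyIntegrable (reflProfile g) := by
  rw [locallyIntegrable_iff]
  intro K hK
  have h1 : IntegrableOn g (Neg.neg ⁻¹' K) :=
    hg.integrableOn_isCompact ((Homeomorph.neg E3).isCompact_preimage.2 hK)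
  have h2 := (Measure.measurePreserving_neg (volume : Measure E3)).integrableOn_comp_preimage
    (MeasurableEquiv.neg E3).measurableEmbedding (f := g) (s := Neg.neg ⁻¹' K)
  rw [← Set.preimage_comp, neg_comp_neg, Set.preimage_id] at h2
  exact memLp_one_iff_integrable.1 (memLp_one_iff_integrable.2 (h2.2 h1)).star

/-- The Fourier density of a real distribution is Hermitian. -/
lemma IsFourierDensity.hermitian {T : 𝓢'(E3, ℂ)} {g : E3 → ℂ} (h : IsFourierDensity T g)
    (hT : IsRealDistribution T) : ∀ᵐ ξ, reflProfile g ξ = g ξ := by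
  refine ae_eq_of_integral_contDiff_smul_eq (LocallyIntegrable.reflProfile h.locallyIntegrable)
    h.locallyIntegrable fun χ hχ hχc => ?_
  have hc : HasCompactSupport fun w => (χ w : ℂ) := hχc.comp_left (g := fun x : ℝ => (x : ℂ)) rfl
  have hc' : HasCompactSupport fun w => (χ (-w) : ℂ) := hc.comp_homeomorph (Homeomorph.neg E3)
  have hs := Complex.ofRealCLM.contDiff.comp hχ
  set S : 𝓢(E3, ℂ) := hc.toSchwartzMap hs with hS
  set S' : 𝓢(E3, ℂ) := hc'.toSchwartzMap (hs.comp contDiff_neg) with hS'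
  have hSa : ∀ x, S x = χ x := fun _ => rfl
  have hSa' : ∀ x, S' x = χ (-x) := fun _ => rfl
  have hF : ∀ ξ, 𝓕 S' ξ = 𝓕 S (-ξ) := fun ξ => by
    rw [SchwartzMap.fourier_coe, SchwartzMap.fourier_coe, Real.fourier_eq', Real.fourier_eq',
      ← integral_neg_eq_self]
    refine integral_congr_ae (.of_forall fun x => ?_)
    simp [hSa, hSa']
  have hc1 : ∀ ξ, (starRingEnd ℂ) (𝓕 S ξ) = 𝓕 S (-ξ) :=
    conj_fourier_of_real fun x => by rw [hSa]; simp
  -- The test function `S` is real and `S'` is its reflection, so `𝓕 S'` is the conjugate of `𝓕 S`.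
  -- Their sum is real and their difference imaginary; reality of `T` on both shows that `T (𝓕 S')`
  -- is the conjugate of `T (𝓕 S)`.
  have hadd : (T (𝓕 S) + T (𝓕 S')).im = 0 := by
    rw [← map_add]
    refine hT _ fun ξ => ?_
    rw [← Complex.conj_eq_iff_im]
    simp only [add_apply, map_add, hF, hc1, neg_neg]
    ring
  have hsub : (T (𝓕 S) - T (𝓕 S')).re = 0 := by
    rw [← map_sub]
    refine im_apply_of_conj_eq_neg hT fun ξ => ?_
    simp only [sub_apply, map_sub, hF, hc1, neg_neg]
    ring
  have hA : T (𝓕 S) = ∫ ξ, χ ξ • g ξ := by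
    rw [← TemperedDistribution.fourier_apply, (h S).2]
    refine integral_congr_ae (.of_forall fun x => ?_)
    simp [hSa, mul_comm]
  have hA' : T (𝓕 S') = ∫ ξ, χ (-ξ) • g ξ := by
    rw [← TemperedDistribution.fourier_apply, (h S').2]
    refine integral_congr_ae (.of_forall fun x => ?_)
    simp [hSa', mul_comm]
  have h1 : ∫ ξ, χ ξ • reflProfile g ξ = (starRingEnd ℂ) (T (𝓕 S')) := by
    rw [hA', ← integral_conj, ← integral_neg_eq_self]
    refine integral_congr_ae (.of_forall fun x => ?_)
    simp [reflProfile]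
  rw [h1, ← hA]
  rw [Complex.add_im] at hadd
  rw [Complex.sub_re] at hsub
  refine Complex.ext ?_ ?_
  · rw [Complex.conj_re]
    linarith
  · rw [Complex.conj_im]
    linarith

/-- Every point of the phase space has a profile. -/
lemma MemPhaseSpace.exists_hasProfile {f : 𝓢'(E3, ℂ) × 𝓢'(E3, ℂ)} (hf : MemPhaseSpace f) :
    ∃ a, HasProfile f a := by
  obtain ⟨hn, hr0, hr1⟩ := hf
  have hlt : eHdotNorm (1 / 2) f.1 ^ 2 + eHdotNorm (-1 / 2) f.2 ^ 2 < ∞ := by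
    rw [ePhaseNorm] at hn
    exact (ENNReal.rpow_lt_top_iff_of_pos (by norm_num)).1 hn
  rw [ENNReal.add_lt_top] at hlt
  have hlt0 : eHdotNorm (1 / 2) f.1 < ∞ := by
    have := hlt.1
    rw [ENNReal.pow_lt_top_iff] at this
    simpa using this
  have hlt1 : eHdotNorm (-1 / 2) f.2 < ∞ := by
    have := hlt.2
    rw [ENNReal.pow_lt_top_iff] at this
    simpa using this
  obtain ⟨g0, hg0⟩ := exists_fourierDensity_of_eHdotNorm_lt_top hlt0
  obtain ⟨g1, hg1⟩ := exists_fourierDensity_of_eHdotNorm_lt_top hlt1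
  rw [eHdotNorm_eq hg0] at hlt0
  rw [eHdotNorm_eq hg1] at hlt1
  have hpi := Real.pi_pos
  have hm0 : MemLp (fun ξ => (‖ξ‖ : ℂ) * g0 ξ) 2 coneMeasure := by
    refine ⟨aestronglyMeasurable_coneMeasure.2 (Measurable.aestronglyMeasurable (by fun_prop) |>.mul
      hg0.locallyIntegrable.aestronglyMeasurable), ?_⟩
    rw [eLpNorm_two_rpow] at hlt0 ⊢
    rw [ENNReal.rpow_lt_top_iff_of_pos (by norm_num)] at hlt0 ⊢
    rw [lintegral_coneMeasure]
    refine lt_of_eq_of_lt ?_ (ENNReal.mul_lt_top (ENNReal.ofReal_lt_top (r := (2 * Real.pi)⁻¹)) hlt0)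
    rw [← lintegral_const_mul' _ _ ENNReal.ofReal_ne_top]
    refine lintegral_congr fun ξ => ?_
    rw [enorm_rpow_smul_sq, enorm_mul, ENNReal.mul_rpow_of_nonneg _ _ zero_le_two, ← mul_assoc,
      ← mul_assoc, ← ENNReal.ofReal_mul (by positivity)]
    congr 1
    rw [← ofReal_norm, ENNReal.ofReal_rpow_of_nonneg (by positivity) zero_le_two,
      ← ENNReal.ofReal_mul (by positivity), Complex.norm_real, norm_norm, Real.rpow_two]
    congr 1
    norm_num
    rcases eq_or_ne ‖ξ‖ 0 with h0 | h0
    · simp [h0]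
    · field_simp
  have hm1 : MemLp g1 2 coneMeasure := by
    refine ⟨aestronglyMeasurable_coneMeasure.2 hg1.locallyIntegrable.aestronglyMeasurable, ?_⟩
    rw [eLpNorm_two_rpow] at hlt1 ⊢
    rw [ENNReal.rpow_lt_top_iff_of_pos (by norm_num)] at hlt1 ⊢
    rw [lintegral_coneMeasure]
    refine lt_of_eq_of_lt ?_ (ENNReal.mul_lt_top (ENNReal.ofReal_lt_top (r := 2 * Real.pi)) hlt1)
    rw [← lintegral_const_mul' _ _ ENNReal.ofReal_ne_top]
    refine lintegral_congr fun ξ => ?_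
    rw [enorm_rpow_smul_sq, ← mul_assoc, ← ENNReal.ofReal_mul (by positivity)]
    congr 2
    rw [show (2 : ℝ) * (-1 / 2) = -1 by norm_num, Real.rpow_neg_one, mul_inv]
    field_simp
  -- The profile solves the system `|ξ| g0 = a + ã`, `g1 = 2πi (a - ã)`, where `ã` is the reflected
  -- conjugate of `a`. The solution is consistent because `g0` and `g1` are Hermitian.
  set a : E3 → ℂ := fun ξ => (1 / 2 : ℂ) * ((‖ξ‖ : ℂ) * g0 ξ) +
    (1 / (4 * Real.pi * Complex.I)) * g1 ξ with ha
  have h0 := hg0.hermitian hr0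
  have h1 := hg1.hermitian hr1
  have hpiC : (Real.pi : ℂ) ≠ 0 := by exact_mod_cast hpi.ne'
  have hrefl : ∀ ξ, reflProfile a ξ = (1 / 2 : ℂ) * ((‖ξ‖ : ℂ) * reflProfile g0 ξ) -
      (1 / (4 * Real.pi * Complex.I)) * reflProfile g1 ξ := fun ξ => by
    simp only [ha, reflProfile, map_add, map_mul, map_div₀, map_one, Complex.conj_ofReal,
      Complex.conj_I, map_ofNat, norm_neg]
    field_simp
    ring
  refine ⟨a, (hm0.const_mul _).add (hm1.const_mul _), hg0.congr_ae ?_, hg1.congr_ae ?_⟩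
  · filter_upwards [h0, h1, norm_mul_inv_ae] with ξ h0 h1 hξ
    rw [hrefl, h0, h1, ha]
    field_simp
    ring
  · filter_upwards [h0, h1, norm_mul_inv_ae] with ξ h0 h1 hξ
    rw [hrefl, h0, h1, ha]
    field_simp
    ring

/-! ### The free evolution of a profile -/

lemma coneChar_time (t : ℝ) (ξ : E3) :
    coneChar (t, 0) ξ = cosSymbol t ξ + Complex.I * (2 * Real.pi * ‖ξ‖) * sinSymbol t ξ := by
  have h1 : ((2 * Real.pi * ‖ξ‖) * (t * Real.sinc (2 * Real.pi * t * ‖ξ‖)) : ℝ) =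
      Real.sin (2 * Real.pi * t * ‖ξ‖) := by
    rcases eq_or_ne (2 * Real.pi * t * ‖ξ‖) 0 with h | h
    · rw [h, Real.sin_zero, Real.sinc_zero]
      linarith
    · rw [Real.sinc_of_ne_zero h]
      have h3 : 2 * Real.pi * ‖ξ‖ * (t * (Real.sin (2 * Real.pi * t * ‖ξ‖) /
          (2 * Real.pi * t * ‖ξ‖))) = (2 * Real.pi * t * ‖ξ‖) *
          (Real.sin (2 * Real.pi * t * ‖ξ‖) / (2 * Real.pi * t * ‖ξ‖)) := by ring
      rw [h3, mul_div_cancel₀ _ h]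
  have h2 : Complex.I * (2 * Real.pi * ‖ξ‖) * sinSymbol t ξ =
      Complex.I * (Real.sin (2 * Real.pi * t * ‖ξ‖) : ℝ) := by
    rw [← h1, sinSymbol]
    push_cast
    ring
  rw [h2, coneChar, cosSymbol, Complex.ofReal_cos, Complex.ofReal_sin, mul_comm Complex.I,
    ← Complex.exp_mul_I]
  congr 1
  simp only [spacetimeInner, inner_zero_left]
  push_cast
  ring

lemma reflProfile_propag (t : ℝ) (a : E3 → ℂ) (ξ : E3) :
    reflProfile (propag t a) ξ = coneChar (-t, 0) ξ * reflProfile a ξ := by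
  rw [reflProfile, propag, map_mul, conj_coneChar, reflProfile]
  have h : -((t, 0) : ℝ × E3) = (-t, 0) := by simp
  rw [h, coneChar_zero_right_neg]

lemma cosSymbol_neg (t : ℝ) (ξ : E3) : cosSymbol (-t) ξ = cosSymbol t ξ := by
  simp [cosSymbol]

lemma sinSymbol_neg (t : ℝ) (ξ : E3) : sinSymbol (-t) ξ = -sinSymbol t ξ := by
  simp [sinSymbol]

/-- In terms of `a` and its reflected conjugate the evolution is diagonal: they are multiplied by
`exp(±2πit|ξ|)`, and Euler's formula `coneChar_time` recovers the cosine and sine multipliers. -/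
lemma HasProfile.freeWave_apply {f : 𝓢'(E3, ℂ) × 𝓢'(E3, ℂ)} {a : E3 → ℂ} (h : HasProfile f a)
    (t : ℝ) (φ : 𝓢(E3, ℂ)) : freeWave f t φ = wavePair (propag t a) φ := by
  have h0 : freeWave f t φ =
      TemperedDistribution.fourierMultiplierCLM ℂ (cosSymbol t) f.1 φ +
        TemperedDistribution.fourierMultiplierCLM ℂ (sinSymbol t) f.2 φ := rfl
  rw [h0, TemperedDistribution.fourierMultiplierCLM_apply_apply,
    TemperedDistribution.fourierMultiplierCLM_apply_apply, ← TemperedDistribution.fourier_apply,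
    ← TemperedDistribution.fourier_apply, (h.2.1 _).2, (h.2.2 _).2,
    ← integral_add (h.2.1 _).1 (h.2.2 _).1, wavePair, integral_coneMeasure]
  refine integral_congr_ae ?_
  filter_upwards [norm_mul_inv_ae] with ξ hξ
  simp only [SchwartzMap.smulLeftCLM_apply_apply (hasTemperateGrowth_cosSymbol t),
    SchwartzMap.smulLeftCLM_apply_apply (hasTemperateGrowth_sinSymbol t), reflProfile_propag,
    propag, coneChar_time, cosSymbol_neg, sinSymbol_neg, Complex.real_smul, Complex.ofReal_inv,
    smul_eq_mul]
  field_simp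
  ring

lemma hasDerivAt_coneChar_time (t : ℝ) (ξ : E3) :
    HasDerivAt (fun s : ℝ => coneChar (s, 0) ξ)
      ((2 * Real.pi * Complex.I * ‖ξ‖) * coneChar (t, 0) ξ) t := by
  have h1 : ∀ s : ℝ, coneChar (s, 0) ξ = Complex.exp ((2 * Real.pi * Complex.I * ‖ξ‖) * s) :=
    fun s => by
      simp only [coneChar, spacetimeInner, inner_zero_left]
      congr 1
      push_cast
      ring
  simp_rw [h1]
  have h2 : HasDerivAt (fun s : ℝ => (2 * Real.pi * Complex.I * ‖ξ‖) * (s : ℂ))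
      (2 * Real.pi * Complex.I * ‖ξ‖) t := by
    simpa using (Complex.ofRealCLM.hasDerivAt (x := t)).const_mul (2 * Real.pi * Complex.I * ‖ξ‖)
  simpa [mul_comm] using h2.cexp

/-- The time derivative costs a factor `2π|ξ|`, which is absorbed by the test function: `|ξ| 𝓕⁻ φ`
is still in `L²` of the cone, so dominated differentiation applies. -/
lemma hasDerivAt_wavePair_propag {a : E3 → ℂ} (ha : MemLp a 2 coneMeasure) (t : ℝ)
    (φ : 𝓢(E3, ℂ)) :
    HasDerivAt (fun s => wavePair (propag s a) φ) (velPair (propag t a) φ) t := by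
  have hm := memLp_reflProfile ha
  have hb : Integrable (fun ξ => 2 * Real.pi * ((‖a ξ‖ + ‖reflProfile a ξ‖) * (‖ξ‖ * ‖𝓕⁻ φ ξ‖)))
      coneMeasure := by
    have h1 := ((integrable_mul_of_memLp 2 2 ha (memLp_norm_mul_schwartz (𝓕⁻ φ))).norm.add
      (integrable_mul_of_memLp 2 2 hm (memLp_norm_mul_schwartz (𝓕⁻ φ))).norm).const_mul
        (2 * Real.pi)
    refine h1.congr (.of_forall fun ξ => ?_)
    simp
    ring
  refine (hasDerivAt_integral_of_dominated_loc_of_deriv_le (μ := coneMeasure)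
    (F := fun s ξ => (propag s a ξ + reflProfile (propag s a) ξ) * 𝓕⁻ φ ξ)
    (F' := fun s ξ => (2 * Real.pi * Complex.I * ‖ξ‖) * (propag s a ξ - reflProfile (propag s a) ξ)
      * 𝓕⁻ φ ξ) univ_mem (.of_forall fun s => ?_) ?_ ?_ ?_ hb ?_).2
  · exact (integrable_mul_fourierInv ((memLp_propag s ha).add
      (memLp_reflProfile (memLp_propag s ha))) φ).aestronglyMeasurable
  · exact integrable_mul_fourierInv ((memLp_propag t ha).add
      (memLp_reflProfile (memLp_propag t ha))) φ
  · have h1 := (memLp_propag t ha).sub (memLp_reflProfile (memLp_propag t ha))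
    exact ((Measurable.aestronglyMeasurable (by fun_prop)).mul h1.1).mul
      (𝓕⁻ φ).continuous.aestronglyMeasurable
  · refine .of_forall fun ξ s _ => ?_
    simp only [norm_mul, Complex.norm_real, Complex.norm_I, norm_norm, Complex.norm_ofNat, mul_one,
      Real.norm_of_nonneg Real.pi_pos.le]
    have h2 : ‖propag s a ξ - reflProfile (propag s a) ξ‖ ≤ ‖a ξ‖ + ‖reflProfile a ξ‖ := by
      refine (norm_sub_le _ _).trans_eq ?_
      rw [reflProfile_propag, propag, norm_mul, norm_mul, norm_coneChar, norm_coneChar, one_mul,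
        one_mul]
    have h3 : 0 ≤ 2 * Real.pi * (‖ξ‖ * ‖𝓕⁻ φ ξ‖) := by positivity
    nlinarith [mul_le_mul_of_nonneg_left h2 h3]
  · refine .of_forall fun ξ s _ => ?_
    simp only [reflProfile_propag, propag]
    have h1 := hasDerivAt_coneChar_time s ξ
    have h2 := (hasDerivAt_coneChar_time (-s) ξ).scomp s (hasDerivAt_neg s)
    have h3 := ((h1.mul_const (a ξ)).add (h2.mul_const (reflProfile a ξ))).mul_const (𝓕⁻ φ ξ)
    refine h3.congr_deriv ?_
    rw [neg_one_smul]
    ring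

lemma tendsto_eLpNorm_propag {a : E3 → ℂ} (ha : MemLp a 2 coneMeasure) (t : ℝ) :
    Tendsto (fun s => eLpNorm (propag s a - propag t a) 2 coneMeasure) (𝓝 t) (𝓝 0) := by
  have h1 : Tendsto (fun s => ∫⁻ ξ, ‖(propag s a - propag t a) ξ‖ₑ ^ (2 : ℝ) ∂coneMeasure) (𝓝 t)
      (𝓝 (∫⁻ _, 0 ∂coneMeasure)) := by
    refine tendsto_of_seq_tendsto fun s hs => ?_
    refine tendsto_lintegral_of_dominated_convergence'
      (fun ξ => (2 * ‖a ξ‖ₑ) ^ (2 : ℝ)) (fun n => ?_) (fun n => ?_) ?_ ?_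
    · exact ((memLp_propag _ ha).sub (memLp_propag t ha)).1.enorm.pow_const _
    · refine .of_forall fun ξ => ENNReal.rpow_le_rpow ?_ zero_le_two
      have h0 : ∀ r, ‖propag r a ξ‖ₑ = ‖a ξ‖ₑ := fun r => by
        rw [propag, enorm_mul, ← ofReal_norm (coneChar _ _), norm_coneChar]
        simp
      refine (enorm_sub_le).trans_eq ?_
      rw [h0, h0, two_mul]
    · simp_rw [ENNReal.mul_rpow_of_nonneg _ _ (zero_le_two (α := ℝ))]
      rw [lintegral_const_mul' _ _ (by simp), lintegral_enorm_sq]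
      exact ENNReal.mul_ne_top (by simp) (ENNReal.pow_ne_top ha.2.ne)
    · refine .of_forall fun ξ => ?_
      have h2 : Continuous fun s : ℝ => ‖(propag s a - propag t a) ξ‖ₑ ^ (2 : ℝ) := by
        simp only [propag, Pi.sub_apply]
        fun_prop
      have h3 := (h2.tendsto t).comp hs
      simpa [Function.comp_def] using h3
  have h4 := h1.ennrpow_const (1 / 2)
  simp_rw [← eLpNorm_two_rpow] at h4
  simpa using h4

/-! ### The adjoint of the half wave operator -/

/-- `g` is the image of `F` under the adjoint of the half wave operator. -/
def IsDualProfile (F : ℝ × E3 → ℝ) (g : E3 → ℂ) : Prop :=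
  MemLp g 2 coneMeasure ∧ ∀ c, Integrable c coneMeasure → MemLp c 2 coneMeasure →
    ∫ z, (F z : ℂ) * halfWave c z = ∫ ξ, (starRingEnd ℂ) (g ξ) * c ξ ∂coneMeasure

lemma memLp_halfWave {c : E3 → ℂ} (hc : Integrable c coneMeasure) (hc2 : MemLp c 2 coneMeasure) :
    MemLp (halfWave c) 4 volume :=
  ⟨(continuous_halfWave hc).aestronglyMeasurable, (eLpNorm_halfWave_le hc hc2).trans_lt
    (ENNReal.mul_lt_top ENNReal.ofReal_lt_top hc2.2)⟩

lemma integrable_mul_halfWave {F : ℝ × E3 → ℝ} (hF : MemLp F (4 / 3) volume) {c : E3 → ℂ}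
    (hc : Integrable c coneMeasure) (hc2 : MemLp c 2 coneMeasure) :
    Integrable (fun z => (F z : ℂ) * halfWave c z) :=
  integrable_mul_of_memLp (4 / 3) 4 hF.ofReal (memLp_halfWave hc hc2)

lemma enorm_integral_mul_halfWave_le {F : ℝ × E3 → ℝ} (hF : MemLp F (4 / 3) volume) {c : E3 → ℂ}
    (hc : Integrable c coneMeasure) (hc2 : MemLp c 2 coneMeasure) :
    ‖∫ z, (F z : ℂ) * halfWave c z‖ₑ ≤ eLpNorm F (4 / 3) volume *
      (ENNReal.ofReal strichartzConst * eLpNorm c 2 coneMeasure) := by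
  have h1 : ‖∫ z, (F z : ℂ) * halfWave c z‖ₑ ≤
      eLpNorm (fun z => (F z : ℂ)) (4 / 3) volume * eLpNorm (halfWave c) 4 volume :=
    enorm_integral_mul_le (4 / 3) 4 hF.ofReal.1 (memLp_halfWave hc hc2).1
  rw [eLpNorm_ofReal_complex] at h1
  exact h1.trans (mul_le_mul_right (eLpNorm_halfWave_le hc hc2) _)

lemma integrable_and_memLp_schwartz (φ : 𝓢(E3, ℂ)) :
    Integrable φ coneMeasure ∧ MemLp φ 2 coneMeasure := ⟨φ.integrable, φ.memLp 2 _⟩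

lemma strichartzConst_nonneg : 0 ≤ strichartzConst := Real.sqrt_nonneg _

lemma memLp_conj {g : E3 → ℂ} (hg : MemLp g 2 coneMeasure) :
    MemLp (fun ξ => (starRingEnd ℂ) (g ξ)) 2 coneMeasure := hg.star

lemma eLpNorm_conj (g : E3 → ℂ) :
    eLpNorm (fun ξ => (starRingEnd ℂ) (g ξ)) 2 coneMeasure = eLpNorm g 2 coneMeasure :=
  eLpNorm_congr_norm_ae (.of_forall fun _ => RCLike.norm_conj _)

/-- By Hölder and Strichartz, `c ↦ ∫ F · halfWave c` is bounded in the `L²` norm on the cone, with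
constant `strichartzConst * ‖F‖_{4/3}`. The Riesz theorem provides the adjoint together with this
bound. -/
lemma exists_isDualProfile {F : ℝ × E3 → ℝ} (hF : MemLp F (4 / 3) volume) :
    ∃ g, IsDualProfile F g ∧ eLpNorm g 2 coneMeasure ≤
      ENNReal.ofReal strichartzConst * eLpNorm F (4 / 3) volume := by
  let f : 𝓢(E3, ℂ) →ₗ[ℂ] ℂ :=
    { toFun := fun φ => ∫ z, (F z : ℂ) * halfWave φ z
      map_add' := fun φ ψ => by
        obtain ⟨h1, h2⟩ := integrable_and_memLp_schwartz φ
        obtain ⟨h3, h4⟩ := integrable_and_memLp_schwartz ψ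
        rw [← integral_add (integrable_mul_halfWave hF h1 h2) (integrable_mul_halfWave hF h3 h4)]
        refine integral_congr_ae (.of_forall fun z => ?_)
        simp only [halfWave, add_apply, mul_add]
        rw [integral_add (integrable_coneChar_mul h1 z) (integrable_coneChar_mul h3 z), mul_add]
      map_smul' := fun a φ => by
        rw [RingHom.id_apply, smul_eq_mul, ← integral_const_mul]
        refine integral_congr_ae (.of_forall fun z => ?_)
        simp only [halfWave, smul_apply, smul_eq_mul]
        rw [← mul_assoc, mul_comm a, mul_assoc, ← integral_const_mul a]
        simp_rw [mul_left_comm a] }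
  set N := (eLpNorm F (4 / 3) volume).toReal with hN
  have hN' : eLpNorm F (4 / 3) volume = ENNReal.ofReal N := (ENNReal.ofReal_toReal hF.2.ne).symm
  have hs := strichartzConst_nonneg
  obtain ⟨g, hg1, hg2⟩ := exists_Lp_two_of_forall_schwartz (μ := coneMeasure) f
    (K := strichartzConst * N) (by positivity) fun φ => by
      obtain ⟨h1, h2⟩ := integrable_and_memLp_schwartz φ
      have h3 := enorm_integral_mul_halfWave_le hF h1 h2
      rw [hN', ← ENNReal.ofReal_toReal h2.2.ne, ← SchwartzMap.norm_toLp,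
        ← ENNReal.ofReal_mul (by positivity), ← ENNReal.ofReal_mul (by positivity), ← ofReal_norm,
        ENNReal.ofReal_le_ofReal_iff (by positivity)] at h3
      refine h3.trans_eq ?_
      ring
  have hgn : eLpNorm g 2 coneMeasure ≤ ENNReal.ofReal strichartzConst *
      eLpNorm F (4 / 3) volume := by
    rw [← ENNReal.ofReal_toReal (Lp.eLpNorm_ne_top g), ← Lp.norm_def, hN',
      ← ENNReal.ofReal_mul (by positivity)]
    exact ENNReal.ofReal_le_ofReal hg1
  refine ⟨g, ⟨Lp.memLp g, fun c hc hc2 => ?_⟩, hgn⟩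
  set K := ENNReal.ofReal strichartzConst * eLpNorm F (4 / 3) volume with hK
  have hKt : K ≠ ∞ := ENNReal.mul_ne_top ENNReal.ofReal_ne_top hF.2.ne
  rw [← sub_eq_zero, ← enorm_eq_zero]
  refine le_antisymm (ENNReal.le_of_forall_pos_le_add fun ε hε _ => ?_) zero_le
  rw [zero_add]
  -- The identity is known for Schwartz functions. Approximation of `c` in `L²` alone suffices,
  -- since each side changes by at most `K` times the `L²` error; the tolerance makes the two errors
  -- add up to at most `ε`.
  obtain ⟨φ, hφ1, hφ2, hφ3⟩ := MemLp.exist_eLpNorm_sub_le (by norm_num) (by norm_num) hc2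
    (ε := ((ε : ℝ≥0∞) / (2 * (K + 1))).toReal)
    (ENNReal.toReal_pos (ENNReal.div_pos (by simpa using hε.ne') (by finiteness)).ne'
      (ENNReal.div_ne_top (by simp) (by simp)))
  rw [ENNReal.ofReal_toReal (ENNReal.div_ne_top (by simp) (by simp))] at hφ3
  obtain ⟨h1, h2⟩ := integrable_and_memLp_schwartz (hφ1.toSchwartzMap hφ2)
  have h3 : ∫ z, (F z : ℂ) * halfWave φ z = ∫ ξ, φ ξ * (starRingEnd ℂ) (g ξ) ∂coneMeasure :=
    hg2 (hφ1.toSchwartzMap hφ2)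
  replace h1 : Integrable φ coneMeasure := h1
  replace h2 : MemLp φ 2 coneMeasure := h2
  clear_value f
  have h4 : (∫ z, (F z : ℂ) * halfWave c z) - ∫ ξ, (starRingEnd ℂ) (g ξ) * c ξ ∂coneMeasure =
      (∫ z, (F z : ℂ) * halfWave (c - φ) z) -
        ∫ ξ, (starRingEnd ℂ) (g ξ) * (c - φ) ξ ∂coneMeasure := by
    have h5 : ∫ z, (F z : ℂ) * halfWave (c - φ) z =
        (∫ z, (F z : ℂ) * halfWave c z) - ∫ z, (F z : ℂ) * halfWave φ z := by
      rw [← integral_sub (integrable_mul_halfWave hF hc hc2) (integrable_mul_halfWave hF h1 h2),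
        halfWave_sub hc h1]
      simp only [Pi.sub_apply, mul_sub]
    have hgm := memLp_conj (Lp.memLp g)
    have h6 : ∫ ξ, (starRingEnd ℂ) (g ξ) * (c - φ) ξ ∂coneMeasure =
        (∫ ξ, (starRingEnd ℂ) (g ξ) * c ξ ∂coneMeasure) -
          ∫ ξ, (starRingEnd ℂ) (g ξ) * φ ξ ∂coneMeasure := by
      rw [← integral_sub (integrable_mul_of_memLp 2 2 hgm hc2)
        (integrable_mul_of_memLp 2 2 hgm h2)]
      simp only [Pi.sub_apply, mul_sub]
    have h7 : ∫ z, (F z : ℂ) * halfWave φ z =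
        ∫ ξ, (starRingEnd ℂ) (g ξ) * φ ξ ∂coneMeasure := by
      refine h3.trans ?_
      simp_rw [mul_comm]
    rw [h5, h6, h7]
    ring
  rw [h4]
  refine enorm_sub_le.trans ?_
  have h8 := enorm_integral_mul_halfWave_le hF (hc.sub h1) (hc2.sub h2)
  have h9 : ‖∫ ξ, (starRingEnd ℂ) (g ξ) * (c - φ) ξ ∂coneMeasure‖ₑ ≤
      eLpNorm (fun ξ => (starRingEnd ℂ) (g ξ)) 2 coneMeasure * eLpNorm (c - φ) 2 coneMeasure :=
    enorm_integral_mul_le 2 2 (memLp_conj (Lp.memLp g)).1 (hc2.sub h2).1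
  rw [eLpNorm_conj] at h9
  calc _ ≤ K * (ε / (2 * (K + 1))) + K * (ε / (2 * (K + 1))) := by
        refine add_le_add (h8.trans ?_) (h9.trans ?_)
        · rw [← mul_assoc, mul_comm (eLpNorm F _ _)]
          gcongr
        · gcongr
    _ ≤ (2 * (K + 1)) * (ε / (2 * (K + 1))) := by
        rw [← two_mul, ← mul_assoc]
        gcongr
        exact le_self_add
    _ = ε := ENNReal.mul_div_cancel (by simp) (by finiteness)

/-- A function in `L²` of the cone is determined by its integrals against Schwartz functions. -/
lemma ae_eq_of_forall_coneMeasure {b b' : E3 → ℂ} (hb : MemLp b 2 coneMeasure)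
    (hb' : MemLp b' 2 coneMeasure)
    (h : ∀ φ : 𝓢(E3, ℂ), ∫ ξ, b ξ * φ ξ ∂coneMeasure = ∫ ξ, b' ξ * φ ξ ∂coneMeasure) :
    b =ᵐ[coneMeasure] b' := by
  obtain ⟨T, hT⟩ := exists_fourierDensity_inv_norm hb
  obtain ⟨T', hT'⟩ := exists_fourierDensity_inv_norm hb'
  have h1 := ae_eq_of_forall_schwartz hT.locallyIntegrable hT'.locallyIntegrable fun φ _ => by
    have := h φ
    rw [integral_coneMeasure, integral_coneMeasure] at this
    convert this using 4 <;> simp <;> ring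
  rw [EventuallyEq, ae_coneMeasure]
  filter_upwards [h1, norm_mul_inv_ae] with ξ hξ h0
  exact mul_left_cancel₀ (inv_ne_zero h0) hξ

lemma IsDualProfile.sub {F F' : ℝ × E3 → ℝ} {g g' : E3 → ℂ} (h : IsDualProfile F g)
    (h' : IsDualProfile F' g') (hF : MemLp F (4 / 3) volume) (hF' : MemLp F' (4 / 3) volume) :
    IsDualProfile (F - F') (g - g') := by
  refine ⟨h.1.sub h'.1, fun c hc hc2 => ?_⟩
  have h1 := integral_sub (integrable_mul_halfWave hF hc hc2) (integrable_mul_halfWave hF' hc hc2)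
  have h2 := integral_sub (integrable_mul_of_memLp 2 2 (memLp_conj h.1) hc2)
    (integrable_mul_of_memLp 2 2 (memLp_conj h'.1) hc2)
  rw [h.2 c hc hc2, h'.2 c hc hc2, ← h2] at h1
  refine Eq.trans ?_ (h1.trans ?_)
  · simp [sub_mul]
  · simp [sub_mul]

/-- Dual profiles are unique almost everywhere, so the bound of the constructed one holds for any,
in particular for differences. -/
lemma IsDualProfile.eLpNorm_le {F : ℝ × E3 → ℝ} {g : E3 → ℂ} (h : IsDualProfile F g)
    (hF : MemLp F (4 / 3) volume) : eLpNorm g 2 coneMeasure ≤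
      ENNReal.ofReal strichartzConst * eLpNorm F (4 / 3) volume := by
  obtain ⟨g', hg', hle⟩ := exists_isDualProfile hF
  have h1 := ae_eq_of_forall_coneMeasure (memLp_conj h.1) (memLp_conj hg'.1) fun φ => by
    obtain ⟨h1, h2⟩ := integrable_and_memLp_schwartz φ
    rw [← h.2 φ h1 h2, ← hg'.2 φ h1 h2]
  refine (eLpNorm_congr_ae ?_).trans_le hle
  filter_upwards [h1] with ξ hξ
  exact (starRingEnd ℂ).injective hξ

/-! ### The retarded solution operator -/

/-- The restriction of `F` to the past of time `t`. -/
noncomputable def pastCut (F : ℝ × E3 → ℝ) (t : ℝ) : ℝ × E3 → ℝ :=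
  {z : ℝ × E3 | z.1 < t}.indicator F

lemma measurableSet_past (t : ℝ) : MeasurableSet {z : ℝ × E3 | z.1 < t} :=
  measurableSet_lt measurable_fst measurable_const

lemma memLp_pastCut {F : ℝ × E3 → ℝ} {p : ℝ≥0∞} (hF : MemLp F p volume) (t : ℝ) :
    MemLp (pastCut F t) p volume := hF.indicator (measurableSet_past t)

lemma integrable_fourier (φ : 𝓢(E3, ℂ)) : Integrable (fun ξ => 𝓕 φ ξ) coneMeasure ∧
    MemLp (fun ξ => 𝓕 φ ξ) 2 coneMeasure := integrable_and_memLp_schwartz (𝓕 φ)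

lemma fourierMultiplier_sinSymbol_eq (r : ℝ) (φ : 𝓢(E3, ℂ)) (x : E3) :
    SchwartzMap.fourierMultiplierCLM ℂ (sinSymbol r) φ x = (4 * Real.pi * Complex.I)⁻¹ *
      (halfWave (fun ξ => 𝓕 φ ξ) (r, x) - halfWave (fun ξ => 𝓕 φ ξ) (-r, x)) := by
  have hi := (integrable_fourier φ).1
  rw [SchwartzMap.fourierMultiplierCLM_apply, SchwartzMap.fourierInv_coe, Real.fourierInv_eq',
    halfWave, halfWave, ← integral_sub (integrable_coneChar_mul hi _)
    (integrable_coneChar_mul hi _), ← integral_const_mul, integral_coneMeasure]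
  refine integral_congr_ae ?_
  filter_upwards [norm_mul_inv_ae] with ξ hξ
  have h1 : ∀ s, coneChar (s, x) ξ = coneChar (0, x) ξ * coneChar (s, 0) ξ := fun s => by
    rw [← coneChar_add]
    simp
  have h2 : coneChar (0, x) ξ = Complex.exp (↑(2 * Real.pi * inner ℝ ξ x) * Complex.I) := by
    simp only [coneChar, spacetimeInner, real_inner_comm x ξ]
    congr 1
    push_cast
    ring
  rw [SchwartzMap.smulLeftCLM_apply_apply (hasTemperateGrowth_sinSymbol r), h1, h1 (-r),
    coneChar_time, coneChar_time, cosSymbol_neg, sinSymbol_neg, ← h2]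
  have hpi : (Real.pi : ℂ) ≠ 0 := by exact_mod_cast Real.pi_ne_zero
  simp only [smul_eq_mul, Complex.real_smul, Complex.ofReal_inv]
  field_simp
  ring

/-- As a function of `(s, x)` the propagated test function is a combination of a half wave and a
conjugate half wave. This form can be paired with a dual profile. -/
lemma fourierMultiplier_sinSymbol_sub (t s : ℝ) (φ : 𝓢(E3, ℂ)) (x : E3) :
    SchwartzMap.fourierMultiplierCLM ℂ (sinSymbol (t - s)) φ x = (4 * Real.pi * Complex.I)⁻¹ *
      ((starRingEnd ℂ) (halfWave (reflProfile (propag t fun ξ => 𝓕 φ ξ)) (s, x)) -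
        halfWave (propag (-t) fun ξ => 𝓕 φ ξ) (s, x)) := by
  rw [fourierMultiplier_sinSymbol_eq, conj_halfWave, reflProfile_reflProfile, halfWave_time _ (-s),
    halfWave_time _ s, propag_propag, propag_propag, halfWave_time _ (t - s),
    halfWave_time _ (-(t - s))]
  ring_nf

/-- The kernel of the retarded operator, tested against `φ`, as a function in `L⁴`. -/
lemma memLp_propagated (t : ℝ) (φ : 𝓢(E3, ℂ)) : MemLp (fun z : ℝ × E3 =>
    SchwartzMap.fourierMultiplierCLM ℂ (sinSymbol (t - z.1)) φ z.2) 4 volume := by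
  obtain ⟨h1, h2⟩ := integrable_fourier φ
  have h3 := memLp_halfWave (memLp_one_iff_integrable.1 (memLp_reflProfile (memLp_propag t
    (memLp_one_iff_integrable.2 h1)))) (memLp_reflProfile (memLp_propag t h2))
  have h4 := memLp_halfWave (memLp_one_iff_integrable.1 (memLp_propag (-t)
    (memLp_one_iff_integrable.2 h1))) (memLp_propag (-t) h2)
  have h5 := (h3.star.sub h4).const_mul (4 * Real.pi * Complex.I)⁻¹
  refine h5.ae_eq (.of_forall fun z => ?_)
  simp only [fourierMultiplier_sinSymbol_sub]
  rfl

lemma integral_pastCut_mul (F : ℝ × E3 → ℝ) (t : ℝ) (K : ℝ × E3 → ℂ)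
    (h : Integrable fun z => (pastCut F t z : ℂ) * K z) :
    ∫ s in Set.Iio t, ∫ x : E3, (F (s, x) : ℂ) * K (s, x) = ∫ z, (pastCut F t z : ℂ) * K z := by
  rw [Measure.volume_eq_prod] at h ⊢
  rw [integral_prod _ h, ← integral_indicator measurableSet_Iio]
  refine integral_congr_ae (.of_forall fun s => ?_)
  by_cases hs : s < t
  · simp [pastCut, hs]
  · simp [pastCut, hs]

lemma antibox_eq {F : ℝ × E3 → ℝ} (hF : MemLp F (4 / 3) volume) (t : ℝ) (φ : 𝓢(E3, ℂ)) :
    antibox F t φ = ∫ z : ℝ × E3, (pastCut F t z : ℂ) *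
      SchwartzMap.fourierMultiplierCLM ℂ (sinSymbol (t - z.1)) φ z.2 :=
  integral_pastCut_mul F t _ (integrable_mul_of_memLp (4 / 3) 4 (memLp_pastCut hF t).ofReal
    (memLp_propagated t φ))

lemma fourier_neg_eq (φ : 𝓢(E3, ℂ)) (ξ : E3) : 𝓕 φ (-ξ) = 𝓕⁻ φ ξ := by
  rw [SchwartzMap.fourier_coe, SchwartzMap.fourierInv_coe, Real.fourierInv_eq_fourier_neg]

/-- The two half waves of the kernel produce `g` and its reflected conjugate with opposite signs.
Since `(4πi)⁻¹` is imaginary, conjugating it also changes the sign, so the result is the pairing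
with one profile `(4πi)⁻¹ g`. -/
lemma IsDualProfile.integral_mul_propagated {G : ℝ × E3 → ℝ} {g : E3 → ℂ}
    (hg : IsDualProfile G g) (hG : MemLp G (4 / 3) volume) (t : ℝ) (φ : 𝓢(E3, ℂ)) :
    ∫ z : ℝ × E3, (G z : ℂ) *
        SchwartzMap.fourierMultiplierCLM ℂ (sinSymbol (t - z.1)) φ z.2 =
      wavePair (propag t fun ξ => (4 * Real.pi * Complex.I)⁻¹ * g ξ) φ := by
  obtain ⟨h1, h2⟩ := integrable_fourier φ
  have hr1 := memLp_one_iff_integrable.1 (memLp_reflProfile (memLp_propag t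
    (memLp_one_iff_integrable.2 h1)))
  have hr2 := memLp_reflProfile (memLp_propag t h2)
  have hp1 := memLp_one_iff_integrable.1 (memLp_propag (-t) (memLp_one_iff_integrable.2 h1))
  have hp2 := memLp_propag (-t) h2
  have hi1 := integrable_mul_halfWave hG hr1 hr2
  have hi2 := integrable_mul_halfWave hG hp1 hp2
  have hi1' : Integrable (fun z => (G z : ℂ) * (starRingEnd ℂ)
      (halfWave (reflProfile (propag t fun ξ => 𝓕 φ ξ)) z)) := by
    refine (memLp_one_iff_integrable.1 (memLp_one_iff_integrable.2 hi1).star).congr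
      (.of_forall fun z => ?_)
    simp
  have e1 : ∫ z, (G z : ℂ) * (starRingEnd ℂ)
      (halfWave (reflProfile (propag t fun ξ => 𝓕 φ ξ)) z) =
      ∫ ξ, g ξ * (coneChar (t, 0) ξ * 𝓕⁻ φ ξ) ∂coneMeasure := by
    have := congrArg (starRingEnd ℂ) (hg.2 _ hr1 hr2)
    rw [← integral_conj, ← integral_conj] at this
    refine Eq.trans (integral_congr_ae (.of_forall fun z => ?_))
      (this.trans (integral_congr_ae (.of_forall fun ξ => ?_)))
    · simp
    · simp only [map_mul, reflProfile, propag, Complex.conj_conj, fourier_neg_eq,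
        coneChar_zero_right_neg]
  have e2 : ∫ z, (G z : ℂ) * halfWave (propag (-t) fun ξ => 𝓕 φ ξ) z =
      ∫ ξ, reflProfile g ξ * (coneChar (-t, 0) ξ * 𝓕⁻ φ ξ) ∂coneMeasure := by
    rw [hg.2 _ hp1 hp2, ← measurePreserving_neg_coneMeasure.integral_comp
      (MeasurableEquiv.neg E3).measurableEmbedding]
    refine integral_congr_ae (.of_forall fun ξ => ?_)
    simp only [reflProfile, propag, fourier_neg_eq, coneChar_zero_right_neg]
  have hg1 : Integrable (fun ξ => g ξ * (coneChar (t, 0) ξ * 𝓕⁻ φ ξ)) coneMeasure := by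
    refine (integrable_mul_fourierInv (memLp_propag t hg.1) φ).congr (.of_forall fun ξ => ?_)
    simp only [propag]
    ring
  have hg2 : Integrable (fun ξ => reflProfile g ξ * (coneChar (-t, 0) ξ * 𝓕⁻ φ ξ)) coneMeasure := by
    refine (integrable_mul_fourierInv (memLp_propag (-t) (memLp_reflProfile hg.1)) φ).congr
      (.of_forall fun ξ => ?_)
    simp only [propag]
    ring
  calc _ = (4 * Real.pi * Complex.I)⁻¹ *
        ((∫ z, (G z : ℂ) * (starRingEnd ℂ)
          (halfWave (reflProfile (propag t fun ξ => 𝓕 φ ξ)) z)) -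
        ∫ z, (G z : ℂ) * halfWave (propag (-t) fun ξ => 𝓕 φ ξ) z) := by
        rw [← integral_sub hi1' hi2, ← integral_const_mul]
        refine integral_congr_ae (.of_forall fun z => ?_)
        simp only [fourierMultiplier_sinSymbol_sub]
        ring
    _ = _ := by
        rw [e1, e2, ← integral_sub hg1 hg2, ← integral_const_mul, wavePair]
        refine integral_congr_ae (.of_forall fun ξ => ?_)
        simp only [reflProfile_propag, propag]
        simp only [reflProfile, map_mul, map_inv₀, Complex.conj_I, Complex.conj_ofReal, map_ofNat]
        have hpi : (Real.pi : ℂ) ≠ 0 := by exact_mod_cast Real.pi_ne_zero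
        field_simp
        ring

/-- The profile of the retarded solution at the time `t`. -/
lemma exists_antibox_profile {F : ℝ × E3 → ℝ} (hF : MemLp F (4 / 3) volume) :
    ∃ c : ℝ → E3 → ℂ, (∀ t, MemLp (c t) 2 coneMeasure) ∧
      (∀ t φ, antibox F t φ = wavePair (propag t (c t)) φ) ∧
      (∀ t, eLpNorm (c t) 2 coneMeasure ≤
        ENNReal.ofReal strichartzConst * eLpNorm (pastCut F t) (4 / 3) volume) ∧
      (∀ s t, eLpNorm (c s - c t) 2 coneMeasure ≤
        ENNReal.ofReal strichartzConst * eLpNorm (pastCut F s - pastCut F t) (4 / 3) volume) ∧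
      ∀ t, IsDualProfile (pastCut F t) (fun ξ => 4 * Real.pi * Complex.I * c t ξ) := by
  have hC : ‖(4 * Real.pi * Complex.I : ℂ)⁻¹‖ₑ ≤ 1 := by
    rw [← ofReal_norm, ENNReal.ofReal_le_one]
    simp only [norm_inv, norm_mul, Complex.norm_ofNat, Complex.norm_real, Complex.norm_I, mul_one,
      Real.norm_of_nonneg Real.pi_pos.le]
    refine inv_le_one_of_one_le₀ ?_
    linarith [Real.pi_gt_three]
  have hCne : (4 * Real.pi * Complex.I : ℂ) ≠ 0 := by
    simp [Real.pi_ne_zero]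
  have hle : ∀ g : E3 → ℂ, eLpNorm (fun ξ => (4 * Real.pi * Complex.I : ℂ)⁻¹ * g ξ) 2
      coneMeasure ≤ eLpNorm g 2 coneMeasure := fun g => by
    have h1 := eLpNorm_const_smul_le (p := 2) (μ := coneMeasure) (f := g)
      (c := (4 * Real.pi * Complex.I : ℂ)⁻¹)
    refine h1.trans ((mul_le_mul_left hC _).trans_eq (one_mul _))
  -- For a fixed `t` the constraint `s < t` is put into the function by cutting it. The adjoint
  -- estimate then applies directly at each time, with no estimate for `□⁻¹` in `L⁴`.
  choose g hg hgle using fun t => exists_isDualProfile (memLp_pastCut hF t)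
  refine ⟨fun t ξ => (4 * Real.pi * Complex.I)⁻¹ * g t ξ, fun t => (hg t).1.const_mul _,
    fun t φ => (antibox_eq hF t φ).trans
    ((hg t).integral_mul_propagated (memLp_pastCut hF t) t φ), fun t => (hle _).trans (hgle t),
    fun s t => ?_, fun t => ?_⟩
  · have h1 := ((hg s).sub (hg t) (memLp_pastCut hF s) (memLp_pastCut hF t)).eLpNorm_le
      ((memLp_pastCut hF s).sub (memLp_pastCut hF t))
    refine le_trans ?_ ((hle _).trans h1)
    refine (eLpNorm_congr_ae (.of_forall fun ξ => ?_)).le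
    simp [mul_sub]
  · simp_rw [mul_inv_cancel_left₀ hCne]
    exact hg t

/-! ### Continuity and differentiability of the retarded solution -/

lemma tendsto_eLpNorm_of_dominated {α E ι : Type*} [MeasurableSpace α] [NormedAddCommGroup E]
    {μ : Measure α} {l : Filter ι} [l.IsCountablyGenerated] {F : α → E} {p : ℝ≥0∞} (hp0 : p ≠ 0)
    (hp : p ≠ ∞) (hF : MemLp F p μ) {G : ι → α → E} (hG : ∀ i, AEStronglyMeasurable (G i) μ)
    (hle : ∀ i z, ‖G i z‖ ≤ ‖F z‖) (hlim : ∀ᵐ z ∂μ, Tendsto (fun i => G i z) l (𝓝 0)) :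
    Tendsto (fun i => eLpNorm (G i) p μ) l (𝓝 0) := by
  have hp' : 0 < p.toReal := ENNReal.toReal_pos hp0 hp
  have h1 : Tendsto (fun i => ∫⁻ z, ‖G i z‖ₑ ^ p.toReal ∂μ) l (𝓝 (∫⁻ _ : α, 0 ∂μ)) := by
    refine tendsto_of_seq_tendsto fun s hs => ?_
    refine tendsto_lintegral_of_dominated_convergence' (fun z => ‖F z‖ₑ ^ p.toReal)
      (fun n => (hG _).enorm.pow_const _) (fun n => .of_forall fun z => ?_) ?_ ?_
    · exact ENNReal.rpow_le_rpow (enorm_le_iff_norm_le.2 (hle _ z)) hp'.le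
    · exact (lintegral_rpow_enorm_lt_top_of_eLpNorm_lt_top hp0 hp hF.2).ne
    · filter_upwards [hlim] with z hz
      have h2 := ((hz.comp hs).enorm).ennrpow_const p.toReal
      simpa [Function.comp_def, hp', hp'.ne'] using h2
  have h2 := h1.ennrpow_const (1 / p.toReal)
  simp_rw [← eLpNorm_eq_lintegral_rpow_enorm_toReal hp0 hp] at h2
  simpa [hp'] using h2

lemma four_thirds_ne_zero : (4 / 3 : ℝ≥0∞) ≠ 0 := by simp

lemma four_thirds_ne_top : (4 / 3 : ℝ≥0∞) ≠ ∞ := ENNReal.div_ne_top (by simp) (by simp)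

lemma ae_fst_ne (t : ℝ) : ∀ᵐ z : ℝ × E3, z.1 ≠ t := by
  have h := (Measure.quasiMeasurePreserving_fst (μ := (volume : Measure ℝ))
    (ν := (volume : Measure E3))).ae (p := fun s => s ≠ t) (by simp [ae_iff])
  rwa [← Measure.volume_eq_prod] at h

lemma pastCut_sub_pastCut (F : ℝ × E3 → ℝ) (s t : ℝ) (z : ℝ × E3) :
    (pastCut F s - pastCut F t) z = if z.1 < s ∧ t ≤ z.1 then F z else
      if z.1 < t ∧ s ≤ z.1 then -F z else 0 := by
  simp only [pastCut, Pi.sub_apply, Set.indicator, Set.mem_ofPred_eq]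
  by_cases h1 : z.1 < s <;> by_cases h2 : z.1 < t
  · simp [h1, h2, h1.not_ge, h2.not_ge]
  · simp [h1, h2, not_lt.1 h2]
  · simp [h1, h2, not_lt.1 h1]
  · simp [h1, h2]

lemma tendsto_eLpNorm_pastCut_sub {F : ℝ × E3 → ℝ} (hF : MemLp F (4 / 3) volume) (t : ℝ) :
    Tendsto (fun s => eLpNorm (pastCut F s - pastCut F t) (4 / 3) volume) (𝓝 t) (𝓝 0) := by
  refine tendsto_eLpNorm_of_dominated four_thirds_ne_zero four_thirds_ne_top hF
    (fun s => ((memLp_pastCut hF s).sub (memLp_pastCut hF t)).1) (fun s z => ?_) ?_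
  · rw [pastCut_sub_pastCut]
    split_ifs <;> simp
  · filter_upwards [ae_fst_ne t] with z hz
    refine tendsto_const_nhds.congr' ?_
    rcases lt_or_gt_of_ne hz with h | h
    · filter_upwards [lt_mem_nhds h] with s hs
      rw [pastCut_sub_pastCut, if_neg (by simp [h]), if_neg (by simp [hs])]
    · filter_upwards [gt_mem_nhds h] with s hs
      rw [pastCut_sub_pastCut, if_neg (by simp [hs.le]), if_neg (by simp [h.le])]

lemma tendsto_eLpNorm_pastCut_atBot {F : ℝ × E3 → ℝ} (hF : MemLp F (4 / 3) volume) :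
    Tendsto (fun s => eLpNorm (pastCut F s) (4 / 3) volume) atBot (𝓝 0) := by
  refine tendsto_eLpNorm_of_dominated four_thirds_ne_zero four_thirds_ne_top hF
    (fun s => (memLp_pastCut hF s).1) (fun s z => ?_) (.of_forall fun z => ?_)
  · simp only [pastCut]
    exact norm_indicator_le_norm_self _ _
  · refine tendsto_const_nhds.congr' ?_
    filter_upwards [eventually_le_atBot z.1] with s hs
    simp [pastCut, hs]

lemma eLpNorm_fourierInv_schwartz (ψ : 𝓢(E3, ℂ)) :
    eLpNorm (fun x => 𝓕⁻ ψ x) 2 volume = eLpNorm ψ 2 volume := by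
  have h5 := SchwartzMap.norm_fourier_toL2_eq (𝓕⁻ ψ)
  rw [FourierTransform.fourier_fourierInv_eq, SchwartzMap.norm_toLp, SchwartzMap.norm_toLp] at h5
  exact ((ENNReal.toReal_eq_toReal_iff' (SchwartzMap.eLpNorm_lt_top _ _ _).ne
    (SchwartzMap.eLpNorm_lt_top _ _ _).ne).1 h5).symm

lemma norm_sinSymbol_le (r : ℝ) (ξ : E3) : ‖sinSymbol r ξ‖ ≤ |r| := by
  rw [sinSymbol, Complex.norm_real, Real.norm_eq_abs, abs_mul]
  exact mul_le_of_le_one_right (abs_nonneg _) (Real.abs_sinc_le_one _)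

lemma norm_fourierMultiplier_sinSymbol_le (r : ℝ) (φ : 𝓢(E3, ℂ)) (x : E3) :
    ‖SchwartzMap.fourierMultiplierCLM ℂ (sinSymbol r) φ x‖ ≤ |r| * ∫ ξ, ‖𝓕 φ ξ‖ := by
  rw [SchwartzMap.fourierMultiplierCLM_apply, SchwartzMap.fourierInv_coe, Real.fourierInv_eq',
    ← integral_const_mul]
  refine norm_integral_le_of_norm_le ((𝓕 φ).integrable.norm.const_mul _) (.of_forall fun ξ => ?_)
  rw [SchwartzMap.smulLeftCLM_apply_apply (hasTemperateGrowth_sinSymbol r), norm_smul, norm_smul,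
    Complex.norm_exp_ofReal_mul_I, one_mul]
  gcongr
  exact norm_sinSymbol_le r ξ

/-- The wave propagator is bounded in `L⁴` by the time, on a fixed test function. -/
lemma exists_lintegral_fourierMultiplier_sinSymbol_le (φ : 𝓢(E3, ℂ)) :
    ∃ C : ℝ≥0∞, C ≠ ∞ ∧ ∀ r : ℝ,
      ∫⁻ x, ‖SchwartzMap.fourierMultiplierCLM ℂ (sinSymbol r) φ x‖ₑ ^ 4 ≤
        C * ENNReal.ofReal |r| ^ 4 := by
  set N := ENNReal.ofReal (∫ ξ, ‖𝓕 φ ξ‖) with hN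
  set M := eLpNorm (fun ξ => 𝓕 φ ξ) 2 volume with hM
  have hMt : M ≠ ∞ := (SchwartzMap.eLpNorm_lt_top (𝓕 φ) 2 volume).ne
  refine ⟨N ^ 2 * M ^ 2, by finiteness, fun r => ?_⟩
  set u := SchwartzMap.fourierMultiplierCLM ℂ (sinSymbol r) φ with hu
  have h1 : ∀ x, ‖u x‖ₑ ≤ ENNReal.ofReal |r| * N := fun x => by
    rw [hN, ← ENNReal.ofReal_mul (abs_nonneg r), ← ofReal_norm]
    exact ENNReal.ofReal_le_ofReal (norm_fourierMultiplier_sinSymbol_le r φ x)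
  have h2 : eLpNorm u 2 volume ≤ ENNReal.ofReal |r| * M := by
    have h3 : eLpNorm u 2 volume =
        eLpNorm (SchwartzMap.smulLeftCLM ℂ (sinSymbol r) (𝓕 φ)) 2 volume := by
      rw [← eLpNorm_fourierInv_schwartz (SchwartzMap.smulLeftCLM ℂ (sinSymbol r) (𝓕 φ)), hu,
        SchwartzMap.fourierMultiplierCLM_apply]
    rw [h3]
    refine eLpNorm_le_mul_eLpNorm_of_ae_le_mul (.of_forall fun ξ => ?_) 2
    rw [SchwartzMap.smulLeftCLM_apply_apply (hasTemperateGrowth_sinSymbol r), norm_smul]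
    gcongr
    exact norm_sinSymbol_le r ξ
  calc ∫⁻ x, ‖u x‖ₑ ^ 4 ≤ ∫⁻ x, (ENNReal.ofReal |r| * N) ^ 2 * ‖u x‖ₑ ^ (2 : ℝ) := by
        refine lintegral_mono fun x => ?_
        rw [show (4 : ℕ) = 2 + 2 by rfl, pow_add]
        refine (mul_le_mul_left (pow_le_pow_left' (h1 x) 2) _).trans_eq ?_
        norm_num
    _ = (ENNReal.ofReal |r| * N) ^ 2 * eLpNorm u 2 volume ^ 2 := by
        rw [lintegral_const_mul' _ _ (by finiteness), lintegral_enorm_sq]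
    _ ≤ (ENNReal.ofReal |r| * N) ^ 2 * (ENNReal.ofReal |r| * M) ^ 2 := by gcongr
    _ = _ := by ring

/-- The difference of the cuts lives in the slab between `s` and `t`, where the propagator has
elapsed time at most `|s - t|` and hence is `O(|s - t|)` in `L⁴(ℝ³)` on `φ`. The width of the slab,
at most `2|s - t| ≤ 2`, only affects the constant. -/
lemma enorm_integral_pastCut_sub_le (φ : 𝓢(E3, ℂ)) : ∃ C : ℝ≥0∞, C ≠ ∞ ∧
    ∀ (F : ℝ × E3 → ℝ), MemLp F (4 / 3) volume → ∀ s t : ℝ, |s - t| ≤ 1 →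
      ‖∫ z : ℝ × E3, ((pastCut F s - pastCut F t) z : ℂ) *
        SchwartzMap.fourierMultiplierCLM ℂ (sinSymbol (s - z.1)) φ z.2‖ₑ ≤
        eLpNorm (pastCut F s - pastCut F t) (4 / 3) volume * (C * ENNReal.ofReal |s - t|) := by
  obtain ⟨C, hC, hCle⟩ := exists_lintegral_fourierMultiplier_sinSymbol_le φ
  refine ⟨2 * C + 1, by finiteness, fun F hF s t hst => ?_⟩
  set h := |s - t| with hh
  set K : ℝ × E3 → ℂ := fun z =>
    SchwartzMap.fourierMultiplierCLM ℂ (sinSymbol (s - z.1)) φ z.2 with hK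
  have hKm : MemLp K 4 volume := memLp_propagated s φ
  set E : Set (ℝ × E3) := {z | |s - z.1| ≤ h} with hE
  have hEm : MeasurableSet E := measurableSet_le (by fun_prop) (by fun_prop)
  have h1 : ∀ z, ((pastCut F s - pastCut F t) z : ℂ) * K z =
      ((pastCut F s - pastCut F t) z : ℂ) * E.indicator K z := fun z => by
    by_cases hz : z ∈ E
    · rw [Set.indicator_of_mem hz]
    · have h0 : (pastCut F s - pastCut F t) z = 0 := by
        rw [pastCut_sub_pastCut, if_neg, if_neg]
        · rintro ⟨h3, h4⟩
          refine hz ?_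
          rw [hE, Set.mem_ofPred_eq, hh, abs_of_nonpos (by linarith), abs_of_nonpos (by linarith)]
          linarith
        · rintro ⟨h3, h4⟩
          refine hz ?_
          rw [hE, Set.mem_ofPred_eq, hh, abs_of_nonneg (by linarith), abs_of_nonneg (by linarith)]
          linarith
      rw [h0]
      simp
  have h2 : eLpNorm (E.indicator K) 4 volume ≤ (2 * C + 1) * ENNReal.ofReal h := by
    refine (ENNReal.pow_le_pow_left_iff four_ne_zero).1 ?_
    rw [eLpNorm_four_pow]
    have hm : AEMeasurable (fun z => ‖E.indicator K z‖ₑ ^ 4) volume :=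
      (hKm.1.indicator hEm).enorm.pow_const 4
    rw [Measure.volume_eq_prod] at hm ⊢
    rw [lintegral_prod _ hm]
    calc ∫⁻ τ, ∫⁻ x, ‖E.indicator K (τ, x)‖ₑ ^ 4
        ≤ ∫⁻ τ, (Metric.closedBall s h).indicator
            (fun _ => C * ENNReal.ofReal h ^ 4) τ := by
          refine lintegral_mono fun τ => ?_
          by_cases hτ : |s - τ| ≤ h
          · have h3 : τ ∈ Metric.closedBall s h := by
              rw [Metric.mem_closedBall, Real.dist_eq, abs_sub_comm]
              exact hτ
            have h4 : ∀ x, E.indicator K (τ, x) = K (τ, x) := fun x =>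
              Set.indicator_of_mem (s := E) (a := ((τ, x) : ℝ × E3)) hτ K
            rw [Set.indicator_of_mem h3]
            simp_rw [h4]
            refine (hCle (s - τ)).trans ?_
            gcongr
          · have h4 : ∀ x, E.indicator K (τ, x) = 0 := fun x =>
              Set.indicator_of_notMem (s := E) (a := ((τ, x) : ℝ × E3)) hτ K
            simp_rw [h4]
            simp
      _ = C * ENNReal.ofReal h ^ 4 * ENNReal.ofReal (2 * h) := by
          rw [lintegral_indicator_const Metric.isClosed_closedBall.measurableSet,
            Real.volume_closedBall]
      _ ≤ C * ENNReal.ofReal h ^ 4 * 2 := by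
          gcongr
          rw [show (2 : ℝ≥0∞) = ENNReal.ofReal 2 by simp]
          exact ENNReal.ofReal_le_ofReal (by linarith)
      _ ≤ (2 * C + 1) ^ 4 * ENNReal.ofReal h ^ 4 := by
          rw [mul_right_comm, mul_comm C 2]
          gcongr
          exact (le_self_add).trans (le_self_pow (le_add_self) four_ne_zero)
      _ = _ := by rw [mul_pow]
  have hD := (memLp_pastCut hF s).sub (memLp_pastCut hF t)
  have h3 : ‖∫ z, ((pastCut F s - pastCut F t) z : ℂ) * E.indicator K z‖ₑ ≤
      eLpNorm (fun z => ((pastCut F s - pastCut F t) z : ℂ)) (4 / 3) volume *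
        eLpNorm (E.indicator K) 4 volume :=
    enorm_integral_mul_le (4 / 3) 4 hD.ofReal.1 (hKm.1.indicator hEm)
  rw [eLpNorm_ofReal_complex] at h3
  have h4 := integral_congr_ae (μ := (volume : Measure (ℝ × E3))) (.of_forall h1)
  exact (congrArg enorm h4).trans_le (h3.trans (mul_le_mul_right h2 _))

/-- The retarded solution is differentiable in time. -/
lemma hasDerivAt_antibox {F : ℝ × E3 → ℝ} (hF : MemLp F (4 / 3) volume) {c : ℝ → E3 → ℂ}
    (hc : ∀ t, MemLp (c t) 2 coneMeasure)
    (hcd : ∀ t, IsDualProfile (pastCut F t) (fun ξ => 4 * Real.pi * Complex.I * c t ξ)) (t : ℝ)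
    (φ : 𝓢(E3, ℂ)) :
    HasDerivAt (fun s => wavePair (propag s (c s)) φ) (velPair (propag t (c t)) φ) t := by
  have hpi : (4 * Real.pi * Complex.I : ℂ) ≠ 0 := by simp [Real.pi_ne_zero]
  obtain ⟨C, hC, hCle⟩ := enorm_integral_pastCut_sub_le φ
  have h1 : ∀ s, wavePair (propag s (c s - c t)) φ = ∫ z : ℝ × E3,
      ((pastCut F s - pastCut F t) z : ℂ) *
        SchwartzMap.fourierMultiplierCLM ℂ (sinSymbol (s - z.1)) φ z.2 := fun s => by
    have hFs := memLp_pastCut hF s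
    have hFt := memLp_pastCut hF t
    rw [((hcd s).sub (hcd t) hFs hFt).integral_mul_propagated (hFs.sub hFt) s φ]
    have h3 : c s - c t = fun ξ => (4 * Real.pi * Complex.I)⁻¹ *
        ((fun ξ => 4 * Real.pi * Complex.I * c s ξ) -
          fun ξ => 4 * Real.pi * Complex.I * c t ξ) ξ := by
      ext ξ
      simp only [Pi.sub_apply, ← mul_sub, inv_mul_cancel_left₀ hpi]
    rw [← h3]
  have h2 : (fun s => wavePair (propag s (c s)) φ) = fun s => wavePair (propag s (c t)) φ +
      wavePair (propag s (c s - c t)) φ := by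
    ext s
    rw [← wavePair_add (memLp_propag s (hc t)) (memLp_propag s ((hc s).sub (hc t))),
      ← propag_add, add_sub_cancel]
  -- The moving endpoint contributes no derivative, because `sin` vanishes at elapsed time 0: the
  -- term is `O(|s - t|)` times the norm of `F` on the slab, which tends to 0.
  have h3 : HasDerivAt (fun s => wavePair (propag s (c s - c t)) φ) 0 t := by
    rw [hasDerivAt_iff_isLittleO, Asymptotics.isLittleO_iff]
    intro ε hε
    have h4 : Tendsto (fun s => eLpNorm (pastCut F s - pastCut F t) (4 / 3) volume * C) (𝓝 t)
        (𝓝 0) := by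
      have := ENNReal.Tendsto.mul_const (tendsto_eLpNorm_pastCut_sub hF t) (.inr hC)
      simpa using this
    have h0 : wavePair (propag t (c t - c t)) φ = 0 := by
      rw [h1]
      simp
    filter_upwards [h4.eventually_lt_const (ENNReal.ofReal_pos.2 hε),
      Metric.closedBall_mem_nhds t one_pos] with s hs hs1
    have hs2 : |s - t| ≤ 1 := by simpa [Real.dist_eq] using hs1
    rw [h0, smul_zero, sub_zero, sub_zero, h1]
    have h5 := hCle F hF s t hs2
    rw [← mul_assoc] at h5
    have h6 := h5.trans (mul_le_mul_left hs.le _)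
    rwa [← ofReal_norm, ← ENNReal.ofReal_mul hε.le, ENNReal.ofReal_le_ofReal_iff (by positivity)]
      at h6
  rw [h2]
  exact ((hasDerivAt_wavePair_propag (hc t) t φ).add h3).congr_deriv (add_zero _)

/-! ### Kirchhoff's formula -/

lemma schwartz_eq_integral_fourier (φ : 𝓢(E3, ℂ)) (x : E3) :
    φ x = ∫ ξ : E3, Complex.exp (2 * Real.pi * Complex.I * (inner ℝ ξ x : ℝ)) * 𝓕 φ ξ := by
  have h0 : (𝓕⁻ (𝓕 φ : 𝓢(E3, ℂ)) : 𝓢(E3, ℂ)) = φ := FourierTransform.fourierInv_fourier_eq φ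
  have h : (𝓕⁻ (𝓕 φ : 𝓢(E3, ℂ)) : 𝓢(E3, ℂ)) x = φ x := by rw [h0]
  rw [SchwartzMap.fourierInv_coe, Real.fourierInv_eq'] at h
  rw [← h]
  refine integral_congr_ae (.of_forall fun ξ => ?_)
  simp only [smul_eq_mul]
  push_cast
  ring_nf

lemma fourierMultiplier_sinSymbol_apply (r : ℝ) (φ : 𝓢(E3, ℂ)) (x : E3) :
    SchwartzMap.fourierMultiplierCLM ℂ (sinSymbol r) φ x = ∫ ξ : E3,
      Complex.exp (2 * Real.pi * Complex.I * (inner ℝ ξ x : ℝ)) * (sinSymbol r ξ * 𝓕 φ ξ) := by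
  rw [SchwartzMap.fourierMultiplierCLM_apply, SchwartzMap.fourierInv_coe, Real.fourierInv_eq']
  refine integral_congr_ae (.of_forall fun ξ => ?_)
  simp only [SchwartzMap.smulLeftCLM_apply_apply (hasTemperateGrowth_sinSymbol r), smul_eq_mul]
  push_cast
  ring_nf

lemma continuous_fourierMultiplier_sinSymbol (φ : 𝓢(E3, ℂ)) : Continuous fun z : ℝ × E3 =>
    SchwartzMap.fourierMultiplierCLM ℂ (sinSymbol z.1) φ z.2 := by
  simp only [fourierMultiplier_sinSymbol_eq]
  have h := continuous_halfWave (integrable_fourier φ).1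
  have h1 : Continuous fun z : ℝ × E3 => halfWave (fun ξ => 𝓕 φ ξ) (z.1, z.2) := h
  have h2 : Continuous fun z : ℝ × E3 => halfWave (fun ξ => 𝓕 φ ξ) (-z.1, z.2) :=
    h.comp (g := halfWave fun ξ => 𝓕 φ ξ) (f := fun z : ℝ × E3 => (-z.1, z.2)) (by fun_prop)
  exact continuous_const.mul (h1.sub h2)

lemma norm_exp_two_pi_I_mul (x : ℝ) : ‖Complex.exp (2 * Real.pi * Complex.I * x)‖ = 1 := by
  rw [Complex.norm_exp]
  simp

/-- Kirchhoff's formula, integrated in time against a function `h`. -/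
lemma integral_coneMeasure_norm_mul_schwartz {h : ℝ → ℂ} (hh : Measurable h)
    (hi : IntegrableOn (fun r : ℝ => (r : ℂ) * h r) (Set.Ioi 0)) (φ : 𝓢(E3, ℂ)) (x : E3) :
    ∫ y, h ‖y‖ * φ (x - y) ∂coneMeasure = 4 * Real.pi * ∫ r in Set.Ioi 0,
      h r * SchwartzMap.fourierMultiplierCLM ℂ (sinSymbol r) φ x := by
  have hφ : Integrable (fun ξ => 𝓕 φ ξ) := (𝓕 φ).integrable
  have hhi := integrable_coneMeasure_norm hh hi
  have hint1 : Integrable (fun q : E3 × E3 =>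
      Complex.exp (2 * Real.pi * Complex.I * (inner ℝ q.2 (x - q.1) : ℝ)) * (h ‖q.1‖ * 𝓕 φ q.2))
      (coneMeasure.prod volume) :=
    (hhi.mul_prod hφ).bdd_mul (c := 1) (Continuous.aestronglyMeasurable (by fun_prop))
      (.of_forall fun q => (norm_exp_two_pi_I_mul _).le)
  have hint2 : Integrable (fun q : ℝ × E3 =>
      (Complex.exp (2 * Real.pi * Complex.I * (inner ℝ q.2 x : ℝ)) *
        (Real.sinc (2 * Real.pi * q.1 * ‖q.2‖) : ℝ)) * ((q.1 * h q.1) * 𝓕 φ q.2))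
      ((volume.restrict (Set.Ioi 0)).prod volume) := by
    refine (hi.integrable.mul_prod hφ).bdd_mul (c := 1)
      (Measurable.aestronglyMeasurable ?_) (.of_forall fun q => ?_)
    · have := Real.continuous_sinc
      fun_prop
    · rw [norm_mul, norm_exp_two_pi_I_mul, one_mul, Complex.norm_real]
      exact Real.abs_sinc_le_one _
  calc ∫ y, h ‖y‖ * φ (x - y) ∂coneMeasure
      = ∫ y, (∫ ξ : E3, Complex.exp (2 * Real.pi * Complex.I * (inner ℝ ξ (x - y) : ℝ)) *
          (h ‖y‖ * 𝓕 φ ξ)) ∂coneMeasure := by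
        refine integral_congr_ae (.of_forall fun y => ?_)
        simp only
        rw [schwartz_eq_integral_fourier, ← integral_const_mul]
        refine integral_congr_ae (.of_forall fun ξ => ?_)
        simp only
        ring
    _ = ∫ ξ : E3, (∫ y, Complex.exp (2 * Real.pi * Complex.I * (inner ℝ ξ (x - y) : ℝ)) *
          (h ‖y‖ * 𝓕 φ ξ) ∂coneMeasure) := integral_integral_swap hint1
    _ = ∫ ξ : E3, (∫ r in Set.Ioi 0, (Complex.exp (2 * Real.pi * Complex.I * (inner ℝ ξ x : ℝ)) *
        (Real.sinc (2 * Real.pi * r * ‖ξ‖) : ℝ)) * ((r * h r) * 𝓕 φ ξ)) * (4 * Real.pi) := by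
        refine integral_congr_ae (.of_forall fun ξ => ?_)
        have h1 := integral_coneMeasure_norm_mul_exp hh hi (-ξ)
        simp only
        have h2 : ∀ y, Complex.exp (2 * Real.pi * Complex.I * (inner ℝ ξ (x - y) : ℝ)) *
            (h ‖y‖ * 𝓕 φ ξ) = (Complex.exp (2 * Real.pi * Complex.I * (inner ℝ ξ x : ℝ)) *
            𝓕 φ ξ) * (h ‖y‖ * Complex.exp (2 * Real.pi * Complex.I * (inner ℝ y (-ξ) : ℝ))) :=
          fun y => by
            have h3 : Complex.exp (2 * Real.pi * Complex.I * (inner ℝ ξ (x - y) : ℝ)) =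
                Complex.exp (2 * Real.pi * Complex.I * (inner ℝ ξ x : ℝ)) *
                Complex.exp (2 * Real.pi * Complex.I * (inner ℝ y (-ξ) : ℝ)) := by
              rw [← Complex.exp_add, inner_sub_right, inner_neg_right, real_inner_comm ξ y]
              congr 1
              push_cast
              ring
            rw [h3]
            ring
        simp_rw [h2]
        rw [integral_const_mul, h1, mul_left_comm, ← integral_const_mul, mul_comm]
        congr 1
        refine integral_congr_ae (.of_forall fun r => ?_)
        simp only [sinSymbol, norm_neg]
        push_cast
        ring
    _ = 4 * Real.pi * ∫ ξ : E3, (∫ r in Set.Ioi 0,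
        (Complex.exp (2 * Real.pi * Complex.I * (inner ℝ ξ x : ℝ)) *
        (Real.sinc (2 * Real.pi * r * ‖ξ‖) : ℝ)) * ((r * h r) * 𝓕 φ ξ)) := by
        rw [integral_mul_const, mul_comm]
    _ = 4 * Real.pi * ∫ r in Set.Ioi 0, (∫ ξ : E3,
        (Complex.exp (2 * Real.pi * Complex.I * (inner ℝ ξ x : ℝ)) *
        (Real.sinc (2 * Real.pi * r * ‖ξ‖) : ℝ)) * ((r * h r) * 𝓕 φ ξ)) := by
        exact congrArg _ (integral_integral_swap hint2).symm
    _ = _ := by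
        congr 1
        refine integral_congr_ae (.of_forall fun r => ?_)
        simp only
        rw [fourierMultiplier_sinSymbol_apply, ← integral_const_mul]
        refine integral_congr_ae (.of_forall fun ξ => ?_)
        simp only [sinSymbol]
        push_cast
        ring

/-- The truncation of a function on the half line to a set where it is bounded. -/
def truncSet (h : ℝ → ℝ) (n : ℕ) : Set ℝ := {r | |h r| ≤ n ∧ r ≤ n}

lemma measurableSet_truncSet {h : ℝ → ℝ} (hh : Measurable h) (n : ℕ) :
    MeasurableSet (truncSet h n) :=
  (measurableSet_le (f := fun r => |h r|) (by fun_prop) measurable_const).inter measurableSet_Iic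

lemma eventually_mem_truncSet (h : ℝ → ℝ) (r : ℝ) : ∀ᶠ n in atTop, r ∈ truncSet h n := by
  filter_upwards [eventually_ge_atTop ⌈|h r|⌉₊, eventually_ge_atTop ⌈r⌉₊] with n h1 h2
  exact ⟨(Nat.le_ceil _).trans (by exact_mod_cast h1), (Nat.le_ceil _).trans (by exact_mod_cast h2)⟩

lemma integrableOn_truncSet {h : ℝ → ℝ} (hh : Measurable h) (n : ℕ) :
    IntegrableOn (fun r : ℝ => (r : ℂ) * (((truncSet h n).indicator h r : ℝ) : ℂ)) (Set.Ioi 0) := by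
  have hm : Measurable fun r => (((truncSet h n).indicator h r : ℝ) : ℂ) :=
    Complex.measurable_ofReal.comp (hh.indicator (measurableSet_truncSet hh n))
  have h1 : IntegrableOn (fun _ : ℝ => (n : ℝ) * n) (Set.Ioc 0 n) := by
    rw [integrableOn_const_iff]
    simp
  have h2 := (integrable_indicator_iff measurableSet_Ioc).2 h1
  refine h2.integrableOn.mono' ((Complex.measurable_ofReal.mul hm).aestronglyMeasurable) ?_
  filter_upwards [ae_restrict_mem measurableSet_Ioi] with r hr
  have hr0 : 0 < r := hr
  rw [norm_mul, Complex.norm_real, Complex.norm_real, Real.norm_of_nonneg hr0.le]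
  by_cases hmem : r ∈ truncSet h n
  · have h3 : r ∈ Set.Ioc (0 : ℝ) n := ⟨hr0, hmem.2⟩
    rw [Set.indicator_of_mem hmem, Set.indicator_of_mem h3]
    exact mul_le_mul hmem.2 hmem.1 (norm_nonneg _) (Nat.cast_nonneg n)
  · rw [Set.indicator_of_notMem hmem, norm_zero, mul_zero]
    exact Set.indicator_nonneg (fun _ _ => by positivity) _

lemma integral_coneMeasure_truncSet {h : ℝ → ℝ} (hh : Measurable h) (φ : 𝓢(E3, ℂ)) (x : E3)
    (n : ℕ) :
    ∫ y, (((truncSet h n).indicator h ‖y‖ : ℝ) : ℂ) * φ (x - y) ∂coneMeasure =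
      4 * Real.pi * ∫ r in Set.Ioi 0, (((truncSet h n).indicator h r : ℝ) : ℂ) *
        SchwartzMap.fourierMultiplierCLM ℂ (sinSymbol r) φ x :=
  integral_coneMeasure_norm_mul_schwartz
    (Complex.measurable_ofReal.comp (hh.indicator (measurableSet_truncSet hh n)))
    (integrableOn_truncSet hh n) φ x

/-- For a nonnegative `φ` and a truncation of `|h|` the left integral is the modulus of its complex
counterpart, to which Kirchhoff's formula applies. Fatou's lemma removes the truncation, so no
integrability of `h` is required. -/
lemma lintegral_coneMeasure_mul_le {h : ℝ → ℝ} (hh : Measurable h) {φ : 𝓢(E3, ℂ)}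
    (hφ : ∀ x, ∃ r : ℝ, 0 ≤ r ∧ φ x = r) (x : E3) :
    ∫⁻ y, ‖h ‖y‖‖ₑ * ‖φ (x - y)‖ₑ ∂coneMeasure ≤ ENNReal.ofReal (4 * Real.pi) *
      ∫⁻ r in Set.Ioi 0, ‖h r‖ₑ *
        ‖SchwartzMap.fourierMultiplierCLM ℂ (sinSymbol r) φ x‖ₑ := by
  set k : ℝ → ℝ := fun r => |h r| with hk
  have hkm : Measurable k := by fun_prop
  have hcont : Continuous fun y => φ (x - y) := φ.continuous.comp (by fun_prop)
  have hmn : ∀ n, Measurable fun y : E3 => ((truncSet k n).indicator k ‖y‖ : ℝ) := fun n =>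
    (hkm.indicator (measurableSet_truncSet hkm n)).comp measurable_norm
  have h1 : ∀ n, ∫⁻ y, ‖((truncSet k n).indicator k ‖y‖ : ℝ)‖ₑ * ‖φ (x - y)‖ₑ ∂coneMeasure ≤
      ENNReal.ofReal (4 * Real.pi) * ∫⁻ r in Set.Ioi 0, ‖h r‖ₑ *
        ‖SchwartzMap.fourierMultiplierCLM ℂ (sinSymbol r) φ x‖ₑ := fun n => by
    have hint : Integrable (fun y => (((truncSet k n).indicator k ‖y‖ : ℝ) : ℂ) * φ (x - y))
        coneMeasure := by
      refine (integrable_coneMeasure_norm (Complex.measurable_ofReal.comp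
        (hkm.indicator (measurableSet_truncSet hkm n))) (integrableOn_truncSet hkm n)).mul_bdd
        (c := ‖φ.toBoundedContinuousFunction‖) hcont.aestronglyMeasurable (.of_forall fun y => ?_)
      exact φ.toBoundedContinuousFunction.norm_coe_le_norm (x - y)
    have h2 : ∫⁻ y, ‖((truncSet k n).indicator k ‖y‖ : ℝ)‖ₑ * ‖φ (x - y)‖ₑ ∂coneMeasure =
        ‖∫ y, (((truncSet k n).indicator k ‖y‖ : ℝ) : ℂ) * φ (x - y) ∂coneMeasure‖ₑ := by
      have h3 : ∀ y, (((truncSet k n).indicator k ‖y‖ : ℝ) : ℂ) * φ (x - y) =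
          ((‖(((truncSet k n).indicator k ‖y‖ : ℝ) : ℂ) * φ (x - y)‖ : ℝ) : ℂ) := fun y => by
        obtain ⟨r, hr, hφr⟩ := hφ (x - y)
        have h4 : 0 ≤ (truncSet k n).indicator k ‖y‖ :=
          Set.indicator_nonneg (fun _ _ => abs_nonneg _) _
        rw [hφr, ← Complex.ofReal_mul, Complex.norm_real, Real.norm_of_nonneg (by positivity)]
      rw [integral_congr_ae (.of_forall h3), integral_complex_ofReal, ← ofReal_norm,
        Complex.norm_real, Real.norm_of_nonneg (integral_nonneg fun _ => norm_nonneg _),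
        ofReal_integral_norm_eq_lintegral_enorm hint]
      refine lintegral_congr fun y => ?_
      rw [enorm_mul, ← ofReal_norm (((truncSet k n).indicator k ‖y‖ : ℝ) : ℂ), Complex.norm_real,
        ofReal_norm]
    rw [h2, integral_coneMeasure_truncSet hkm, enorm_mul]
    have h3 : ‖(4 * Real.pi : ℂ)‖ₑ = ENNReal.ofReal (4 * Real.pi) := by
      rw [← ofReal_norm]
      simp [abs_of_pos Real.pi_pos]
    rw [h3]
    gcongr
    refine (enorm_integral_le_lintegral_enorm _).trans (lintegral_mono fun r => ?_)
    rw [enorm_mul]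
    gcongr
    rw [← ofReal_norm, ← ofReal_norm, Complex.norm_real]
    refine ENNReal.ofReal_le_ofReal ((norm_indicator_le_norm_self _ _).trans_eq ?_)
    simp [hk]
  have h2 : ∀ y : E3, ‖h ‖y‖‖ₑ * ‖φ (x - y)‖ₑ =
      liminf (fun n => ‖((truncSet k n).indicator k ‖y‖ : ℝ)‖ₑ * ‖φ (x - y)‖ₑ) atTop := fun y => by
    refine (Tendsto.liminf_eq ?_).symm
    refine tendsto_const_nhds.congr' ?_
    filter_upwards [eventually_mem_truncSet k ‖y‖] with n hn
    rw [Set.indicator_of_mem hn, hk]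
    simp
  simp_rw [h2]
  refine (lintegral_liminf_le fun n => ?_).trans ?_
  · exact (hmn n).enorm.mul hcont.measurable.enorm
  · exact liminf_le_of_frequently_le' (Frequently.of_forall h1)

/-- Kirchhoff's formula for an unbounded `h` is the limit of its truncations, by dominated
convergence on both sides. -/
lemma integral_coneMeasure_mul_schwartz {h : ℝ → ℝ} (hh : Measurable h) {φ : 𝓢(E3, ℂ)} {x : E3}
    (hi1 : Integrable (fun y => (h ‖y‖ : ℂ) * φ (x - y)) coneMeasure)
    (hi2 : IntegrableOn (fun r => (h r : ℂ) *
      SchwartzMap.fourierMultiplierCLM ℂ (sinSymbol r) φ x) (Set.Ioi 0)) :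
    ∫ y, (h ‖y‖ : ℂ) * φ (x - y) ∂coneMeasure = 4 * Real.pi *
      ∫ r in Set.Ioi 0, (h r : ℂ) * SchwartzMap.fourierMultiplierCLM ℂ (sinSymbol r) φ x := by
  have hP : Continuous fun r => SchwartzMap.fourierMultiplierCLM ℂ (sinSymbol r) φ x :=
    (continuous_fourierMultiplier_sinSymbol φ).comp (f := fun r : ℝ => ((r, x) : ℝ × E3))
      (by fun_prop)
  have hcont : Continuous fun y => φ (x - y) := φ.continuous.comp (by fun_prop)
  have hm : ∀ n, Measurable fun r => (((truncSet h n).indicator h r : ℝ) : ℂ) := fun n =>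
    Complex.measurable_ofReal.comp (hh.indicator (measurableSet_truncSet hh n))
  have hle : ∀ n r, ‖(((truncSet h n).indicator h r : ℝ) : ℂ)‖ ≤ ‖(h r : ℂ)‖ := fun n r => by
    rw [Complex.norm_real, Complex.norm_real]
    exact norm_indicator_le_norm_self _ _
  have hlim : ∀ r, Tendsto (fun n => (((truncSet h n).indicator h r : ℝ) : ℂ)) atTop
      (𝓝 (h r : ℂ)) := fun r => by
    refine tendsto_const_nhds.congr' ?_
    filter_upwards [eventually_mem_truncSet h r] with n hn
    rw [Set.indicator_of_mem hn]
  have h1 : Tendsto (fun n => ∫ y, (((truncSet h n).indicator h ‖y‖ : ℝ) : ℂ) * φ (x - y)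
      ∂coneMeasure) atTop (𝓝 (∫ y, (h ‖y‖ : ℂ) * φ (x - y) ∂coneMeasure)) := by
    refine tendsto_integral_of_dominated_convergence (fun y => ‖(h ‖y‖ : ℂ) * φ (x - y)‖)
      (fun n => ((hm n).comp measurable_norm).aestronglyMeasurable.mul hcont.aestronglyMeasurable)
      hi1.norm (fun n => .of_forall fun y => ?_) (.of_forall fun y => (hlim _).mul_const _)
    rw [norm_mul, norm_mul]
    gcongr
    exact hle n _
  have h2 : Tendsto (fun n => ∫ r in Set.Ioi 0, (((truncSet h n).indicator h r : ℝ) : ℂ) *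
      SchwartzMap.fourierMultiplierCLM ℂ (sinSymbol r) φ x) atTop (𝓝 (∫ r in Set.Ioi 0,
      (h r : ℂ) * SchwartzMap.fourierMultiplierCLM ℂ (sinSymbol r) φ x)) := by
    refine tendsto_integral_of_dominated_convergence (fun r => ‖(h r : ℂ) *
      SchwartzMap.fourierMultiplierCLM ℂ (sinSymbol r) φ x‖)
      (fun n => (hm n).aestronglyMeasurable.mul hP.aestronglyMeasurable)
      hi2.norm (fun n => .of_forall fun r => ?_) (.of_forall fun r => (hlim r).mul_const _)
    rw [norm_mul, norm_mul]
    gcongr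
    exact hle n _
  refine tendsto_nhds_unique h1 ?_
  simp_rw [integral_coneMeasure_truncSet hh]
  exact h2.const_mul _

/-! ### The retarded potential -/

/-- The retarded potential `(1/4π) ∫ F(t - |y|, x - y) dy/|y|`. -/
noncomputable def retarded (F : ℝ × E3 → ℝ) (z : ℝ × E3) : ℝ :=
  (4 * Real.pi)⁻¹ * ∫ y, F (z.1 - ‖y‖, z.2 - y) ∂coneMeasure

lemma measurable_retarded {F : ℝ × E3 → ℝ} (hF : Measurable F) : Measurable (retarded F) := by
  have h : StronglyMeasurable fun q : (ℝ × E3) × E3 => F (q.1.1 - ‖q.2‖, q.1.2 - q.2) :=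
    (hF.comp (by fun_prop)).stronglyMeasurable
  exact (h.integral_prod_right' (ν := coneMeasure)).measurable.const_mul _

lemma pastCut_time_sub (F : ℝ × E3 → ℝ) (t r : ℝ) (x : E3) :
    pastCut F t (t - r, x) = (Set.Ioi (0 : ℝ)).indicator (fun r => F (t - r, x)) r := by
  simp [pastCut, Set.indicator]

/-- The integrability cannot be read off the propagator of `φ` itself, since `φ` may oscillate. The
nonnegative Schwartz majorant `ψ` allows Tonelli's theorem to be combined with
`lintegral_coneMeasure_mul_le`; the resulting integral is finite by Hölder, as `F ∈ L^{4/3}` and the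
propagated `ψ` is in `L⁴`. -/
lemma integrable_retarded_kernel {F : ℝ × E3 → ℝ} (hFm : Measurable F)
    (hF : MemLp F (4 / 3) volume) (t : ℝ) {φ ψ : 𝓢(E3, ℂ)} (hψ : ∀ x, ∃ r : ℝ, 0 ≤ r ∧ ψ x = r)
    (hφ : ∀ x, ‖φ x‖ ≤ ‖ψ x‖) :
    Integrable (fun q : E3 × E3 => (F (t - ‖q.1‖, q.2) : ℂ) * φ (q.2 - q.1))
      (coneMeasure.prod volume) := by
  have hm : Measurable fun q : E3 × E3 => (F (t - ‖q.1‖, q.2) : ℂ) * φ (q.2 - q.1) := by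
    refine (Complex.measurable_ofReal.comp (hFm.comp (by fun_prop))).mul ?_
    exact φ.continuous.measurable.comp (by fun_prop)
  refine ⟨hm.aestronglyMeasurable, ?_⟩
  rw [HasFiniteIntegral, lintegral_prod_symm' _ hm.enorm]
  have hint : Integrable fun z : ℝ × E3 => (pastCut F t z : ℂ) *
      SchwartzMap.fourierMultiplierCLM ℂ (sinSymbol (t - z.1)) ψ z.2 :=
    integrable_mul_of_memLp (4 / 3) 4 (memLp_pastCut hF t).ofReal (memLp_propagated t ψ)
  have h1 : ∀ x : E3, ∫⁻ y, ‖(F (t - ‖y‖, x) : ℂ) * φ (x - y)‖ₑ ∂coneMeasure ≤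
      ENNReal.ofReal (4 * Real.pi) * ∫⁻ s, ‖(pastCut F t (s, x) : ℂ) *
        SchwartzMap.fourierMultiplierCLM ℂ (sinSymbol (t - s)) ψ x‖ₑ := fun x => by
    have h2 := lintegral_coneMeasure_mul_le (h := fun r => F (t - r, x))
      (hFm.comp (by fun_prop)) hψ x
    have h3 : ∫⁻ r in Set.Ioi 0, ‖F (t - r, x)‖ₑ *
        ‖SchwartzMap.fourierMultiplierCLM ℂ (sinSymbol r) ψ x‖ₑ =
        ∫⁻ s, ‖(pastCut F t (s, x) : ℂ) *
        SchwartzMap.fourierMultiplierCLM ℂ (sinSymbol (t - s)) ψ x‖ₑ := by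
      refine Eq.trans ?_ (lintegral_sub_left_eq_self _ t)
      rw [← lintegral_indicator measurableSet_Ioi]
      refine lintegral_congr fun r => ?_
      rw [pastCut_time_sub, sub_sub_cancel, enorm_mul]
      by_cases hr : r ∈ Set.Ioi (0 : ℝ)
      · rw [Set.indicator_of_mem hr, Set.indicator_of_mem hr, ← ofReal_norm, ← ofReal_norm,
          ← ofReal_norm (_ : ℂ), Complex.norm_real]
      · rw [Set.indicator_of_notMem hr, Set.indicator_of_notMem hr]
        simp
    rw [← h3]
    refine le_trans (lintegral_mono fun y => ?_) h2
    rw [enorm_mul, ← ofReal_norm, ← ofReal_norm, ← ofReal_norm, ← ofReal_norm, Complex.norm_real]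
    gcongr
    exact hφ _
  refine (lintegral_mono h1).trans_lt ?_
  rw [lintegral_const_mul' _ _ ENNReal.ofReal_ne_top]
  refine ENNReal.mul_lt_top ENNReal.ofReal_lt_top ?_
  have h4 := hint.2
  rw [HasFiniteIntegral, Measure.volume_eq_prod, lintegral_prod_symm] at h4
  · exact h4
  · rw [← Measure.volume_eq_prod]
    exact hint.1.enorm

/-- The reflected shear `(y, x) ↦ (-y, x - y)`. -/
lemma measurePreserving_reflect_shear : MeasurePreserving (fun q : E3 × E3 => (-q.1, q.2 - q.1))
    (coneMeasure.prod volume) (coneMeasure.prod volume) :=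
  measurePreserving_neg_coneMeasure.skew_product (g := fun y x => x - y) (by fun_prop)
    (.of_forall fun y => (measurePreserving_sub_right volume y).map_eq)

lemma measurableEmbedding_reflect_shear :
    MeasurableEmbedding (fun q : E3 × E3 => (-q.1, q.2 - q.1)) :=
  (MeasurableEquiv.ofInvolutive _ (fun q => by simp) (by fun_prop)).measurableEmbedding

lemma integrable_retarded_shear {F : ℝ × E3 → ℝ} (hFm : Measurable F)
    (hF : MemLp F (4 / 3) volume) (t : ℝ) {φ ψ : 𝓢(E3, ℂ)} (hψ : ∀ x, ∃ r : ℝ, 0 ≤ r ∧ ψ x = r)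
    (hφ : ∀ x, ‖φ x‖ ≤ ‖ψ x‖) :
    Integrable (fun q : E3 × E3 => (F (t - ‖q.1‖, q.2 - q.1) : ℂ) * φ q.2)
      (coneMeasure.prod volume) := by
  have h := (measurePreserving_reflect_shear.integrable_comp_emb
    measurableEmbedding_reflect_shear).2 (integrable_retarded_kernel hFm hF t hψ hφ)
  refine h.congr (.of_forall fun q => ?_)
  simp

lemma integral_retarded_inner (F : ℝ × E3 → ℝ) (t : ℝ) (x : E3) (c : ℂ) :
    ∫ y, (F (t - ‖y‖, x - y) : ℂ) * c ∂coneMeasure = 4 * Real.pi * ((retarded F (t, x) : ℂ) * c) := by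
  have hpi : (Real.pi : ℂ) ≠ 0 := by exact_mod_cast Real.pi_ne_zero
  rw [integral_mul_const, integral_complex_ofReal, retarded]
  push_cast
  field_simp

lemma integrable_retarded_mul {F : ℝ × E3 → ℝ} (hFm : Measurable F)
    (hF : MemLp F (4 / 3) volume) (t : ℝ) {φ ψ : 𝓢(E3, ℂ)} (hψ : ∀ x, ∃ r : ℝ, 0 ≤ r ∧ ψ x = r)
    (hφ : ∀ x, ‖φ x‖ ≤ ‖ψ x‖) : Integrable fun x => (retarded F (t, x) : ℂ) * φ x := by
  have hpi : (Real.pi : ℂ) ≠ 0 := by exact_mod_cast Real.pi_ne_zero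
  have h := (integrable_retarded_shear hFm hF t hψ hφ).integral_prod_right.const_mul
    (4 * Real.pi : ℂ)⁻¹
  refine h.congr (.of_forall fun x => ?_)
  simp only
  rw [integral_retarded_inner]
  field_simp

/-- The retarded solution is the retarded potential. -/
lemma antibox_eq_integral_retarded {F : ℝ × E3 → ℝ} (hFm : Measurable F)
    (hF : MemLp F (4 / 3) volume) (t : ℝ) {φ ψ : 𝓢(E3, ℂ)} (hψ : ∀ x, ∃ r : ℝ, 0 ≤ r ∧ ψ x = r)
    (hφ : ∀ x, ‖φ x‖ ≤ ‖ψ x‖) : antibox F t φ = ∫ x, (retarded F (t, x) : ℂ) * φ x := by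
  have hpi : (4 * Real.pi : ℂ) ≠ 0 := by
    simp [Real.pi_ne_zero]
  have hint : Integrable fun z : ℝ × E3 => (pastCut F t z : ℂ) *
      SchwartzMap.fourierMultiplierCLM ℂ (sinSymbol (t - z.1)) φ z.2 :=
    integrable_mul_of_memLp (4 / 3) 4 (memLp_pastCut hF t).ofReal (memLp_propagated t φ)
  have hker := integrable_retarded_kernel hFm hF t hψ hφ
  rw [Measure.volume_eq_prod] at hint
  -- Kirchhoff's formula at a fixed `x`, with `h(r) = F(t - r, x)` and `r = t - s`. Fubini makes
  -- both sides integrable for almost every `x`.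
  have h1 : ∀ᵐ x : E3, 4 * Real.pi * ∫ s, (pastCut F t (s, x) : ℂ) *
      SchwartzMap.fourierMultiplierCLM ℂ (sinSymbol (t - s)) φ x =
      ∫ y, (F (t - ‖y‖, x) : ℂ) * φ (x - y) ∂coneMeasure := by
    filter_upwards [hint.prod_left_ae, hker.prod_left_ae] with x hx1 hx2
    have h2 : ∀ r, (pastCut F t (t - r, x) : ℂ) *
        SchwartzMap.fourierMultiplierCLM ℂ (sinSymbol (t - (t - r))) φ x =
        (Set.Ioi (0 : ℝ)).indicator (fun r => (F (t - r, x) : ℂ) *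
          SchwartzMap.fourierMultiplierCLM ℂ (sinSymbol r) φ x) r := fun r => by
      rw [pastCut_time_sub, sub_sub_cancel]
      by_cases hr : r ∈ Set.Ioi (0 : ℝ)
      · rw [Set.indicator_of_mem hr, Set.indicator_of_mem hr]
      · rw [Set.indicator_of_notMem hr, Set.indicator_of_notMem hr]
        simp
    have h3 : Integrable fun r => (pastCut F t (t - r, x) : ℂ) *
        SchwartzMap.fourierMultiplierCLM ℂ (sinSymbol (t - (t - r))) φ x := hx1.comp_sub_left t
    simp only [h2] at h3
    rw [integrable_indicator_iff measurableSet_Ioi] at h3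
    have h4 := integral_coneMeasure_mul_schwartz (h := fun r => F (t - r, x))
      (hFm.comp (by fun_prop)) hx2 h3
    rw [h4, ← integral_sub_left_eq_self _ volume t]
    simp only [h2]
    rw [integral_indicator measurableSet_Ioi]
  rw [antibox_eq hF, Measure.volume_eq_prod, integral_prod_symm _ hint]
  refine mul_left_cancel₀ hpi ?_
  rw [← integral_const_mul, integral_congr_ae h1]
  have h5 := integral_prod_symm _ hker
  have h6 := integral_prod_symm _ (integrable_retarded_shear hFm hF t hψ hφ)
  -- The shear moves the translation by `y` from the test function to `F`, which turns the dual form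
  -- of the formula into the retarded potential.
  have h7 := measurePreserving_reflect_shear.integral_comp measurableEmbedding_reflect_shear
    (fun q : E3 × E3 => (F (t - ‖q.1‖, q.2) : ℂ) * φ (q.2 - q.1))
  simp only [norm_neg, sub_neg_eq_add, sub_add_cancel] at h7
  rw [← h5, ← h7, h6, ← integral_const_mul]
  refine integral_congr_ae (.of_forall fun x => ?_)
  exact integral_retarded_inner F t x (φ x)

lemma exists_dominating_bump {φ : 𝓢(E3, ℂ)} (hφ : HasCompactSupport φ) :
    ∃ ψ : 𝓢(E3, ℂ), (∀ x, ∃ r : ℝ, 0 ≤ r ∧ ψ x = r) ∧ ∀ x, ‖φ x‖ ≤ ‖ψ x‖ := by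
  obtain ⟨R, hR⟩ := hφ.isCompact.isBounded.subset_closedBall 0
  obtain ⟨χ, -, hχ, hχ1⟩ := exists_schwartz_bump (R := max R 1) (by positivity)
  set M := ‖φ.toBoundedContinuousFunction‖ with hM
  refine ⟨(M : ℂ) • χ, fun x => ?_, fun x => ?_⟩
  · obtain ⟨r, hr, -, hr1⟩ := hχ x
    exact ⟨M * r, by positivity, by rw [smul_apply, hr1]; simp⟩
  · by_cases hx : x ∈ tsupport φ
    · rw [smul_apply, hχ1 x ((mem_closedBall_zero_iff.1 (hR hx)).trans (le_max_left _ _)),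
        smul_eq_mul, mul_one, Complex.norm_real, Real.norm_of_nonneg (norm_nonneg _)]
      exact φ.toBoundedContinuousFunction.norm_coe_le_norm x
    · rw [image_eq_zero_of_notMem_tsupport hx, norm_zero]
      exact norm_nonneg _

lemma locallyIntegrable_retarded {F : ℝ × E3 → ℝ} (hFm : Measurable F)
    (hF : MemLp F (4 / 3) volume) (t : ℝ) :
    LocallyIntegrable fun x => (retarded F (t, x) : ℂ) :=
  locallyIntegrable_of_forall_schwartz fun φ hφ => by
    obtain ⟨ψ, hψ, hφψ⟩ := exists_dominating_bump hφ
    exact integrable_retarded_mul hFm hF t hψ hφψ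

/-- On almost every time slice the two functions have the same integrals against test functions of
compact support, which have a dominating bump; this suffices for locally integrable functions. -/
lemma Represents.ae_eq_retarded {F w : ℝ × E3 → ℝ} (hFm : Measurable F)
    (hF : MemLp F (4 / 3) volume) (hw : Represents w (antibox F)) : w =ᵐ[volume] retarded F := by
  refine ae_eq_of_forall_slice hw.1.1 (measurable_retarded hFm).aestronglyMeasurable ?_
  filter_upwards [hw.2, ae_memLp_slice hw.1] with t ht hm
  have h1 := ae_eq_of_forall_schwartz (G := fun x => (w (t, x) : ℂ))
    (G' := fun x => (retarded F (t, x) : ℂ)) (hm.ofReal.locallyIntegrable (by norm_num))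
    (locallyIntegrable_retarded hFm hF t) fun φ hφ => by
      obtain ⟨ψ, hψ, hφψ⟩ := exists_dominating_bump hφ
      simp_rw [mul_comm (φ _)]
      rw [ht, antibox_eq_integral_retarded hFm hF t hψ hφψ]
  filter_upwards [h1] with x hx
  exact_mod_cast hx

/-! ### Approximation by compactly supported test functions -/

/-- On the unit ball the transform is bounded by `‖ψ‖₁` and the cone measure is finite; outside it
the weight `1/|ξ|` is at most 1 and Plancherel applies. -/
lemma eLpNorm_fourierInv_coneMeasure_le (ψ : 𝓢(E3, ℂ)) :
    eLpNorm (fun ξ => 𝓕⁻ ψ ξ) 2 coneMeasure ^ 2 ≤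
      coneMeasure (Metric.closedBall 0 1) * eLpNorm ψ 1 volume ^ 2 + eLpNorm ψ 2 volume ^ 2 := by
  have hm : Measurable fun ξ => ‖𝓕⁻ ψ ξ‖ₑ ^ (2 : ℝ) :=
    (𝓕⁻ ψ).continuous.measurable.enorm.pow_const _
  have hB : MeasurableSet (Metric.closedBall (0 : E3) 1) := Metric.isClosed_closedBall.measurableSet
  rw [← lintegral_enorm_sq, ← lintegral_add_compl _ hB]
  refine add_le_add ?_ ?_
  · have h1 : ∀ ξ, ‖𝓕⁻ ψ ξ‖ₑ ≤ eLpNorm ψ 1 volume := fun ξ => by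
      rw [SchwartzMap.fourierInv_coe, Real.fourierInv_eq', eLpNorm_one_eq_lintegral_enorm]
      refine (enorm_integral_le_lintegral_enorm _).trans (lintegral_mono fun x => ?_)
      rw [enorm_smul, ← ofReal_norm, Complex.norm_exp_ofReal_mul_I]
      simp
    refine (lintegral_mono fun ξ => ENNReal.rpow_le_rpow (h1 ξ) zero_le_two).trans_eq ?_
    rw [setLIntegral_const, mul_comm, ENNReal.rpow_two]
  · rw [coneMeasure, restrict_withDensity hB.compl, lintegral_withDensity_eq_lintegral_mul₀
      (by fun_prop) hm.aemeasurable]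
    calc _ ≤ ∫⁻ ξ in (Metric.closedBall (0 : E3) 1)ᶜ, ‖𝓕⁻ ψ ξ‖ₑ ^ (2 : ℝ) := by
          refine setLIntegral_mono hm fun ξ hξ => ?_
          have h2 : 1 < ‖ξ‖ := by simpa using hξ
          rw [Pi.mul_apply]
          refine mul_le_of_le_one_left zero_le ?_
          rw [ENNReal.ofReal_le_one]
          exact inv_le_one_of_one_le₀ h2.le
      _ ≤ ∫⁻ ξ, ‖𝓕⁻ ψ ξ‖ₑ ^ (2 : ℝ) := setLIntegral_le_lintegral _ _
      _ = eLpNorm ψ 2 volume ^ 2 := by rw [lintegral_enorm_sq, eLpNorm_fourierInv_schwartz]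

/-- Test functions of compact support approximate a Schwartz function. -/
lemma exists_seq_hasCompactSupport (φ : 𝓢(E3, ℂ)) : ∃ ψ : ℕ → 𝓢(E3, ℂ),
    (∀ n, HasCompactSupport (ψ n)) ∧ ∀ p : ℝ≥0∞, p ≠ 0 → p ≠ ∞ →
      Tendsto (fun n => eLpNorm (ψ n - φ) p volume) atTop (𝓝 0) := by
  choose χ hχc hχ hχ1 using fun n : ℕ => exists_schwartz_bump (R := n + 1) (by positivity)
  have hc : ∀ n, HasCompactSupport fun x => χ n x * φ x := fun n => (hχc n).mul_right
  refine ⟨fun n => (hc n).toSchwartzMap ((χ n).smooth'.mul φ.smooth'), hc, fun p hp0 hp => ?_⟩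
  refine tendsto_eLpNorm_of_dominated hp0 hp (φ.memLp p volume)
    (fun n => (Continuous.aestronglyMeasurable (by fun_prop))) (fun n x => ?_)
    (.of_forall fun x => ?_)
  · change ‖χ n x * φ x - φ x‖ ≤ ‖φ x‖
    obtain ⟨r, hr0, hr1, hr⟩ := hχ n x
    rw [hr, ← sub_one_mul, norm_mul, ← Complex.ofReal_one, ← Complex.ofReal_sub, Complex.norm_real]
    refine mul_le_of_le_one_left (norm_nonneg _) ?_
    rw [Real.norm_eq_abs, abs_le]
    constructor <;> linarith
  · refine tendsto_const_nhds.congr' ?_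
    filter_upwards [eventually_ge_atTop ⌈‖x‖⌉₊] with n hn
    change 0 = χ n x * φ x - φ x
    rw [hχ1 n x, one_mul, sub_self]
    have : ‖x‖ ≤ n := (Nat.le_ceil _).trans (by exact_mod_cast hn)
    linarith

lemma wavePair_sub_right {a : E3 → ℂ} (ha : MemLp a 2 coneMeasure) (φ ψ : 𝓢(E3, ℂ)) :
    wavePair a (φ - ψ) = wavePair a φ - wavePair a ψ := by
  obtain ⟨f, hf⟩ := exists_hasProfile ha
  rw [← hf.fst_apply, ← hf.fst_apply, ← hf.fst_apply, map_sub]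

/-- The converse of `Represents.ae_eq_retarded`. Kirchhoff's formula gives the identity for test
functions of compact support. It extends to all Schwartz functions because the left side is
continuous in the `L^{4/3}` norm of the test function and the right side in the `L²(dξ/|ξ|)` norm of
its transform. -/
lemma represents_antibox {F w : ℝ × E3 → ℝ} (hFm : Measurable F)
    (hF : MemLp F (4 / 3) volume) (hw : MemLp w 4 volume) (hwF : w =ᵐ[volume] retarded F) :
    Represents w (antibox F) := by
  refine ⟨hw, ?_⟩
  obtain ⟨c, hc, hcF, -⟩ := exists_antibox_profile hF
  have hwF' := hwF
  rw [Measure.volume_eq_prod] at hwF'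
  filter_upwards [ae_memLp_slice hw, Measure.ae_ae_of_ae_prod hwF'] with t hmr ht φ
  have hm : MemLp (fun x => (w (t, x) : ℂ)) 4 volume := hmr.ofReal
  obtain ⟨ψ, hψc, hψ⟩ := exists_seq_hasCompactSupport φ
  have h1 : ∀ n, ∫ x : E3, (w (t, x) : ℂ) * ψ n x = antibox F t (ψ n) := fun n => by
    obtain ⟨χ, hχ, hψχ⟩ := exists_dominating_bump (hψc n)
    rw [antibox_eq_integral_retarded hFm hF t hχ hψχ]
    refine integral_congr_ae ?_
    filter_upwards [ht] with x hx
    rw [hx]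
  have h2 : Tendsto (fun n => ∫ x : E3, (w (t, x) : ℂ) * ψ n x) atTop
      (𝓝 (∫ x : E3, (w (t, x) : ℂ) * φ x)) := by
    rw [tendsto_iff_edist_tendsto_0]
    have h3 := ENNReal.Tendsto.const_mul (a := eLpNorm (fun x => (w (t, x) : ℂ)) 4 volume)
      (hψ (4 / 3) four_thirds_ne_zero four_thirds_ne_top) (.inr hm.2.ne)
    rw [mul_zero] at h3
    refine tendsto_of_tendsto_of_tendsto_of_le_of_le tendsto_const_nhds h3 (fun i => zero_le)
      fun n => ?_
    simp only [edist_eq_enorm_sub]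
    rw [← integral_sub (integrable_mul_of_memLp 4 (4 / 3) hm ((ψ n).memLp _ _))
      (integrable_mul_of_memLp 4 (4 / 3) hm (φ.memLp _ _))]
    simp_rw [← mul_sub]
    exact enorm_integral_mul_le 4 (4 / 3) hm.1
      (((ψ n).memLp (4 / 3) volume).sub (φ.memLp (4 / 3) volume)).1
  have h4 : Tendsto (fun n => antibox F t (ψ n)) atTop (𝓝 (antibox F t φ)) := by
    simp_rw [hcF]
    have hct := memLp_propag t (hc t)
    rw [tendsto_iff_edist_tendsto_0]
    have h5 : Tendsto (fun n => eLpNorm (fun ξ => 𝓕⁻ (ψ n - φ) ξ) 2 coneMeasure ^ 2) atTop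
        (𝓝 0) := by
      have h6 := (ENNReal.Tendsto.const_mul (a := coneMeasure (Metric.closedBall 0 1))
        (ENNReal.Tendsto.pow (n := 2) (hψ 1 one_ne_zero ENNReal.one_ne_top))
        (.inr (isCompact_closedBall (0 : E3) 1).measure_lt_top.ne)).add
        (ENNReal.Tendsto.pow (n := 2) (hψ 2 two_ne_zero ENNReal.ofNat_ne_top))
      have h0 : coneMeasure (Metric.closedBall 0 1) * 0 ^ 2 + (0 : ℝ≥0∞) ^ 2 = 0 := by simp
      rw [h0] at h6
      exact tendsto_of_tendsto_of_tendsto_of_le_of_le tendsto_const_nhds h6 (fun i => zero_le)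
        fun n => eLpNorm_fourierInv_coneMeasure_le (ψ n - φ)
    have h7 : Tendsto (fun n => eLpNorm (fun ξ => 𝓕⁻ (ψ n - φ) ξ) 2 coneMeasure) atTop (𝓝 0) := by
      have := h5.ennrpow_const (1 / 2)
      simp_rw [← ENNReal.rpow_natCast, ← ENNReal.rpow_mul] at this
      simpa using this
    have h8 := ENNReal.Tendsto.const_mul (a := 2 * eLpNorm (propag t (c t)) 2 coneMeasure) h7
      (.inr (ENNReal.mul_ne_top (by simp) hct.2.ne))
    rw [mul_zero] at h8
    refine tendsto_of_tendsto_of_tendsto_of_le_of_le tendsto_const_nhds h8 (fun i => zero_le)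
      fun n => ?_
    simp only [edist_eq_enorm_sub]
    rw [← wavePair_sub_right hct]
    exact enorm_wavePair_le hct _
  simp_rw [h1] at h2
  exact tendsto_nhds_unique h2 h4

/-! ### The action of the Poincaré transformations and dilations -/

lemma map_smul_coneMeasure {c : ℝ} (hc : 0 < c) :
    coneMeasure.map (c • ·) = ENNReal.ofReal (c ^ 2)⁻¹ • coneMeasure := by
  refine Measure.ext_of_lintegral _ fun f hf => ?_
  have hm : Measurable fun y : E3 => ENNReal.ofReal ‖y‖⁻¹ * f y := by fun_prop
  have h1 := lintegral_map (μ := (volume : Measure E3)) hm (measurable_const_smul c)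
  rw [Measure.map_addHaar_smul _ hc.ne', lintegral_smul_measure] at h1
  rw [lintegral_map hf (measurable_const_smul c), lintegral_smul_measure, lintegral_coneMeasure,
    lintegral_coneMeasure]
  have h2 : ∀ y : E3, ENNReal.ofReal ‖y‖⁻¹ * f (c • y) =
      ENNReal.ofReal c * (ENNReal.ofReal ‖c • y‖⁻¹ * f (c • y)) := fun y => by
    rw [← mul_assoc, ← ENNReal.ofReal_mul hc.le, norm_smul, Real.norm_of_nonneg hc.le, mul_inv,
      mul_inv_cancel_left₀ hc.ne']
  simp_rw [h2]
  rw [lintegral_const_mul' _ _ ENNReal.ofReal_ne_top, ← h1, smul_eq_mul, ← mul_assoc,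
    ← ENNReal.ofReal_mul hc.le, smul_eq_mul, finrank_euclideanSpace_fin, abs_of_pos (by positivity)]
  congr 2
  field_simp

section Poincare

variable {t₀ : ℝ} {x₀ : E3} {lam : ℝ} {β : E3}

lemma poincare_eq (z : ℝ × E3) :
    poincare t₀ x₀ lam β z = lorentzBoost β (lam • (z - (t₀, x₀))) := rfl

lemma continuous_poincare : Continuous (poincare t₀ x₀ lam β) :=
  continuous_lorentzBoost.comp (by fun_prop)

lemma map_poincare (hlam : 0 < lam) (hβ : ‖β‖ < 1) :
    (volume : Measure (ℝ × E3)).map (poincare t₀ x₀ lam β) =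
      ENNReal.ofReal (lam ^ 4)⁻¹ • volume := by
  have : Measure.IsAddHaarMeasure (volume : Measure (ℝ × E3)) := by
    rw [Measure.volume_eq_prod]
    infer_instance
  have h : poincare t₀ x₀ lam β = lorentzBoost β ∘ (lam • ·) ∘ fun z => z - (t₀, x₀) := rfl
  rw [h, ← Measure.map_map continuous_lorentzBoost.measurable (by fun_prop),
    ← Measure.map_map (by fun_prop) (by fun_prop), map_sub_right_eq_self,
    Measure.map_addHaar_smul _ hlam.ne', Measure.map_smul, (measurePreserving_lorentzBoost hβ).map_eq]
  have hr : Module.finrank ℝ (ℝ × E3) = 4 := by simp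
  rw [hr, abs_of_pos (by positivity)]

lemma quasiMeasurePreserving_poincare (hlam : 0 < lam) (hβ : ‖β‖ < 1) :
    Measure.QuasiMeasurePreserving (poincare t₀ x₀ lam β) volume volume :=
  ⟨continuous_poincare.measurable, by
    rw [map_poincare hlam hβ]
    exact Measure.smul_absolutelyContinuous⟩

lemma eLpNorm_comp_poincare (hlam : 0 < lam) (hβ : ‖β‖ < 1) {u : ℝ × E3 → ℝ}
    (hu : AEStronglyMeasurable u) {p : ℝ≥0∞} (hp : p ≠ ∞) :
    eLpNorm (fun z => u (poincare t₀ x₀ lam β z)) p volume =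
      ENNReal.ofReal (lam ^ 4)⁻¹ ^ (1 / p).toReal * eLpNorm u p volume := by
  have h := eLpNorm_map_measure (p := p) (f := poincare t₀ x₀ lam β) (g := u) (μ := volume)
    (by rw [map_poincare hlam hβ]; exact hu.smul_measure _) continuous_poincare.aemeasurable
  rw [map_poincare hlam hβ, eLpNorm_smul_measure_of_ne_top hp, smul_eq_mul] at h
  exact h.symm

lemma eLpNorm_poincareAct (hlam : 0 < lam) (hβ : ‖β‖ < 1) {u : ℝ × E3 → ℝ}
    (hu : AEStronglyMeasurable u) :
    eLpNorm (poincareAct t₀ x₀ lam β u) 4 volume = eLpNorm u 4 volume := by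
  change eLpNorm (lam • fun z => u (poincare t₀ x₀ lam β z)) 4 volume = _
  rw [eLpNorm_const_smul, eLpNorm_comp_poincare hlam hβ hu (by simp), ← mul_assoc,
    Real.enorm_eq_ofReal hlam.le, ENNReal.ofReal_rpow_of_pos (by positivity),
    ← ENNReal.ofReal_mul hlam.le]
  have : lam * (lam ^ 4)⁻¹ ^ ((1 / 4 : ℝ≥0∞)).toReal = 1 := by
    rw [← inv_pow, ← Real.rpow_natCast, ← Real.rpow_mul (by positivity)]
    norm_num
    exact mul_inv_cancel₀ hlam.ne'
  rw [this, ENNReal.ofReal_one, one_mul]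

lemma memLp_comp_poincare (hlam : 0 < lam) (hβ : ‖β‖ < 1) {u : ℝ × E3 → ℝ} {p : ℝ≥0∞}
    (hp : p ≠ ∞) (hu : MemLp u p volume) :
    MemLp (fun z => u (poincare t₀ x₀ lam β z)) p volume :=
  ⟨hu.1.comp_quasiMeasurePreserving (quasiMeasurePreserving_poincare hlam hβ), by
    rw [eLpNorm_comp_poincare hlam hβ hu.1 hp]
    exact ENNReal.mul_lt_top (ENNReal.rpow_lt_top_of_nonneg ENNReal.toReal_nonneg
      ENNReal.ofReal_ne_top) hu.2⟩

lemma memLp_poincareAct (hlam : 0 < lam) (hβ : ‖β‖ < 1) {u : ℝ × E3 → ℝ} {p : ℝ≥0∞}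
    (hp : p ≠ ∞) (hu : MemLp u p volume) : MemLp (poincareAct t₀ x₀ lam β u) p volume :=
  (memLp_comp_poincare hlam hβ hp hu).const_mul lam

lemma poincareAct_congr_ae (hlam : 0 < lam) (hβ : ‖β‖ < 1) {u v : ℝ × E3 → ℝ}
    (h : u =ᵐ[volume] v) : poincareAct t₀ x₀ lam β u =ᵐ[volume] poincareAct t₀ x₀ lam β v := by
  filter_upwards [(quasiMeasurePreserving_poincare (t₀ := t₀) (x₀ := x₀) hlam hβ).ae_eq_comp h]
    with z hz
  simp only [Function.comp_apply] at hz
  simp only [poincareAct, hz]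

/-! ### Covariance of the retarded solution -/

/-- As `Λ` is affine, `Λ(z - (|y|, y)) = Λz - L^β(λ|y|, λy)`, and the subtracted vector is the cone
point over `coneBoost β (λ y)`. The boost preserves the measure and the dilation contributes `λ²`,
which with the prefactor `λ` gives `λ³`. -/
lemma retarded_comp_poincare (hlam : 0 < lam) (hβ : ‖β‖ < 1) {F : ℝ × E3 → ℝ} (hF : Measurable F)
    (z : ℝ × E3) : lam * retarded F (poincare t₀ x₀ lam β z) =
      retarded (fun z => lam ^ 3 * F (poincare t₀ x₀ lam β z)) z := by
  have h1 : ∀ y : E3, ((poincare t₀ x₀ lam β z).1 - ‖coneBoost β (lam • y)‖,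
      (poincare t₀ x₀ lam β z).2 - coneBoost β (lam • y)) =
      poincare t₀ x₀ lam β (z.1 - ‖y‖, z.2 - y) := fun y => by
    have h2 : ((‖lam • y‖, lam • y) : ℝ × E3) = lam • (‖y‖, y) := by
      rw [norm_smul, Real.norm_of_nonneg hlam.le]
      rfl
    have h3 : ((z.1 - ‖y‖, z.2 - y) : ℝ × E3) - (t₀, x₀) = (z - (t₀, x₀)) - (‖y‖, y) := by
      ext1
      · simp only [Prod.fst_sub]
        ring
      · simp only [Prod.snd_sub]
        abel
    rw [poincare_eq, poincare_eq, h3, smul_sub lam (z - (t₀, x₀)), lorentzBoost_sub, ← h2,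
      lorentzBoost_cone hβ]
    rfl
  have hm : Measurable fun y : E3 => F ((poincare t₀ x₀ lam β z).1 - ‖y‖,
      (poincare t₀ x₀ lam β z).2 - y) := hF.comp (by fun_prop)
  have h4 := integral_map (μ := coneMeasure) continuous_coneBoost.aemeasurable
    (f := fun y : E3 => F ((poincare t₀ x₀ lam β z).1 - ‖y‖, (poincare t₀ x₀ lam β z).2 - y))
    (φ := coneBoost β) hm.aestronglyMeasurable
  have h5 := integral_map (μ := coneMeasure) (φ := (lam • ·))
    (measurable_const_smul lam).aemeasurable
    (f := fun y : E3 => F ((poincare t₀ x₀ lam β z).1 - ‖coneBoost β y‖,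
      (poincare t₀ x₀ lam β z).2 - coneBoost β y))
    (hm.comp continuous_coneBoost.measurable).aestronglyMeasurable
  rw [(measurePreserving_coneBoost hβ).map_eq] at h4
  rw [map_smul_coneMeasure hlam, integral_smul_measure,
    ENNReal.toReal_ofReal (by positivity), smul_eq_mul] at h5
  simp_rw [h1] at h5
  rw [retarded, retarded, h4, integral_const_mul, ← h5]
  field_simp

lemma antibox_congr_ae {F F' : ℝ × E3 → ℝ} (h : F =ᵐ[volume] F') : antibox F = antibox F' := by
  funext t φ
  rw [Measure.volume_eq_prod] at h
  refine setIntegral_congr_ae measurableSet_Iio ?_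
  filter_upwards [Measure.ae_ae_of_ae_prod h] with s hs _
  refine integral_congr_ae ?_
  filter_upwards [hs] with x hx
  rw [hx]

lemma Represents.poincareAct_antibox (hlam : 0 < lam) (hβ : ‖β‖ < 1) {F w : ℝ × E3 → ℝ}
    (hF : MemLp F (4 / 3) volume) (hw : Represents w (antibox F)) :
    Represents (poincareAct t₀ x₀ lam β w)
      (antibox fun z => lam ^ 3 * F (poincare t₀ x₀ lam β z)) := by
  -- A light cone is a null set of spacetime, so the retarded potential at a point is not determined
  -- by the class of `F`. A Borel representative is fixed before the pointwise formula is used.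
  obtain ⟨G, hG, hFG⟩ := hF.1.aemeasurable
  have hGF : (fun z => lam ^ 3 * F (poincare t₀ x₀ lam β z)) =ᵐ[volume]
      fun z => lam ^ 3 * G (poincare t₀ x₀ lam β z) := by
    filter_upwards [(quasiMeasurePreserving_poincare (t₀ := t₀) (x₀ := x₀) hlam hβ).ae_eq_comp hFG]
      with z hz
    simp only [Function.comp_apply] at hz
    rw [hz]
  rw [antibox_congr_ae hFG] at hw
  rw [antibox_congr_ae hGF]
  have hG' := hF.ae_eq hFG
  refine represents_antibox ((hG.comp continuous_poincare.measurable).const_mul _)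
    ((memLp_comp_poincare hlam hβ four_thirds_ne_top hG').const_mul _)
    (memLp_poincareAct hlam hβ (by simp) hw.1) ?_
  refine (poincareAct_congr_ae hlam hβ (hw.ae_eq_retarded hG hG')).trans (.of_forall fun z => ?_)
  exact retarded_comp_poincare hlam hβ hG z

/-! ### Covariance of the free waves -/

/-- The action of a Poincaré transformation and dilation on the profiles of free waves. -/
noncomputable def actProfile (t₀ : ℝ) (x₀ : E3) (lam : ℝ) (β : E3) (a : E3 → ℂ) (η : E3) : ℂ :=
  (lam⁻¹ : ℝ) * (coneChar (-(t₀, x₀)) η * a (coneBoost (-β) (lam⁻¹ • η)))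

lemma map_coneBoost_smul (hlam : 0 < lam) (hβ : ‖β‖ < 1) :
    coneMeasure.map (fun η => coneBoost (-β) (lam⁻¹ • η)) =
      ENNReal.ofReal (lam ^ 2) • coneMeasure := by
  have h : (fun η : E3 => coneBoost (-β) (lam⁻¹ • η)) = coneBoost (-β) ∘ (lam⁻¹ • ·) := rfl
  rw [h, ← Measure.map_map continuous_coneBoost.measurable (by fun_prop),
    map_smul_coneMeasure (inv_pos.2 hlam), Measure.map_smul,
    (measurePreserving_coneBoost (by rwa [norm_neg])).map_eq, inv_pow, inv_inv]

lemma measurable_coneBoost_smul : Measurable fun η : E3 => coneBoost (-β) (lam⁻¹ • η) :=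
  continuous_coneBoost.measurable.comp (by fun_prop)

lemma aestronglyMeasurable_map_coneBoost_smul (hlam : 0 < lam) (hβ : ‖β‖ < 1) {a : E3 → ℂ}
    (ha : AEStronglyMeasurable a coneMeasure) : AEStronglyMeasurable a
      (coneMeasure.map (fun η => coneBoost (-β) (lam⁻¹ • η))) := by
  rw [map_coneBoost_smul hlam hβ]
  exact ha.smul_measure _

lemma aestronglyMeasurable_actProfile (hlam : 0 < lam) (hβ : ‖β‖ < 1) {a : E3 → ℂ}
    (ha : AEStronglyMeasurable a coneMeasure) :
    AEStronglyMeasurable (actProfile t₀ x₀ lam β a) coneMeasure := by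
  have h1 : AEStronglyMeasurable (coneChar (-(t₀, x₀))) coneMeasure :=
    Continuous.aestronglyMeasurable (by fun_prop)
  exact (h1.mul ((aestronglyMeasurable_map_coneBoost_smul hlam hβ ha).comp_measurable
    measurable_coneBoost_smul)).const_mul _

lemma eLpNorm_actProfile_eq (hlam : 0 < lam) (hβ : ‖β‖ < 1) {a : E3 → ℂ}
    (ha : AEStronglyMeasurable a coneMeasure) {p : ℝ≥0∞} (hp : p ≠ ∞) :
    eLpNorm (actProfile t₀ x₀ lam β a) p coneMeasure =
      ENNReal.ofReal lam⁻¹ * (ENNReal.ofReal (lam ^ 2) ^ (1 / p).toReal *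
        eLpNorm a p coneMeasure) := by
  have h1 : eLpNorm (actProfile t₀ x₀ lam β a) p coneMeasure =
      eLpNorm (lam⁻¹ • fun η => a (coneBoost (-β) (lam⁻¹ • η))) p coneMeasure :=
    eLpNorm_congr_norm_ae (.of_forall fun η => by
      rw [actProfile, norm_mul, norm_mul, norm_coneChar, one_mul, Pi.smul_apply, norm_smul,
        Complex.norm_real])
  have h2 := eLpNorm_map_measure (p := p) (aestronglyMeasurable_map_coneBoost_smul hlam hβ ha)
    (measurable_coneBoost_smul (β := β) (lam := lam)).aemeasurable
  rw [map_coneBoost_smul hlam hβ, eLpNorm_smul_measure_of_ne_top hp, smul_eq_mul] at h2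
  rw [h1, eLpNorm_const_smul, Real.enorm_eq_ofReal (by positivity), h2]
  rfl

/-- The phase has modulus 1 and the boost preserves the measure; the dilation contributes `λ` to the
`L²` norm, which the prefactor `λ⁻¹` cancels. -/
lemma eLpNorm_actProfile (hlam : 0 < lam) (hβ : ‖β‖ < 1) {a : E3 → ℂ}
    (ha : AEStronglyMeasurable a coneMeasure) :
    eLpNorm (actProfile t₀ x₀ lam β a) 2 coneMeasure = eLpNorm a 2 coneMeasure := by
  rw [eLpNorm_actProfile_eq hlam hβ ha (by simp), ← mul_assoc,
    ENNReal.ofReal_rpow_of_pos (by positivity), ← ENNReal.ofReal_mul (by positivity)]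
  have : lam⁻¹ * (lam ^ 2) ^ ((1 / 2 : ℝ≥0∞)).toReal = 1 := by
    rw [← Real.rpow_natCast, ← Real.rpow_mul hlam.le]
    norm_num
    exact inv_mul_cancel₀ hlam.ne'
  rw [this, ENNReal.ofReal_one, one_mul]

lemma memLp_actProfile (hlam : 0 < lam) (hβ : ‖β‖ < 1) {a : E3 → ℂ}
    (ha : MemLp a 2 coneMeasure) : MemLp (actProfile t₀ x₀ lam β a) 2 coneMeasure :=
  ⟨aestronglyMeasurable_actProfile hlam hβ ha.1, by
    rw [eLpNorm_actProfile hlam hβ ha.1]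
    exact ha.2⟩

lemma integrable_actProfile (hlam : 0 < lam) (hβ : ‖β‖ < 1) {a : E3 → ℂ}
    (ha : Integrable a coneMeasure) : Integrable (actProfile t₀ x₀ lam β a) coneMeasure := by
  rw [← memLp_one_iff_integrable] at ha ⊢
  refine ⟨aestronglyMeasurable_actProfile hlam hβ ha.1, ?_⟩
  rw [eLpNorm_actProfile_eq hlam hβ ha.1 (by simp)]
  exact ENNReal.mul_lt_top ENNReal.ofReal_lt_top (ENNReal.mul_lt_top
    (ENNReal.rpow_lt_top_of_nonneg ENNReal.toReal_nonneg ENNReal.ofReal_ne_top) ha.2)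

lemma actProfile_sub (a b : E3 → ℂ) : actProfile t₀ x₀ lam β (a - b) =
    actProfile t₀ x₀ lam β a - actProfile t₀ x₀ lam β b := by
  ext η
  simp only [actProfile, Pi.sub_apply]
  ring

/-- The boost is moved onto the frequency by symmetry, where it undoes the inverse boost. The
dilations cancel, and the translation by `(t₀, x₀)` remains as a phase. -/
lemma coneChar_poincare (hlam : 0 < lam) (hβ : ‖β‖ < 1) (z : ℝ × E3) (η : E3) :
    coneChar (poincare t₀ x₀ lam β z) (coneBoost (-β) (lam⁻¹ • η)) =
      coneChar z η * coneChar (-(t₀, x₀)) η := by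
  rw [← coneChar_add, ← sub_eq_add_neg]
  have h1 := coneBoost_neg_coneBoost (β := -β) (by rwa [norm_neg]) (lam⁻¹ • η)
  rw [neg_neg] at h1
  simp only [coneChar]
  rw [poincare_eq, spacetimeInner_lorentzBoost, lorentzBoost_cone hβ, h1]
  congr 3
  simp only [spacetimeInner, Prod.smul_fst, Prod.smul_snd, inner_smul_left, inner_smul_right,
    norm_smul, Real.norm_of_nonneg (inv_pos.2 hlam).le, smul_eq_mul]
  simp
  field_simp

lemma halfWave_poincare (hlam : 0 < lam) (hβ : ‖β‖ < 1) {a : E3 → ℂ}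
    (ha : Integrable a coneMeasure) (z : ℝ × E3) :
    lam * halfWave a (poincare t₀ x₀ lam β z) = halfWave (actProfile t₀ x₀ lam β a) z := by
  have h1 := integral_map (μ := coneMeasure)
    (measurable_coneBoost_smul (β := β) (lam := lam)).aemeasurable
    (aestronglyMeasurable_map_coneBoost_smul hlam hβ
      (integrable_coneChar_mul ha (poincare t₀ x₀ lam β z)).1)
  rw [map_coneBoost_smul hlam hβ, integral_smul_measure, ENNReal.toReal_ofReal (by positivity)] at h1
  simp_rw [coneChar_poincare hlam hβ] at h1
  have hl : (lam : ℂ) ≠ 0 := by exact_mod_cast hlam.ne'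
  have h2 : ∀ η, coneChar z η * actProfile t₀ x₀ lam β a η = (lam⁻¹ : ℝ) *
      (coneChar z η * coneChar (-(t₀, x₀)) η * a (coneBoost (-β) (lam⁻¹ • η))) := fun η => by
    rw [actProfile]
    ring
  rw [halfWave, halfWave]
  simp_rw [h2]
  rw [integral_const_mul, ← h1, Complex.real_smul]
  push_cast
  field_simp

lemma freeSol_poincare (hlam : 0 < lam) (hβ : ‖β‖ < 1) {a : E3 → ℂ}
    (ha : Integrable a coneMeasure) :
    poincareAct t₀ x₀ lam β (freeSol a) = freeSol (actProfile t₀ x₀ lam β a) := by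
  ext z
  rw [poincareAct, freeSol, freeSol, ← halfWave_poincare hlam hβ ha, Complex.re_ofReal_mul]
  ring

/-- The pointwise identity `freeSol_poincare` needs integrable profiles. The general case is their
limit, since the action is isometric both on `L⁴` of spacetime and on `L²` of the cone. -/
lemma Represents.poincareAct_free (hlam : 0 < lam) (hβ : ‖β‖ < 1) {a : E3 → ℂ}
    (ha : MemLp a 2 coneMeasure) {v : ℝ × E3 → ℝ}
    (hv : Represents v (fun t φ => wavePair (propag t a) φ)) :
    Represents (poincareAct t₀ x₀ lam β v)
      (fun t φ => wavePair (propag t (actProfile t₀ x₀ lam β a)) φ) := by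
  obtain ⟨b, v', hb, hb2, hba, hv', hbv⟩ := exists_seq_freeSol ha
  have hab : ∀ t, Tendsto (fun n => eLpNorm (propag t (b n) - propag t a) 2 coneMeasure) atTop
      (𝓝 0) := fun t => tendsto_eLpNorm_propag_sub t hba
  have hr : Represents v' (fun t φ => wavePair (propag t a) φ) :=
    represents_of_tendsto (fun n => represents_freeSol (hb n) (hb2 n)) hv' hbv fun t φ =>
      tendsto_wavePair (fun n => memLp_propag t (hb2 n)) (memLp_propag t ha) (hab t) φ
  refine Represents.congr_ae ?_ (poincareAct_congr_ae hlam hβ (hr.ae_eq hv))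
  refine represents_of_tendsto (fun n => represents_freeSol
    (integrable_actProfile (t₀ := t₀) (x₀ := x₀) hlam hβ (hb n))
    (memLp_actProfile hlam hβ (hb2 n))) (memLp_poincareAct hlam hβ (by simp) hv') ?_ fun t φ => ?_
  · refine hbv.congr fun n => ?_
    have hm := (represents_freeSol (hb n) (hb2 n)).1.sub hv'
    rw [← eLpNorm_poincareAct (t₀ := t₀) (x₀ := x₀) hlam hβ hm.1, ← freeSol_poincare hlam hβ (hb n)]
    congr 1
    ext z
    simp only [poincareAct, Pi.sub_apply, mul_sub]
  · refine tendsto_wavePair (fun n => memLp_propag t (memLp_actProfile hlam hβ (hb2 n)))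
      (memLp_propag t (memLp_actProfile hlam hβ ha)) (tendsto_eLpNorm_propag_sub t ?_) φ
    refine hba.congr fun n => ?_
    rw [← actProfile_sub, eLpNorm_actProfile hlam hβ ((hb2 n).sub ha).1]

end Poincare

/-! ### Uniqueness of the curves represented by a function -/

/-- A function determines its slices only for almost every time. Differentiability makes both curves
continuous, so they agree at all times, and hence so do their derivatives. -/
lemma Represents.eq_of_hasDerivAt {w : ℝ × E3 → ℝ} {W W' V V' : ℝ → 𝓢(E3, ℂ) → ℂ}
    (h : Represents w W) (h' : Represents w W')
    (hW : ∀ t φ, HasDerivAt (fun s => W s φ) (V t φ) t)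
    (hW' : ∀ t φ, HasDerivAt (fun s => W' s φ) (V' t φ) t) (t : ℝ) (φ : 𝓢(E3, ℂ)) :
    W t φ = W' t φ ∧ V t φ = V' t φ := by
  have h1 : (fun s => W s φ) = fun s => W' s φ := by
    refine (Continuous.ae_eq_iff_eq (μ := (volume : Measure ℝ))
      (continuous_iff_continuousAt.2 fun s => (hW s φ).continuousAt)
      (continuous_iff_continuousAt.2 fun s => (hW' s φ).continuousAt)).1 ?_
    filter_upwards [h.2, h'.2] with s hs hs'
    rw [← hs, ← hs']
  refine ⟨congrFun h1 t, ?_⟩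
  have h2 := hW t φ
  rw [h1] at h2
  exact h2.unique (hW' t φ)

lemma IsPhaseCurve.eq {u : ℝ × E3 → ℝ} {U U' : ℝ → 𝓢'(E3, ℂ) × 𝓢'(E3, ℂ)}
    (h : IsPhaseCurve u U) (h' : IsPhaseCurve u U') : U = U' := by
  have h1 := h.represents.eq_of_hasDerivAt h'.represents h.hasDerivAt h'.hasDerivAt
  funext t
  refine Prod.ext ?_ ?_
  · ext φ
    exact (h1 t φ).1
  · ext φ
    exact (h1 t φ).2

lemma HasPastNorm.eq {u : ℝ × E3 → ℝ} {k ℓ : ℝ≥0} (hk : HasPastNorm u k)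
    (hl : HasPastNorm u ℓ) : k = ℓ := by
  obtain ⟨U, hU, hUk⟩ := hk
  obtain ⟨V, hV, hVl⟩ := hl
  rw [hU.eq hV] at hUk
  exact_mod_cast tendsto_nhds_unique hUk hVl

lemma HasProfile.eq_of_represents_freeWave {f g : 𝓢'(E3, ℂ) × 𝓢'(E3, ℂ)} {a b : E3 → ℂ}
    (hf : HasProfile f a) (hg : HasProfile g b) {w : ℝ × E3 → ℝ}
    (h : Represents w (fun t φ => freeWave f t φ)) (h' : Represents w (fun t φ => freeWave g t φ)) :
    f = g := by
  simp only [hf.freeWave_apply] at h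
  simp only [hg.freeWave_apply] at h'
  have h1 := h.eq_of_hasDerivAt h' (hasDerivAt_wavePair_propag hf.1)
    (hasDerivAt_wavePair_propag hg.1) 0
  simp only [propag_zero] at h1
  refine Prod.ext ?_ ?_
  · ext φ
    rw [hf.fst_apply, hg.fst_apply, (h1 φ).1]
  · ext φ
    rw [hf.snd_apply, hg.snd_apply, (h1 φ).2]

/-! ### The curve of a sum of a free wave and a retarded solution -/

lemma velPair_add {a b : E3 → ℂ} (ha : MemLp a 2 coneMeasure) (hb : MemLp b 2 coneMeasure)
    (φ : 𝓢(E3, ℂ)) : velPair (a + b) φ = velPair a φ + velPair b φ := by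
  obtain ⟨f, hf⟩ := exists_hasProfile (ha.add hb)
  obtain ⟨g, hg⟩ := exists_hasProfile hb
  have h := hf.sub hg
  rw [add_sub_cancel_right] at h
  have h1 : (f - g).2 φ = f.2 φ - g.2 φ := rfl
  rw [← hf.snd_apply, ← hg.snd_apply, ← h.snd_apply, h1, sub_add_cancel]

/-- The curve at time `t` has the profile `a + c t` evolved to time `t`, where `c t` is the profile
of the retarded part. The evolution is unitary and `c t → 0` as `t → -∞`, so the norm tends to that
of `a`. -/
lemma exists_isPhaseCurve {a : E3 → ℂ} (ha : MemLp a 2 coneMeasure) {F u : ℝ × E3 → ℝ}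
    (hF : MemLp F (4 / 3) volume)
    (hu : Represents u (fun t φ => wavePair (propag t a) φ + antibox F t φ)) :
    ∃ U, IsPhaseCurve u U ∧ Tendsto (fun t => ePhaseNorm (U t)) atBot
      (𝓝 (ENNReal.ofReal √(8 * Real.pi) * eLpNorm a 2 coneMeasure)) := by
  obtain ⟨c, hc, hcF, hcb, hcs, hcd⟩ := exists_antibox_profile hF
  have hac : ∀ t, MemLp (a + c t) 2 coneMeasure := fun t => ha.add (hc t)
  choose U hU using fun t => exists_hasProfile (memLp_propag t (hac t))
  have hU1 : ∀ t φ, (U t).1 φ = wavePair (propag t a) φ + wavePair (propag t (c t)) φ :=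
    fun t φ => by
      rw [(hU t).fst_apply, propag_add, wavePair_add (memLp_propag t ha) (memLp_propag t (hc t))]
  have hU2 : ∀ t φ, (U t).2 φ = velPair (propag t a) φ + velPair (propag t (c t)) φ :=
    fun t φ => by
      rw [(hU t).snd_apply, propag_add, velPair_add (memLp_propag t ha) (memLp_propag t (hc t))]
  have hcts : ∀ t, Tendsto (fun s => eLpNorm (c s - c t) 2 coneMeasure) (𝓝 t) (𝓝 0) := fun t => by
    have h := ENNReal.Tendsto.const_mul (a := ENNReal.ofReal strichartzConst)
      (tendsto_eLpNorm_pastCut_sub hF t) (.inr ENNReal.ofReal_ne_top)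
    rw [mul_zero] at h
    exact tendsto_of_tendsto_of_tendsto_of_le_of_le tendsto_const_nhds h (fun s => zero_le)
      fun s => hcs s t
  have hbot : Tendsto (fun t => eLpNorm (c t) 2 coneMeasure) atBot (𝓝 0) := by
    have h := ENNReal.Tendsto.const_mul (a := ENNReal.ofReal strichartzConst)
      (tendsto_eLpNorm_pastCut_atBot hF) (.inr ENNReal.ofReal_ne_top)
    rw [mul_zero] at h
    exact tendsto_of_tendsto_of_tendsto_of_le_of_le tendsto_const_nhds h (fun s => zero_le) hcb
  refine ⟨U, ⟨?_, fun t φ => ?_, fun t => (hU t).memPhaseSpace, fun t => ?_⟩, ?_⟩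
  · simp only [hU1, ← hcF]
    exact hu
  · simp only [hU1, hU2]
    exact (hasDerivAt_wavePair_propag ha t φ).add (hasDerivAt_antibox hF hc hcd t φ)
  · simp only [((hU _).sub (hU t)).ePhaseNorm_eq]
    have h1 := ENNReal.Tendsto.const_mul (a := ENNReal.ofReal √(8 * Real.pi))
      ((tendsto_eLpNorm_propag (hac t) t).add (hcts t)) (.inr ENNReal.ofReal_ne_top)
    rw [add_zero, mul_zero] at h1
    refine tendsto_of_tendsto_of_tendsto_of_le_of_le tendsto_const_nhds h1 (fun s => zero_le)
      fun s => mul_le_mul_right ?_ _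
    -- The first part is the strong continuity of the unitary group on a fixed profile; the second
    -- has the norm of `c s - c t`.
    have h2 : propag s (a + c s) - propag t (a + c t) =
        (propag s (a + c t) - propag t (a + c t)) + propag s (c s - c t) := by
      simp only [propag_add, propag_sub]
      abel
    have h3 := (hc s).sub (hc t)
    rw [h2, ← eLpNorm_propag s (c s - c t)]
    exact eLpNorm_add_le ((memLp_propag s (hac t)).sub (memLp_propag t (hac t))).1
      (memLp_propag s h3).1 one_le_two
  · simp only [(hU _).ePhaseNorm_eq, eLpNorm_propag]
    refine ENNReal.Tendsto.const_mul ?_ (.inr ENNReal.ofReal_ne_top)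
    have h1 := (tendsto_const_nhds (x := eLpNorm a 2 coneMeasure)).add hbot
    have h2 := ENNReal.Tendsto.sub (tendsto_const_nhds (x := eLpNorm a 2 coneMeasure)) hbot
      (.inl ha.2.ne)
    rw [add_zero] at h1
    rw [tsub_zero] at h2
    refine tendsto_of_tendsto_of_tendsto_of_le_of_le h2 h1 (fun t => ?_)
      fun t => eLpNorm_add_le ha.1 (hc t).1 one_le_two
    rw [tsub_le_iff_right]
    have h3 := eLpNorm_sub_le (μ := coneMeasure) (hac t).1 (hc t).1 one_le_two
    rwa [add_sub_cancel_right] at h3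

/-! ### Covariance of the solutions -/

lemma memLp_pow_three {u : ℝ × E3 → ℝ} (hu : MemLp u 4 volume) :
    MemLp (fun z => u z ^ 3) (4 / 3) volume := by
  refine (hu.norm_rpow_div 3).congr_norm (hu.1.pow 3) (.of_forall fun z => ?_)
  simp

lemma antibox_const_mul (k : ℝ) (F : ℝ × E3 → ℝ) (t : ℝ) (φ : 𝓢(E3, ℂ)) :
    antibox (fun z => k * F z) t φ = k * antibox F t φ := by
  simp only [antibox, Complex.ofReal_mul, mul_assoc, integral_const_mul]

section Poincare

variable {σ t₀ : ℝ} {x₀ : E3} {lam : ℝ} {β : E3}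

lemma HasProfile.isTransformedData (hlam : 0 < lam) (hβ : ‖β‖ < 1)
    {f g : 𝓢'(E3, ℂ) × 𝓢'(E3, ℂ)} {a : E3 → ℂ} (hf : HasProfile f a)
    (hg : HasProfile g (actProfile t₀ x₀ lam β a)) : IsTransformedData t₀ x₀ lam β f g := by
  obtain ⟨v, hv⟩ := exists_represents_wavePair hf.1
  refine ⟨hg.memPhaseSpace, v, ?_⟩
  simp only [hf.freeWave_apply, hg.freeWave_apply]
  exact ⟨hv, hv.poincareAct_free hlam hβ hf.1⟩

lemma IsTransformedData.eq (hlam : 0 < lam) (hβ : ‖β‖ < 1) {f g g' : 𝓢'(E3, ℂ) × 𝓢'(E3, ℂ)}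
    (h : IsTransformedData t₀ x₀ lam β f g) (h' : IsTransformedData t₀ x₀ lam β f g') :
    g = g' := by
  obtain ⟨hg, v, hv, hvg⟩ := h
  obtain ⟨hg', v', hv', hvg'⟩ := h'
  obtain ⟨b, hb⟩ := hg.exists_hasProfile
  obtain ⟨b', hb'⟩ := hg'.exists_hasProfile
  exact hb.eq_of_represents_freeWave hb' hvg
    (hvg'.congr_ae (poincareAct_congr_ae hlam hβ (hv'.ae_eq hv)))

lemma existsUnique_isTransformedData (hlam : 0 < lam) (hβ : ‖β‖ < 1)
    {f : 𝓢'(E3, ℂ) × 𝓢'(E3, ℂ)} (hf : MemPhaseSpace f) :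
    ∃! g, IsTransformedData t₀ x₀ lam β f g := by
  obtain ⟨a, ha⟩ := hf.exists_hasProfile
  obtain ⟨g, hg⟩ := exists_hasProfile (memLp_actProfile (t₀ := t₀) (x₀ := x₀) hlam hβ ha.1)
  have h := ha.isTransformedData hlam hβ hg
  exact ⟨g, h, fun g' h' => h'.eq hlam hβ h⟩

lemma IsSolution.represents_poincareAct (hlam : 0 < lam) (hβ : ‖β‖ < 1)
    {f g : 𝓢'(E3, ℂ) × 𝓢'(E3, ℂ)} {u : ℝ × E3 → ℝ} (hu : IsSolution σ f u)
    (hg : IsTransformedData t₀ x₀ lam β f g) : Represents (poincareAct t₀ x₀ lam β u)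
      (fun t φ => freeWave g t φ + (σ : ℂ) *
        antibox (fun z => poincareAct t₀ x₀ lam β u z ^ 3) t φ) := by
  obtain ⟨-, v, hv, hvg⟩ := hg
  -- Subtracting the free wave isolates the retarded term, so that each part can be transformed by
  -- its own covariance.
  have hw : Represents (u + fun z => (-1) * v z) (antibox fun z => σ * u z ^ 3) := by
    have h := hu.fixedPoint.add (hv.const_mul (-1))
    convert h using 3 with t φ
    rw [antibox_const_mul]
    push_cast
    ring
  have h1 := hvg.add (hw.poincareAct_antibox (t₀ := t₀) (x₀ := x₀) hlam hβ
    ((memLp_pow_three hu.memLp).const_mul σ))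
  convert h1 using 1
  · ext z
    simp only [poincareAct, Pi.add_apply]
    ring
  · funext t φ
    rw [← antibox_const_mul]
    congr 3
    ext z
    simp only [poincareAct]
    ring

lemma HasProfile.exists_isPhaseCurve {f : 𝓢'(E3, ℂ) × 𝓢'(E3, ℂ)} {a : E3 → ℂ}
    {u : ℝ × E3 → ℝ} (hf : HasProfile f a) (hu : Represents u
      (fun t φ => freeWave f t φ + (σ : ℂ) * antibox (fun z => u z ^ 3) t φ)) :
    ∃ U, IsPhaseCurve u U ∧ Tendsto (fun t => ePhaseNorm (U t)) atBot (𝓝 (ePhaseNorm f)) := by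
  simp only [hf.freeWave_apply, ← antibox_const_mul] at hu
  rw [hf.ePhaseNorm_eq]
  exact CubicWave.exists_isPhaseCurve hf.1 ((memLp_pow_three hu.1).const_mul σ) hu

lemma HasProfile.hasPastNorm {f : 𝓢'(E3, ℂ) × 𝓢'(E3, ℂ)} {a : E3 → ℂ} {u : ℝ × E3 → ℝ}
    (hf : HasProfile f a) (hu : Represents u
      (fun t φ => freeWave f t φ + (σ : ℂ) * antibox (fun z => u z ^ 3) t φ)) :
    HasPastNorm u (ePhaseNorm f).toNNReal := by
  obtain ⟨U, hU, h⟩ := hf.exists_isPhaseCurve hu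
  exact ⟨U, hU, by rwa [ENNReal.coe_toNNReal hf.memPhaseSpace.1.ne]⟩

lemma IsSolution.poincareAct (hlam : 0 < lam) (hβ : ‖β‖ < 1) {f g : 𝓢'(E3, ℂ) × 𝓢'(E3, ℂ)}
    {u : ℝ × E3 → ℝ} (hu : IsSolution σ f u) (hg : IsTransformedData t₀ x₀ lam β f g) :
    IsSolution σ g (poincareAct t₀ x₀ lam β u) := by
  have h := hu.represents_poincareAct hlam hβ hg
  obtain ⟨b, hb⟩ := hg.1.exists_hasProfile
  obtain ⟨U, hU, -⟩ := hb.exists_isPhaseCurve h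
  exact ⟨h.1, ⟨U, hU⟩, h⟩

/-- Each past limit is the norm of the corresponding datum, and the action on profiles preserves
this norm. -/
lemma IsSolution.exists_hasPastNorm (hlam : 0 < lam) (hβ : ‖β‖ < 1) {f : 𝓢'(E3, ℂ) × 𝓢'(E3, ℂ)}
    {u : ℝ × E3 → ℝ} (hu : IsSolution σ f u) (hf : MemPhaseSpace f) :
    ∃ ℓ, HasPastNorm u ℓ ∧ HasPastNorm (CubicWave.poincareAct t₀ x₀ lam β u) ℓ := by
  obtain ⟨a, ha⟩ := hf.exists_hasProfile
  obtain ⟨g, hg⟩ := exists_hasProfile (memLp_actProfile (t₀ := t₀) (x₀ := x₀) hlam hβ ha.1)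
  have h := hu.represents_poincareAct hlam hβ (ha.isTransformedData hlam hβ hg)
  refine ⟨_, ha.hasPastNorm hu.fixedPoint, ?_⟩
  have hn : ePhaseNorm f = ePhaseNorm g := by
    rw [ha.ePhaseNorm_eq, hg.ePhaseNorm_eq, eLpNorm_actProfile hlam hβ ha.1.1]
  rw [hn]
  exact hg.hasPastNorm h

lemma poincareAct_mem_admissible (hlam : 0 < lam) (hβ : ‖β‖ < 1) {δ : ℝ≥0} {u : ℝ × E3 → ℝ}
    (hu : u ∈ admissible σ δ) : poincareAct t₀ x₀ lam β u ∈ admissible σ δ := by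
  obtain ⟨⟨f, hf, hfu⟩, ℓ, hℓ, hul⟩ := hu
  obtain ⟨k, hk, hk'⟩ := hfu.exists_hasPastNorm (t₀ := t₀) (x₀ := x₀) hlam hβ hf
  obtain ⟨g, hg, -⟩ := existsUnique_isTransformedData (t₀ := t₀) (x₀ := x₀) hlam hβ hf
  exact ⟨⟨g, hg.1, hfu.poincareAct hlam hβ hg⟩, k, (hk.eq hul).trans_le hℓ, hk'⟩

/-- The inverse of a Poincaré transformation with dilation is of the same kind. -/
lemma poincare_poincare_inverse (hlam : 0 < lam) (hβ : ‖β‖ < 1) (z : ℝ × E3) :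
    poincare (-(lam • lorentzBoost β (t₀, x₀)).1) (-(lam • lorentzBoost β (t₀, x₀)).2) lam⁻¹ (-β)
      (poincare t₀ x₀ lam β z) = z := by
  have h : ((-(lam • lorentzBoost β (t₀, x₀)).1, -(lam • lorentzBoost β (t₀, x₀)).2) : ℝ × E3) =
      -(lam • lorentzBoost β (t₀, x₀)) := rfl
  rw [poincare_eq, h, poincare_eq, sub_neg_eq_add, lorentzBoost_smul lam⁻¹,
    lorentzBoost_smul lam, ← smul_add, ← lorentzBoost_add, sub_add_cancel,
    lorentzBoost_smul lam, inv_smul_smul₀ hlam.ne', lorentzBoost_neg_lorentzBoost hβ]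

lemma image_poincareAct_admissible (hlam : 0 < lam) (hβ : ‖β‖ < 1) (δ : ℝ≥0) :
    poincareAct t₀ x₀ lam β '' admissible σ δ = admissible σ δ := by
  refine Set.Subset.antisymm ?_ fun u hu => ?_
  · rintro _ ⟨u, hu, rfl⟩
    exact poincareAct_mem_admissible hlam hβ hu
  -- A preimage is the transform of `u` by the inverse map. Solving `w = λ L^β(z - (t₀, x₀))` for
  -- `z` gives velocity `-β`, dilation `λ⁻¹` and base point `-λ L^β(t₀, x₀)`.
  · refine ⟨_, poincareAct_mem_admissible (t₀ := -(lam • lorentzBoost β (t₀, x₀)).1)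
      (x₀ := -(lam • lorentzBoost β (t₀, x₀)).2) (β := -β) (inv_pos.2 hlam)
      (by rwa [norm_neg]) hu, ?_⟩
    ext z
    rw [poincareAct, poincareAct, poincare_poincare_inverse hlam hβ, mul_inv_cancel_left₀ hlam.ne']

end Poincare

end CubicWave
theorem theorem3p3 (σ : ℝ) (t₀ : ℝ) (x₀ : E3) (lam : ℝ) (β : E3) (hlam : 0 < lam)
    (hβ : ‖β‖ < 1) :
    (∀ (f : 𝓢'(E3, ℂ) × 𝓢'(E3, ℂ)) (u : ℝ × E3 → ℝ), MemPhaseSpace f → IsSolution σ f u →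
      MemLp (poincareAct t₀ x₀ lam β u) 4 volume ∧
      eLpNorm (poincareAct t₀ x₀ lam β u) 4 volume = eLpNorm u 4 volume ∧
      (∃ U, IsPhaseCurve (poincareAct t₀ x₀ lam β u) U) ∧
      (∃! g, IsTransformedData t₀ x₀ lam β f g) ∧
      (∀ g, IsTransformedData t₀ x₀ lam β f g →
        IsSolution σ g (poincareAct t₀ x₀ lam β u)) ∧
      ∃ ℓ : ℝ≥0, HasPastNorm u ℓ ∧ HasPastNorm (poincareAct t₀ x₀ lam β u) ℓ) ∧
    (∀ δ : ℝ≥0,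
      poincareAct t₀ x₀ lam β '' admissible σ δ = admissible σ δ ∧
      maxStrichartz σ δ =
        ⨆ u ∈ admissible σ δ, eLpNorm (poincareAct t₀ x₀ lam β u) 4 volume ^ 4) := by
  refine ⟨fun f u hf hu => ?_, fun δ => ⟨image_poincareAct_admissible hlam hβ δ, ?_⟩⟩
  · have hg := existsUnique_isTransformedData (t₀ := t₀) (x₀ := x₀) hlam hβ hf
    exact ⟨memLp_poincareAct hlam hβ (by simp) hu.memLp, eLpNorm_poincareAct hlam hβ hu.memLp.1,
      (hu.poincareAct hlam hβ hg.choose_spec.1).continuous, hg,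
      fun g hg => hu.poincareAct hlam hβ hg, hu.exists_hasPastNorm hlam hβ hf⟩
  · refine biSup_congr fun u hu => ?_
    obtain ⟨⟨f, -, hu⟩, -⟩ := hu
    rw [eLpNorm_poincareAct hlam hβ hu.memLp.1]
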